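/- Let $W$ be a finite Coxeter group acting essentially as a reflection group on a Euclidean space $V$, with a fixed fundamental chamber $\mathcal C$. Let $S$ be the set of simple reflections, let $(\alpha_s)_{s\in S}$ be simple roots (a basis of $V$; $\alpha_s$ is orthogonal to the wall of $\mathcal C$ fixed by $s$ and points toward $\mathcal C$; its length is arbitrary), and let $\nabla=\{\omega_s : s\in S\}$ be the fundamental weights, defined by $\langle\alpha_s,\omega_t\rangle=\delta_{st}\,\langle\alpha_s,\alpha_s\rangle/2$. Put $q=\sum_{s\in S}\omega_s$ and let $\mathrm{Perm}(W)=\mathrm{conv}\{w(q): w\in W\}$ be the balanced $W$-permutahedron. Let $\mathsf c$ be a reduced expression of a Coxeter element $c$ (the product of all simple reflections, each taken once, in some order), let $w_\circ$ be the longest element of $W$, and let $\mathsf c\mathsf w_\circ(\mathsf c)$ be the concatenation of $\mathsf c$ with the $\mathsf c$-sorting word $\mathsf w_\circ(\mathsf c)=w_1\cdots w_N$ of $w_\circ$ (the lexicographically first, as a sequence of positions, reduced subword of $\mathsf c^\infty=\mathsf c\mathsf c\mathsf c\cdots$ for $w_\circ$). For a word $Q=q_1\cdots q_m$ on $S$,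 the subword complex of $Q$ is the simplicial complex of the sets of positions of $Q$ whose complement contains a reduced expression of $w_\circ$. The brick vector of a facet $I$ of this complex is $\sum_{k=1}^m \sigma_{I,k}(\omega_{q_k})$, where $\sigma_{I,k}$ is the product, in this order, of the $q_z$ with $z<k$ and $z\notin I$, and the brick polytope $\mathcal B(Q)$ is the convex hull of the brick vectors of all facets. For $0\le p\le N$ let $\rho_p=w_1\cdots w_p$ (so $\rho_0=e$), and for $1\le p\le N$ let $\omega_p=\rho_{p-1}(\omega_{w_p})$. Put $\Omega=\sum_{p=1}^N\omega_p$. Then: 1. $\mathcal B(\mathsf c\mathsf w_\circ(\mathsf c))$ is obtained from $\mathrm{Perm}(W)$ by removing all facets that do not meet $\{\rho_p(q) : 0\le p\le N\}$ and then translating by $\Omega$. That is, $\mathcal B(\mathsf c\mathsf w_\circ(\mathsf c))-\Omega$ is the intersection of the half-spaces that contain $\mathrm{Perm}(W)$ and are bounded by the hyperplanes spanned by the facets of $\mathrm{Perm}(W)$ that meet $\{\rho_p(q) : 0\le p\le N\}$. 2. The outer normal vectors of the facets of $\mathcal B(\mathsf c\mathsf w_\circ(\mathsf c))$ are, up to positive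 scalars, exactly the vectors of $\nabla\cup\{\rho_p(\omega_{w_p}) : 1\le p\le N\}$. 3. The nonzero vectors orthogonal to a facet of $\mathcal B(\mathsf c\mathsf w_\circ(\mathsf c))$ are exactly the nonzero real multiples of the vectors of $\nabla\cup\{\omega_p : 1\le p\le N\}$; in other words, up to sign and scaling, the facet normals are $\nabla\cup\{\omega_p : 1\le p\le N\}$. -/

import Mathlib

open Module

noncomputable section

/-- The orthogonal reflection exchanging `v` and `-v` and fixing the hyperplane `vᗮ` pointwise. -/
def reflectionIn {V : Type*} [NormedAddCommGroup V] [InnerProductSpace ℝ V] (v : V) :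
    V ≃ₗᵢ[ℝ] V :=
  (ℝ ∙ v)ᗮ.reflection

/-- The group generated by the reflections orthogonal to the vectors of a basis. -/
def reflectionSubgroup {V : Type*} [NormedAddCommGroup V] [InnerProductSpace ℝ V]
    {B : Type*} (α : Basis B ℝ V) : Subgroup (V ≃ₗᵢ[ℝ] V) :=
  Subgroup.closure (Set.range fun s => reflectionIn (α s))

/-- A finite Coxeter group acting essentially on the Euclidean space `V`, with a fundamental
chamber and a choice of simple roots. The open cone `{x | ∀ s, 0 < ⟪α_s, x⟫}` meets no reflecting
hyperplane of the group `W`, so that its closure is a chamber, the fundamental chamber; its walls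
are the hyperplanes orthogonal to the simple roots `α_s`. The lengths of the simple roots are
arbitrary (they correspond to the choice of the generalized Cartan matrix
`a_st = 2 ⟪α_s, α_t⟫ / ⟪α_s, α_s⟫`). -/
structure CoxeterData (B V : Type*) [NormedAddCommGroup V] [InnerProductSpace ℝ V] where
  /-- the simple roots `α_s` -/
  root : Basis B ℝ V
  finite_group : Finite (reflectionSubgroup root)
  chamber : ∀ v : V, v ≠ 0 → reflectionIn v ∈ reflectionSubgroup root →
    ∀ x : V, (∀ s, 0 < inner ℝ (root s) x) → inner ℝ v x ≠ 0

namespace CoxeterData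

variable {B V : Type*} [NormedAddCommGroup V] [InnerProductSpace ℝ V]

/-- The finite Coxeter group, as a group of isometries of `V`. -/
def W (D : CoxeterData B V) : Subgroup (V ≃ₗᵢ[ℝ] V) := reflectionSubgroup D.root

/-- The simple reflection `s`. -/
def simple (D : CoxeterData B V) (s : B) : V ≃ₗᵢ[ℝ] V := reflectionIn (D.root s)

/-- The fundamental weights: the dual basis to `2 α_s / ⟪α_s, α_s⟫`. -/
def weight [FiniteDimensional ℝ V] (D : CoxeterData B V) (t : B) : V :=
  (inner ℝ (D.root t) (D.root t) / 2) •
    (InnerProductSpace.toDual ℝ V).symm (LinearMap.toContinuousLinearMap (D.root.coord t))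

theorem inner_root_weight [FiniteDimensional ℝ V] [DecidableEq B] (D : CoxeterData B V) (s t : B) :
    inner ℝ (D.root s) (D.weight t) =
      if s = t then inner ℝ (D.root s) (D.root s) / 2 else 0 := by
  rw [real_inner_comm, weight, real_inner_smul_left, InnerProductSpace.toDual_symm_apply]
  by_cases h : s = t
  · subst h; simp
  · simp [h]

/-- The point `q`, the sum of all fundamental weights. -/
def basePoint [FiniteDimensional ℝ V] [Fintype B] (D : CoxeterData B V) : V := ∑ s, D.weight s

/-! ### Words -/

/-- The element of `W` expressed by a word. -/
def wordProd (D : CoxeterData B V) (u : List B) : V ≃ₗᵢ[ℝ] V := (u.map D.simple).prod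

/-- The length of an element of `W`. -/
def length (D : CoxeterData B V) (w : V ≃ₗᵢ[ℝ] V) : ℕ :=
  sInf {k | ∃ u : List B, u.length = k ∧ D.wordProd u = w}

/-- Reduced words. -/
def IsReduced (D : CoxeterData B V) (u : List B) : Prop := u.length = D.length (D.wordProd u)

/-- `w` is the longest element of `W`. -/
def IsLongest (D : CoxeterData B V) (w : V ≃ₗᵢ[ℝ] V) : Prop :=
  w ∈ D.W ∧ ∀ v ∈ D.W, D.length v ≤ D.length w

/-- Coxeter elements: products of all simple reflections, each taken once, in some order. -/
def IsCoxeterElement (D : CoxeterData B V) (w : V ≃ₗᵢ[ℝ] V) : Prop :=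
  ∃ e : List B, e.Nodup ∧ (∀ s, s ∈ e) ∧ D.wordProd e = w

/-- The word `u` is the subword of `c^∞ = c c c ⋯` at the positions `p` (listed increasingly, and
numbered from `0`), and is a reduced expression of `w`. -/
def IsReducedSubwordAt (D : CoxeterData B V) (c : List B) (w : V ≃ₗᵢ[ℝ] V)
    (p : List ℕ) (u : List B) : Prop :=
  p.Pairwise (· < ·) ∧ p.map (fun k => getElem? c (k % c.length)) = u.map some ∧
    D.IsReduced u ∧ D.wordProd u = w

/-- `u` is the `c`-sorting word of `w`: the reduced subword of `c^∞` for `w` whose sequence of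
positions is lexicographically first (`≤` on lists is the lexicographic order). -/
def IsSortingWord (D : CoxeterData B V) (c : List B) (w : V ≃ₗᵢ[ℝ] V) (u : List B) : Prop :=
  ∃ p, D.IsReducedSubwordAt c w p u ∧ ∀ p' u', D.IsReducedSubwordAt c w p' u' → p ≤ p'

/-! ### Subword complexes and brick polytopes -/

/-- The subword of `Q` at the set `J` of positions. -/
def subword (Q : List B) (J : Finset (Fin Q.length)) : List B :=
  ((List.finRange Q.length).filter (· ∈ J)).map Q.get

/-- The faces of the subword complex of `Q` and `w`: the sets of positions whose complement
contains a reduced expression of `w`. -/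
def IsFace (D : CoxeterData B V) (Q : List B) (w : V ≃ₗᵢ[ℝ] V)
    (I : Finset (Fin Q.length)) : Prop :=
  ∃ J : Finset (Fin Q.length), J ⊆ Iᶜ ∧ D.IsReduced (subword Q J) ∧ D.wordProd (subword Q J) = w

/-- The facets of the subword complex of `Q` and `w`. -/
def IsFacet (D : CoxeterData B V) (Q : List B) (w : V ≃ₗᵢ[ℝ] V)
    (I : Finset (Fin Q.length)) : Prop :=
  Maximal (D.IsFace Q w) I

/-- The weight function: the weight `ω` of the `k`-th letter, transformed by the product, in this
order, of the letters at the positions before `k` that are not in `I`. -/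
def weightFunction [FiniteDimensional ℝ V] (D : CoxeterData B V) (Q : List B)
    (I : Finset (Fin Q.length)) (k : Fin Q.length) : V :=
  D.wordProd (subword Q {z | z < k ∧ z ∉ I}) (D.weight (Q.get k))

/-- The brick vector of `I`. -/
def brickVector [FiniteDimensional ℝ V] (D : CoxeterData B V) (Q : List B)
    (I : Finset (Fin Q.length)) : V :=
  ∑ k, D.weightFunction Q I k

/-- The brick polytope of `Q`; the element `w` is the longest element of the group. -/
def brickPolytope [FiniteDimensional ℝ V] (D : CoxeterData B V) (Q : List B)
    (w : V ≃ₗᵢ[ℝ] V) : Set V :=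
  convexHull ℝ {x | ∃ I, D.IsFacet Q w I ∧ x = D.brickVector Q I}

/-- The balanced `W`-permutahedron. -/
def balancedPermutahedron [FiniteDimensional ℝ V] [Fintype B] (D : CoxeterData B V) : Set V :=
  convexHull ℝ {x | ∃ w ∈ D.W, x = w D.basePoint}

/-- The product `ρ_p` of the first `p` letters of the word `u`. -/
def prefixProd (D : CoxeterData B V) (u : List B) (p : ℕ) : V ≃ₗᵢ[ℝ] V := D.wordProd (u.take p)

end CoxeterData

/-! ### Facets of polytopes -/

/-- `F` is a facet of the polytope `P`: a nonempty (exposed) face of codimension one. -/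
def IsPolytopeFacet {V : Type*} [NormedAddCommGroup V] [InnerProductSpace ℝ V]
    (P F : Set V) : Prop :=
  IsExposed ℝ P F ∧ F.Nonempty ∧ finrank ℝ (vectorSpan ℝ F) + 1 = finrank ℝ (vectorSpan ℝ P)

/-- `y` is an outer normal vector of `P` defining the face `F`: the linear form `⟪y, ·⟫` is
maximized over `P` exactly on `F`. -/
def IsOuterNormal {V : Type*} [NormedAddCommGroup V] [InnerProductSpace ℝ V]
    (P F : Set V) (y : V) : Prop :=
  F = {x | x ∈ P ∧ ∀ z ∈ P, inner ℝ y z ≤ inner ℝ y x}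

/-- The result of removing from the full-dimensional polytope `P` all the facets that do not
intersect `X`: the intersection of the supporting half-spaces of the remaining facets. -/
def removeFacetsNotMeeting {V : Type*} [NormedAddCommGroup V] [InnerProductSpace ℝ V]
    (P X : Set V) : Set V :=
  {x | ∀ F, IsPolytopeFacet P F → (F ∩ X).Nonempty →
    ∀ y, IsOuterNormal P F y → ∀ z ∈ F, inner ℝ y x ≤ inner ℝ y z}

end

set_option linter.unusedSectionVars false
set_option linter.unusedFintypeInType false

namespace CoxeterData

variable {B V : Type*} [NormedAddCommGroup V] [InnerProductSpace ℝ V]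

/-! ### Reflections -/

/-! Put `Q = c ++ u`. A facet `I` of the subword complex carries at each position a root and a
weight, and flipping a position of `I` moves the brick vector by a negative multiple of the root
there (`IsFacet.exists_flip`). The theorem follows once the weight at a position `k` is the same for
all facets containing `k` and orthogonal to their roots at the other positions, and the linear forms
given by these weights are maximal at those facets. Each brick vector then has a full set of edge
directions with dual valid facet normals. The elementary duality argument of `VertexSystem` turns
this into the complete list of facets, and it applies equally to the permutahedron.

Constancy of the weight: flips that keep `k` and push the other positions to the left lead every
facet containing `k` to one and the same sink, and the normal data survive such flips
(`HasNormal.of_isFacet`). So it suffices to know them at one facet containing `k`. That facet is a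
prefix facet `I_p`: the last occurrences of all letters among the first `c.length + p` positions.
Its roots are `ρ_p(α_s)`, its weights `ρ_p(ω_s)`, and its brick vector is `Ω + ρ_p(q)`. Passing from
`I_p` to `I_{p+1}` is a single flip (`IsPrefixFacet.succ`), because adjacent letters alternate in
`Q`.

Alternation comes from the orbits of the fundamental weights under the Coxeter element. The root at
the `i`-th occurrence of `t` in `c^∞` is `c^i ω_t - c^(i+1) ω_t`. When it first turns negative, `c^i
ω_t` is a negative multiple of a fundamental weight (`exists_cWeight_mult`). The greedy sorting word
takes exactly the earlier occurrences (`IsReducedSubwordAt.exists_state`).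

Validity: seen from the position `c.length + p`, the walk of `I_p` is below the walk of any facet in
Bruhat order (`IsFacet.bruhatLE`), so `I_p` maximizes every form `ρ_p(ω_s)` summand by summand.
Hence the brick polytope minus `Ω` is cut out by the inequalities of the permutahedron at the
vertices `ρ_p(q)`. Up to sign, the two lists of normals agree because `w₀ ω_t` is a negative
multiple of a fundamental weight. -/

theorem _root_.reflectionIn_apply (v x : V) :
    reflectionIn v x = x - (2 * inner ℝ v x / inner ℝ v v) • v := by
  rw [reflectionIn, Submodule.reflection_orthogonal_apply, Submodule.reflection_singleton_apply,
    real_inner_self_eq_norm_sq]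
  simp only [RCLike.ofReal_real_eq_id, id]
  rw [neg_sub, two_nsmul, ← add_smul]
  congr 2
  ring

theorem _root_.reflectionIn_self (v : V) : reflectionIn v v = -v :=
  Submodule.reflection_orthogonalComplement_singleton_eq_neg (𝕜 := ℝ) v

theorem _root_.reflectionIn_mul_self (v : V) : reflectionIn v * reflectionIn v = 1 :=
  (ℝ ∙ v)ᗮ.reflection_mul_reflection

theorem _root_.reflectionIn_inv (v : V) : (reflectionIn v)⁻¹ = reflectionIn v :=
  inv_eq_of_mul_eq_one_left (reflectionIn_mul_self v)

theorem _root_.LinearIsometryEquiv.mul_app (f g : V ≃ₗᵢ[ℝ] V) (x : V) : (f * g) x = f (g x) := rfl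

theorem _root_.LinearIsometryEquiv.one_app (x : V) : (1 : V ≃ₗᵢ[ℝ] V) x = x := rfl

theorem _root_.LinearIsometryEquiv.inv_app_self (f : V ≃ₗᵢ[ℝ] V) (x : V) : f⁻¹ (f x) = x :=
  f.symm_apply_apply x

theorem _root_.LinearIsometryEquiv.app_inv_self (f : V ≃ₗᵢ[ℝ] V) (x : V) : f (f⁻¹ x) = x :=
  f.apply_symm_apply x

theorem _root_.LinearIsometryEquiv.inner_inv_left (f : V ≃ₗᵢ[ℝ] V) (x y : V) :
    inner ℝ (f⁻¹ x) y = inner ℝ x (f y) := by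
  rw [← f.inner_map_map (f⁻¹ x) y, f.app_inv_self]

theorem _root_.LinearIsometryEquiv.inner_inv_right (f : V ≃ₗᵢ[ℝ] V) (x y : V) :
    inner ℝ x (f⁻¹ y) = inner ℝ (f x) y := by
  rw [← f.inner_map_map x (f⁻¹ y), f.app_inv_self]

theorem _root_.inner_reflectionIn (v x y : V) :
    inner ℝ (reflectionIn v x) y = inner ℝ x (reflectionIn v y) := by
  rw [← LinearIsometryEquiv.inner_inv_left, reflectionIn_inv]

theorem _root_.reflectionIn_smul (v : V) {r : ℝ} (hr : r ≠ 0) :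
    reflectionIn (r • v) = reflectionIn v := by
  ext x
  rw [reflectionIn_apply, reflectionIn_apply, smul_smul, real_inner_smul_left,
    real_inner_smul_left, real_inner_smul_right]
  congr 2
  by_cases hv : (inner ℝ v v : ℝ) = 0
  · rw [hv]; simp
  · field_simp

theorem _root_.reflectionIn_map (f : V ≃ₗᵢ[ℝ] V) (v : V) :
    reflectionIn (f v) * f = f * reflectionIn v := by
  ext x
  rw [LinearIsometryEquiv.mul_app, LinearIsometryEquiv.mul_app, reflectionIn_apply,
    reflectionIn_apply, f.inner_map_map, f.inner_map_map, map_sub, map_smul]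

theorem _root_.reflectionIn_of_inner_eq_zero {v x : V} (h : inner ℝ v x = 0) :
    reflectionIn v x = x := by
  rw [reflectionIn_apply, h]; simp

variable (D : CoxeterData B V)

/-! ### The group and words -/

theorem simple_mem (s : B) : D.simple s ∈ D.W :=
  Subgroup.subset_closure ⟨s, rfl⟩

theorem simple_mul_self (s : B) : D.simple s * D.simple s = 1 := reflectionIn_mul_self _

theorem simple_inv (s : B) : (D.simple s)⁻¹ = D.simple s := reflectionIn_inv _

theorem simple_simple (s : B) (x : V) : D.simple s (D.simple s x) = x := by
  rw [← LinearIsometryEquiv.mul_app, simple_mul_self, LinearIsometryEquiv.one_app]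

theorem simple_root (s : B) : D.simple s (D.root s) = -D.root s := reflectionIn_self _

theorem inner_simple (s : B) (x y : V) :
    inner ℝ (D.simple s x) y = inner ℝ x (D.simple s y) := inner_reflectionIn _ _ _

theorem wordProd_cons (s : B) (u : List B) : D.wordProd (s :: u) = D.simple s * D.wordProd u := by
  simp [wordProd]

theorem wordProd_append (u v : List B) : D.wordProd (u ++ v) = D.wordProd u * D.wordProd v := by
  simp [wordProd]

theorem wordProd_singleton (s : B) : D.wordProd [s] = D.simple s := by
  simp [wordProd]

theorem wordProd_mem (u : List B) : D.wordProd u ∈ D.W := by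
  induction u with
  | nil => exact one_mem _
  | cons s u ih => rw [wordProd_cons]; exact mul_mem (D.simple_mem s) ih

theorem exists_wordProd_eq {w : V ≃ₗᵢ[ℝ] V} (hw : w ∈ D.W) : ∃ u, D.wordProd u = w := by
  induction hw using Subgroup.closure_induction with
  | mem x hx => obtain ⟨s, rfl⟩ := hx; exact ⟨[s], D.wordProd_singleton s⟩
  | one => exact ⟨[], rfl⟩
  | mul x y _ _ hx hy =>
    obtain ⟨u, rfl⟩ := hx
    obtain ⟨v, rfl⟩ := hy
    exact ⟨u ++ v, D.wordProd_append u v⟩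
  | inv x _ hx =>
    obtain ⟨u, rfl⟩ := hx
    refine ⟨u.reverse, ?_⟩
    induction u with
    | nil => simp [wordProd]
    | cons s u ih =>
      rw [List.reverse_cons, wordProd_append, ih (D.wordProd_mem u), D.wordProd_cons s u,
        wordProd_singleton, mul_inv_rev, simple_inv]

theorem length_le (u : List B) : D.length (D.wordProd u) ≤ u.length :=
  Nat.sInf_le ⟨u, rfl, rfl⟩

theorem exists_reduced {w : V ≃ₗᵢ[ℝ] V} (hw : w ∈ D.W) :
    ∃ u, D.IsReduced u ∧ D.wordProd u = w := by
  obtain ⟨u, hu⟩ := D.exists_wordProd_eq hw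
  have : D.length w ∈ {k | ∃ u : List B, u.length = k ∧ D.wordProd u = w} :=
    Nat.sInf_mem ⟨_, u, rfl, hu⟩
  obtain ⟨v, h1, h2⟩ := this
  exact ⟨v, by rw [IsReduced, h1, h2], h2⟩

theorem prefixProd_zero (u : List B) : D.prefixProd u 0 = 1 := rfl

theorem prefixProd_mem (u : List B) (k : ℕ) : D.prefixProd u k ∈ D.W := D.wordProd_mem _

theorem prefixProd_succ (u : List B) {k : ℕ} (hk : k < u.length) :
    D.prefixProd u (k + 1) = D.prefixProd u k * D.simple u[k] := by
  rw [prefixProd, prefixProd, List.take_succ_eq_append_getElem hk, wordProd_append,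
    wordProd_singleton]

theorem prefixProd_of_length_le (u : List B) {k : ℕ} (hk : u.length ≤ k) :
    D.prefixProd u k = D.wordProd u := by
  rw [prefixProd, List.take_of_length_le hk]

theorem finite_W : Finite D.W := D.finite_group

/-! ### Weights and heights -/

theorem inner_root_self_pos (s : B) : 0 < inner ℝ (D.root s) (D.root s) :=
  real_inner_self_pos.2 (D.root.ne_zero s)

variable [FiniteDimensional ℝ V]

theorem inner_root_weight_self (s : B) :
    inner ℝ (D.root s) (D.weight s) = inner ℝ (D.root s) (D.root s) / 2 := by
  classical rw [inner_root_weight, if_pos rfl]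

theorem inner_root_weight_of_ne {s t : B} (h : s ≠ t) :
    inner ℝ (D.root s) (D.weight t) = 0 := by
  classical rw [inner_root_weight, if_neg h]

theorem simple_weight_of_ne {s t : B} (h : s ≠ t) : D.simple s (D.weight t) = D.weight t :=
  reflectionIn_of_inner_eq_zero (D.inner_root_weight_of_ne h)

theorem simple_weight_self (s : B) : D.simple s (D.weight s) = D.weight s - D.root s := by
  have := (D.inner_root_self_pos s).ne'
  rw [simple, reflectionIn_apply, inner_root_weight_self]
  congr 1
  rw [show 2 * (inner ℝ (D.root s) (D.root s) / 2) / inner ℝ (D.root s) (D.root s) = (1 : ℝ) by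
    field_simp, one_smul]

variable [Fintype B]

theorem eq_sum_root (v : V) :
    v = ∑ s, (2 * inner ℝ v (D.weight s) / inner ℝ (D.root s) (D.root s)) • D.root s := by
  conv_lhs => rw [← D.root.sum_repr v]
  refine Finset.sum_congr rfl fun s _ => ?_
  congr 1
  have h : inner ℝ v (D.weight s) = D.root.repr v s * (inner ℝ (D.root s) (D.root s) / 2) := by
    conv_lhs => rw [← D.root.sum_repr v]
    rw [sum_inner, Finset.sum_eq_single s]
    · rw [real_inner_smul_left, inner_root_weight_self]
    · intro t _ ht
      rw [real_inner_smul_left, inner_root_weight_of_ne _ ht, mul_zero]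
    · simp
  have := (D.inner_root_self_pos s).ne'
  rw [h]; field_simp

theorem ext_inner_root {v w : V} (h : ∀ s, inner ℝ (D.root s) v = inner ℝ (D.root s) w) :
    v = w := by
  apply ext_inner_left ℝ
  intro x
  rw [D.eq_sum_root x, sum_inner, sum_inner]
  simp only [real_inner_smul_left, h]

theorem eq_sum_weight (v : V) :
    v = ∑ s, (2 * inner ℝ (D.root s) v / inner ℝ (D.root s) (D.root s)) • D.weight s := by
  apply D.ext_inner_root
  intro s
  rw [inner_sum, Finset.sum_eq_single s]
  · have := (D.inner_root_self_pos s).ne'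
    rw [real_inner_smul_right, inner_root_weight_self]; field_simp
  · intro t _ ht
    rw [real_inner_smul_right, inner_root_weight_of_ne _ ht.symm, mul_zero]
  · simp

theorem inner_root_basePoint (s : B) :
    inner ℝ (D.root s) D.basePoint = inner ℝ (D.root s) (D.root s) / 2 := by
  rw [basePoint, inner_sum, Finset.sum_eq_single s]
  · exact D.inner_root_weight_self s
  · intro t _ ht
    exact D.inner_root_weight_of_ne ht.symm
  · simp

theorem simple_basePoint (s : B) : D.simple s D.basePoint = D.basePoint - D.root s := by
  have := (D.inner_root_self_pos s).ne'
  rw [simple, reflectionIn_apply, inner_root_basePoint]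
  congr 1
  rw [show 2 * (inner ℝ (D.root s) (D.root s) / 2) / inner ℝ (D.root s) (D.root s) = (1 : ℝ) by
    field_simp, one_smul]

/-- The height of a vector: its inner product with the base point. -/
noncomputable def ht (v : V) : ℝ := inner ℝ v D.basePoint

theorem ht_neg (v : V) : D.ht (-v) = -D.ht v := inner_neg_left _ _

theorem ht_smul (r : ℝ) (v : V) : D.ht (r • v) = r * D.ht v := real_inner_smul_left _ _ _

theorem ht_root_pos (s : B) : 0 < D.ht (D.root s) := by
  rw [ht, inner_root_basePoint]; exact half_pos (D.inner_root_self_pos s)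

/-! ### Roots -/

/-- The vectors of the orbits of the simple roots. -/
def IsRoot (v : V) : Prop := ∃ w ∈ D.W, ∃ s, v = w (D.root s)

theorem isRoot_root (s : B) : D.IsRoot (D.root s) := ⟨1, one_mem _, s, rfl⟩

variable {D}

theorem IsRoot.map {v : V} (hv : D.IsRoot v) {w : V ≃ₗᵢ[ℝ] V} (hw : w ∈ D.W) :
    D.IsRoot (w v) := by
  obtain ⟨x, hx, s, rfl⟩ := hv
  exact ⟨w * x, mul_mem hw hx, s, rfl⟩

theorem IsRoot.neg {v : V} (hv : D.IsRoot v) : D.IsRoot (-v) := by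
  obtain ⟨x, hx, s, rfl⟩ := hv
  refine ⟨x * D.simple s, mul_mem hx (D.simple_mem s), s, ?_⟩
  rw [LinearIsometryEquiv.mul_app, simple_root, map_neg]

theorem IsRoot.ne_zero {v : V} (hv : D.IsRoot v) : v ≠ 0 := by
  obtain ⟨x, hx, s, rfl⟩ := hv
  rw [Ne, map_eq_zero_iff _ x.injective]
  exact D.root.ne_zero s

theorem IsRoot.reflectionIn_mem {v : V} (hv : D.IsRoot v) : reflectionIn v ∈ D.W := by
  obtain ⟨x, hx, s, rfl⟩ := hv
  rw [show reflectionIn (x (D.root s)) = x * D.simple s * x⁻¹ by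
    rw [simple, ← reflectionIn_map, mul_inv_cancel_right]]
  exact mul_mem (mul_mem hx (D.simple_mem s)) (inv_mem hx)

theorem IsRoot.inner_chamber_ne_zero {v : V} (hv : D.IsRoot v) {x : V}
    (hx : ∀ s, 0 < inner ℝ (D.root s) x) : inner ℝ v x ≠ 0 :=
  D.chamber v hv.ne_zero hv.reflectionIn_mem x hx

theorem IsRoot.ht_ne_zero {v : V} (hv : D.IsRoot v) : D.ht v ≠ 0 :=
  hv.inner_chamber_ne_zero fun s => D.ht_root_pos s

/-- The ray from the base point in the direction of a fundamental weight stays in the open chamber,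
where no root vanishes. If the pairing were negative, `v` would vanish at the point of the ray
chosen here. -/
theorem IsRoot.inner_weight_nonneg {v : V} (hv : D.IsRoot v) (h : 0 < D.ht v) (s : B) :
    0 ≤ inner ℝ v (D.weight s) := by
  by_contra! hs
  refine hv.inner_chamber_ne_zero
    (x := D.basePoint + (D.ht v / -inner ℝ v (D.weight s)) • D.weight s) (fun t => ?_) ?_
  · rw [inner_add_right, real_inner_smul_right]
    have h1 := D.ht_root_pos t
    have h2 : 0 ≤ inner ℝ (D.root t) (D.weight s) := by
      by_cases hts : t = s
      · subst hts
        rw [inner_root_weight_self]; exact (half_pos (D.inner_root_self_pos t)).le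
      · rw [inner_root_weight_of_ne _ hts]
    have h3 : 0 ≤ D.ht v / -inner ℝ v (D.weight s) := div_nonneg h.le (by linarith)
    exact add_pos_of_pos_of_nonneg h1 (mul_nonneg h3 h2)
  · rw [inner_add_right, real_inner_smul_right, ← ht]
    have := hs.ne
    field_simp
    ring

theorem IsRoot.inner_weight_nonpos {v : V} (hv : D.IsRoot v) (h : D.ht v < 0) (s : B) :
    inner ℝ v (D.weight s) ≤ 0 := by
  have := hv.neg.inner_weight_nonneg (by rw [ht_neg]; linarith) s
  rw [inner_neg_left] at this
  linarith

theorem IsRoot.ht_pos_of_inner_weight_pos {v : V} (hv : D.IsRoot v) {s : B}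
    (h : 0 < inner ℝ v (D.weight s)) : 0 < D.ht v := by
  rcases lt_or_gt_of_ne hv.ht_ne_zero with h1 | h1
  · exact absurd (hv.inner_weight_nonpos h1 s) (not_le.2 h)
  · exact h1

theorem IsRoot.ht_neg_of_inner_weight_neg {v : V} (hv : D.IsRoot v) {s : B}
    (h : inner ℝ v (D.weight s) < 0) : D.ht v < 0 := by
  rcases lt_or_gt_of_ne hv.ht_ne_zero with h1 | h1
  · exact h1
  · exact absurd (hv.inner_weight_nonneg h1 s) (not_le.2 h)

/-- Positive roots have nonnegative inner product with dominant vectors. -/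
theorem IsRoot.inner_dominant_nonneg {v : V} (hv : D.IsRoot v) (h : 0 < D.ht v) {x : V}
    (hx : ∀ s, 0 ≤ inner ℝ (D.root s) x) : 0 ≤ inner ℝ v x := by
  rw [D.eq_sum_root v, sum_inner]
  refine Finset.sum_nonneg fun s _ => ?_
  rw [real_inner_smul_left]
  have := hv.inner_weight_nonneg h s
  have := D.inner_root_self_pos s
  have := hx s
  positivity

variable (D) in
theorem inner_weight_simple_of_ne {s t : B} (h : s ≠ t) (v : V) :
    inner ℝ (D.simple s v) (D.weight t) = inner ℝ v (D.weight t) := by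
  rw [inner_simple, simple_weight_of_ne _ h]

variable (D) in
-- The simple reflection `s` does not change the pairing of `α_t` with `ω_t`, so `s(α_t)` is a
-- positive root. Its pairing with `ω_s` is `-⟪α_s, α_t⟫`, which must therefore be nonnegative.
theorem inner_root_root_nonpos {s t : B} (h : s ≠ t) : inner ℝ (D.root s) (D.root t) ≤ 0 := by
  have hr : D.IsRoot (D.simple s (D.root t)) := (D.isRoot_root t).map (D.simple_mem s)
  have h1 : 0 < D.ht (D.simple s (D.root t)) := by
    apply hr.ht_pos_of_inner_weight_pos (s := t)
    rw [D.inner_weight_simple_of_ne h, inner_root_weight_self]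
    exact half_pos (D.inner_root_self_pos t)
  have h2 := hr.inner_weight_nonneg h1 s
  rw [inner_simple, simple_weight_self, inner_sub_right, inner_root_weight_of_ne _ h.symm,
    real_inner_comm] at h2
  linarith

/-- The only positive roots that a simple reflection makes negative are the positive multiples of
the simple root. -/
theorem IsRoot.eq_smul_root {v : V} (hv : D.IsRoot v) (h : 0 < D.ht v) {s : B}
    (hs : D.ht (D.simple s v) < 0) : ∃ r : ℝ, 0 < r ∧ v = r • D.root s := by
  -- Since `s` fixes `ω_t`, the pairing with `ω_t` is the same for the positive root `v` and the
  -- negative root `s(v)`, hence zero.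
  have h0 : ∀ t, t ≠ s → inner ℝ v (D.weight t) = 0 := by
    intro t ht
    apply le_antisymm _ (hv.inner_weight_nonneg h t)
    rw [← D.inner_weight_simple_of_ne ht.symm]
    exact (hv.map (D.simple_mem s)).inner_weight_nonpos hs t
  have h1 : v = (2 * inner ℝ v (D.weight s) / inner ℝ (D.root s) (D.root s)) • D.root s := by
    conv_lhs => rw [D.eq_sum_root v]
    rw [Finset.sum_eq_single s]
    · intro t _ ht
      rw [h0 t ht]; simp
    · simp
  refine ⟨_, ?_, h1⟩
  have h2 : 0 ≤ 2 * inner ℝ v (D.weight s) / inner ℝ (D.root s) (D.root s) := by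
    have := hv.inner_weight_nonneg h s
    have := D.inner_root_self_pos s
    positivity
  refine lt_of_le_of_ne h2 fun h3 => hv.ne_zero ?_
  rw [h1, ← h3, zero_smul]

end CoxeterData

/-! ### Reduced words, the longest element and the Bruhat order through walks -/

namespace CoxeterData

variable {B V : Type*} [NormedAddCommGroup V] [InnerProductSpace ℝ V]
variable (D : CoxeterData B V) [FiniteDimensional ℝ V] [Fintype B]

/-! ### Walks -/

theorem _root_.exists_last_before_change {P : ℕ → Prop} {a b : ℕ} (hab : a ≤ b) (ha : P a)
    (hb : ¬P b) : ∃ k, a ≤ k ∧ k < b ∧ (∀ l, a ≤ l → l ≤ k → P l) ∧ ¬P (k + 1) := by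
  induction b, hab using Nat.le_induction with
  | base => exact absurd ha hb
  | succ b hab ih =>
    by_cases h : ∀ l, a ≤ l → l ≤ b → P l
    · exact ⟨b, hab, b.lt_succ_self, h, hb⟩
    · by_cases hPb : P b
      · by_contra hcon
        push Not at h hcon
        have hall : ∀ n l, a ≤ l → l ≤ a + n → l ≤ b → P l := by
          intro n
          induction n with
          | zero =>
            intro l h1 h2 _
            rwa [show l = a by omega]
          | succ n ihn =>
            intro l h1 h2 h3
            by_cases h4 : l ≤ a + n
            · exact ihn l h1 h4 h3
            · have := hcon (a + n) (by omega) (by omega) fun l' h1' h2' => ihn l' h1' h2' (by omega)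
              rwa [show l = a + n + 1 by omega]
        obtain ⟨l, h1, h2, h3⟩ := h
        exact h3 (hall (l - a) l h1 (by omega) h2)
      · obtain ⟨k, h1, h2, h3⟩ := ih hPb
        exact ⟨k, h1, by omega, h3⟩

theorem _root_.exists_first_after_change {P : ℕ → Prop} {a b : ℕ} (hab : a ≤ b) (ha : P a)
    (hb : ¬P b) : ∃ k, a ≤ k ∧ k < b ∧ P k ∧ ∀ l, k < l → l ≤ b → ¬P l := by
  induction b, hab using Nat.le_induction with
  | base => exact absurd ha hb
  | succ b hab ih =>
    by_cases hPb : P b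
    · refine ⟨b, hab, b.lt_succ_self, hPb, fun l h1 h2 => ?_⟩
      rwa [show l = b + 1 by omega]
    · obtain ⟨k, h1, h2, h3, h4⟩ := ih hPb
      refine ⟨k, h1, by omega, h3, fun l h5 h6 => ?_⟩
      by_cases h7 : l ≤ b
      · exact h4 l h5 h7
      · rwa [show l = b + 1 by omega]

/-- A walk in the Cayley graph from the identity, with letters `s` (possibly resting). -/
def IsWalk (s : ℕ → Option B) (g : ℕ → V ≃ₗᵢ[ℝ] V) : Prop :=
  g 0 = 1 ∧ ∀ k, g (k + 1) = g k * (s k).elim 1 D.simple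

/-- A walk all of whose steps increase the length. -/
def IsAscending (s : ℕ → Option B) (g : ℕ → V ≃ₗᵢ[ℝ] V) : Prop :=
  ∀ k t, s k = some t → 0 < D.ht (g k (D.root t))

variable {D}

theorem IsWalk.mem {s : ℕ → Option B} {g : ℕ → V ≃ₗᵢ[ℝ] V} (h : D.IsWalk s g) (k : ℕ) :
    g k ∈ D.W := by
  induction k with
  | zero => rw [h.1]; exact one_mem _
  | succ k ih =>
    rw [h.2]
    refine mul_mem ih ?_
    cases s k with
    | none => exact one_mem _
    | some t => exact D.simple_mem t

theorem IsWalk.succ_some {s : ℕ → Option B} {g : ℕ → V ≃ₗᵢ[ℝ] V} (h : D.IsWalk s g) {k : ℕ}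
    {t : B} (hk : s k = some t) : g (k + 1) = g k * D.simple t := by
  rw [h.2, hk]; rfl

theorem IsWalk.succ_none {s : ℕ → Option B} {g : ℕ → V ≃ₗᵢ[ℝ] V} (h : D.IsWalk s g) {k : ℕ}
    (hk : s k = none) : g (k + 1) = g k := by
  rw [h.2, hk]; exact mul_one _

theorem IsRoot.ht_neg_of_not_pos {v : V} (hv : D.IsRoot v) (h : ¬0 < D.ht v) : D.ht v < 0 :=
  lt_of_le_of_ne (not_lt.1 h) hv.ht_ne_zero

/-- A positive multiple is all one can expect: the lengths of the simple roots are arbitrary, so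
distinct positive roots may be proportional. -/
theorem IsWalk.eq_smul_of_change {s : ℕ → Option B} {g : ℕ → V ≃ₗᵢ[ℝ] V} (h : D.IsWalk s g)
    {v : V} (hv : D.IsRoot v) {k : ℕ} (h1 : 0 < D.ht ((g k)⁻¹ v))
    (h2 : ¬0 < D.ht ((g (k + 1))⁻¹ v)) :
    ∃ t, s k = some t ∧ ∃ r : ℝ, 0 < r ∧ v = r • g k (D.root t) := by
  cases hk : s k with
  | none =>
    rw [h.succ_none hk] at h2
    exact absurd h1 h2
  | some t =>
    refine ⟨t, rfl, ?_⟩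
    have h3 : D.ht (D.simple t ((g k)⁻¹ v)) < 0 := by
      rw [h.succ_some hk, mul_inv_rev, simple_inv, LinearIsometryEquiv.mul_app] at h2
      exact ((hv.map (inv_mem (h.mem k))).map (D.simple_mem t)).ht_neg_of_not_pos h2
    obtain ⟨r, hr, hr'⟩ := (hv.map (inv_mem (h.mem k))).eq_smul_root h1 h3
    refine ⟨r, hr, ?_⟩
    rw [← map_smul, ← hr', LinearIsometryEquiv.app_inv_self]

theorem IsWalk.exists_change_first {s : ℕ → Option B} {g : ℕ → V ≃ₗᵢ[ℝ] V} (h : D.IsWalk s g)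
    {v : V} (hv : D.IsRoot v) {a b : ℕ} (hab : a ≤ b) (h1 : 0 < D.ht ((g a)⁻¹ v))
    (h2 : D.ht ((g b)⁻¹ v) < 0) :
    ∃ k, a ≤ k ∧ k < b ∧ (∀ l, a ≤ l → l ≤ k → 0 < D.ht ((g l)⁻¹ v)) ∧
      ∃ t, s k = some t ∧ ∃ r : ℝ, 0 < r ∧ v = r • g k (D.root t) := by
  obtain ⟨k, h3, h4, h5, h6⟩ := exists_last_before_change (P := fun l => 0 < D.ht ((g l)⁻¹ v))
    hab h1 (not_lt.2 h2.le)
  exact ⟨k, h3, h4, h5, h.eq_smul_of_change hv (h5 k h3 le_rfl) h6⟩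

theorem IsWalk.exists_change_last {s : ℕ → Option B} {g : ℕ → V ≃ₗᵢ[ℝ] V} (h : D.IsWalk s g)
    {v : V} (hv : D.IsRoot v) {a b : ℕ} (hab : a ≤ b) (h1 : 0 < D.ht ((g a)⁻¹ v))
    (h2 : D.ht ((g b)⁻¹ v) < 0) :
    ∃ k, a ≤ k ∧ k < b ∧ (∀ l, k < l → l ≤ b → D.ht ((g l)⁻¹ v) < 0) ∧
      ∃ t, s k = some t ∧ ∃ r : ℝ, 0 < r ∧ v = r • g k (D.root t) := by
  obtain ⟨k, h3, h4, h5, h6⟩ := exists_first_after_change (P := fun l => 0 < D.ht ((g l)⁻¹ v))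
    hab h1 (not_lt.2 h2.le)
  exact ⟨k, h3, h4, fun l h7 h8 => (hv.map (inv_mem (h.mem l))).ht_neg_of_not_pos (h6 l h7 h8),
    h.eq_smul_of_change hv h5 (h6 (k + 1) k.lt_succ_self h4)⟩

/-- Along an ascending walk a positive root never becomes positive again. -/
theorem IsWalk.ht_neg_of_le {s : ℕ → Option B} {g : ℕ → V ≃ₗᵢ[ℝ] V} (h : D.IsWalk s g)
    (ha : D.IsAscending s g) {v : V} (hv : D.IsRoot v) (hpos : 0 < D.ht v) {a b : ℕ}
    (hab : a ≤ b) (h1 : D.ht ((g a)⁻¹ v) < 0) : D.ht ((g b)⁻¹ v) < 0 := by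
  by_contra h2
  obtain ⟨k, _, _, _, t, hk, r, hr, hv'⟩ := h.exists_change_first hv.neg hab
    (by rw [map_neg, ht_neg]; linarith)
    (by
      rw [map_neg, ht_neg]
      have := (hv.map (inv_mem (h.mem b))).ht_ne_zero
      rw [not_lt] at h2
      have := lt_of_le_of_ne h2 this.symm
      linarith)
  have h3 := ha k t hk
  have h4 : D.ht (-v) = r * D.ht (g k (D.root t)) := by rw [hv', ht_smul]
  rw [ht_neg] at h4
  have := mul_pos hr h3
  linarith

theorem IsWalk.ht_neg_of_lt {s : ℕ → Option B} {g : ℕ → V ≃ₗᵢ[ℝ] V} (h : D.IsWalk s g)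
    (ha : D.IsAscending s g) {k l : ℕ} {t : B} (hk : s k = some t) (hkl : k < l) :
    D.ht ((g l)⁻¹ (g k (D.root t))) < 0 := by
  refine h.ht_neg_of_le ha ((D.isRoot_root t).map (h.mem k)) (ha k t hk) (Nat.succ_le_of_lt hkl) ?_
  rw [h.succ_some hk, mul_inv_rev, simple_inv, LinearIsometryEquiv.mul_app,
    LinearIsometryEquiv.inv_app_self, simple_root, ht_neg]
  linarith [D.ht_root_pos t]

theorem IsWalk.ht_pos_of_le {s : ℕ → Option B} {g : ℕ → V ≃ₗᵢ[ℝ] V} (h : D.IsWalk s g)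
    (ha : D.IsAscending s g) {k l : ℕ} {t : B} (hk : s k = some t) (hlk : l ≤ k) :
    0 < D.ht ((g l)⁻¹ (g k (D.root t))) := by
  have hr := (D.isRoot_root t).map (h.mem k)
  by_contra h1
  have h2 := h.ht_neg_of_le ha hr (ha k t hk) hlk
    ((hr.map (inv_mem (h.mem l))).ht_neg_of_not_pos h1)
  rw [LinearIsometryEquiv.inv_app_self] at h2
  linarith [D.ht_root_pos t]

/-! ### Reduced words -/

variable (D)

theorem isWalk_prefixProd (u : List B) : D.IsWalk (fun k => u[k]?) (D.prefixProd u) := by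
  refine ⟨rfl, fun k => ?_⟩
  beta_reduce
  by_cases hk : k < u.length
  · rw [D.prefixProd_succ u hk, List.getElem?_eq_getElem hk]; rfl
  · have hk' := not_lt.1 hk
    rw [prefixProd_of_length_le _ _ hk', prefixProd_of_length_le _ _ (by omega),
      List.getElem?_eq_none hk']
    exact (mul_one _).symm

theorem wordProd_take_drop (u : List B) (k : ℕ) :
    D.wordProd u = D.prefixProd u k * D.wordProd (u.drop k) := by
  rw [prefixProd, ← wordProd_append, List.take_append_drop]

variable {D}

/-- This is the deletion argument. If the root at `k` were negative, its opposite would have been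
crossed at some earlier position `j`. The reflections at `j` and `k` coincide, and erasing both
letters shortens the word. -/
theorem IsReduced.ht_pos {u : List B} (hu : D.IsReduced u) {k : ℕ} (hk : k < u.length) :
    0 < D.ht (D.prefixProd u k (D.root u[k])) := by
  have hw := D.isWalk_prefixProd u
  by_contra hneg
  have hr : D.IsRoot (D.prefixProd u k (D.root u[k])) := (D.isRoot_root _).map (hw.mem k)
  obtain ⟨j, -, hj, -, t, ht, r, hr0, hv⟩ := hw.exists_change_first hr.neg (Nat.zero_le k)
    (by
      rw [prefixProd_zero, inv_one, LinearIsometryEquiv.one_app, ht_neg]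
      linarith [hr.ht_neg_of_not_pos hneg])
    (by
      rw [map_neg, LinearIsometryEquiv.inv_app_self, ht_neg]
      linarith [D.ht_root_pos u[k]])
  have hj' : j < u.length := hj.trans hk
  have htj : u[j] = t := by
    have : u[j]? = some t := ht
    rwa [List.getElem?_eq_getElem hj', Option.some_inj] at this
  have href : reflectionIn (D.prefixProd u k (D.root u[k])) =
      reflectionIn (D.prefixProd u j (D.root t)) := by
    rw [← reflectionIn_smul (D.prefixProd u j (D.root t)) (neg_ne_zero.2 hr0.ne'), neg_smul, ← hv,
      neg_neg]
  have hmid : D.prefixProd u k = D.prefixProd u (j + 1) *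
      D.wordProd ((u.take k).drop (j + 1)) := by
    rw [prefixProd, D.wordProd_take_drop (u.take k) (j + 1), prefixProd, List.take_take,
      min_eq_left (by omega), ← prefixProd]
  have key : D.prefixProd u (k + 1) =
      D.prefixProd u j * D.wordProd ((u.take k).drop (j + 1)) := by
    rw [D.prefixProd_succ u hk, simple, ← reflectionIn_map, href]
    rw [hmid, D.prefixProd_succ u hj', htj, ← mul_assoc, ← mul_assoc, reflectionIn_map, ← simple,
      mul_assoc (D.prefixProd u j), simple_mul_self, mul_one]
  have hprod : D.wordProd (u.take j ++ (u.take k).drop (j + 1) ++ u.drop (k + 1)) =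
      D.wordProd u := by
    rw [wordProd_append, wordProd_append, D.wordProd_take_drop u (k + 1), key, prefixProd]
  have hlen := D.length_le (u.take j ++ (u.take k).drop (j + 1) ++ u.drop (k + 1))
  rw [hprod, ← hu] at hlen
  simp only [List.length_append, List.length_take, List.length_drop] at hlen
  omega

/-- Every step of an ascending walk crosses a root that is positive at the start and negative at the
end. Any other word with the same product must cross it too, and different steps of `u` give
non-proportional roots, hence different letters of `v`. -/
theorem length_le_of_isAscending {u v : List B}
    (hu : D.IsAscending (fun k => u[k]?) (D.prefixProd u)) (huv : D.wordProd v = D.wordProd u) :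
    u.length ≤ v.length := by
  have hwu := D.isWalk_prefixProd u
  have hwv := D.isWalk_prefixProd v
  have hex : ∀ k : Fin u.length, ∃ j : Fin v.length, ∃ r : ℝ, 0 < r ∧
      D.prefixProd u k (D.root u[k]) = r • D.prefixProd v j (D.root v[j]) := by
    intro k
    have hk : u[(k : ℕ)]? = some u[k] := List.getElem?_eq_getElem k.2
    obtain ⟨j, -, hj, -, t, ht, r, hr0, hv⟩ := hwv.exists_change_first
      (v := D.prefixProd u k (D.root u[k])) ((D.isRoot_root _).map (hwu.mem k))
      (Nat.zero_le v.length)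
      (by
        rw [prefixProd_zero, inv_one]
        exact hu k _ hk)
      (by
        rw [prefixProd_of_length_le _ _ le_rfl, huv, ← prefixProd_of_length_le _ _ le_rfl]
        exact hwu.ht_neg_of_lt hu hk k.2)
    refine ⟨⟨j, hj⟩, r, hr0, ?_⟩
    have : v[j] = t := by
      have : v[j]? = some t := ht
      rwa [List.getElem?_eq_getElem hj, Option.some_inj] at this
    rw [hv]
    simp only [Fin.getElem_fin, this]
  choose φ r hr0 hr using hex
  have hinj : ∀ k l, k < l → φ k ≠ φ l := by
    intro k l hkl heq
    have hk : u[(k : ℕ)]? = some u[k] := List.getElem?_eq_getElem k.2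
    have h1 := hwu.ht_neg_of_lt hu hk (show (k : ℕ) < l from hkl)
    have h2 : D.prefixProd u k (D.root u[k]) = (r k / r l) • D.prefixProd u l (D.root u[l]) := by
      rw [hr k, hr l, heq, smul_smul, div_mul_cancel₀ _ (hr0 l).ne']
    rw [h2, map_smul, LinearIsometryEquiv.inv_app_self, ht_smul] at h1
    have := mul_pos (div_pos (hr0 k) (hr0 l)) (D.ht_root_pos u[l])
    linarith
  have : Function.Injective φ := by
    intro k l h
    by_contra hne
    rcases lt_or_gt_of_ne hne with h1 | h1
    · exact hinj k l h1 h
    · exact hinj l k h1 h.symm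
  simpa using Fintype.card_le_of_injective φ this

theorem isReduced_of_isAscending {u : List B}
    (hu : D.IsAscending (fun k => u[k]?) (D.prefixProd u)) : D.IsReduced u := by
  apply le_antisymm _ (D.length_le u)
  obtain ⟨v, hv, hvu⟩ := D.exists_reduced (D.wordProd_mem u)
  rw [← hvu, ← hv]
  exact length_le_of_isAscending hu hvu

theorem IsReduced.append_singleton {u : List B} (hu : D.IsReduced u) {s : B}
    (hs : 0 < D.ht (D.wordProd u (D.root s))) : D.IsReduced (u ++ [s]) := by
  apply isReduced_of_isAscending
  intro k t hk
  obtain ⟨hk', rfl⟩ := List.getElem?_eq_some_iff.1 hk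
  rw [List.length_append, List.length_singleton] at hk'
  by_cases h : k < u.length
  · have : D.prefixProd (u ++ [s]) k = D.prefixProd u k := by
      rw [prefixProd, prefixProd, List.take_append_of_le_length h.le]
    rw [this, List.getElem_append_left h]
    exact hu.ht_pos h
  · obtain rfl : k = u.length := by omega
    have : D.prefixProd (u ++ [s]) u.length = D.wordProd u := by
      rw [prefixProd, List.take_left]
    rw [this]
    simpa using hs

theorem IsReduced.take {u : List B} (hu : D.IsReduced u) (n : ℕ) : D.IsReduced (u.take n) := by
  apply isReduced_of_isAscending
  intro k t hk
  obtain ⟨hk', rfl⟩ := List.getElem?_eq_some_iff.1 hk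
  rw [List.length_take] at hk'
  have : D.prefixProd (u.take n) k = D.prefixProd u k := by
    rw [prefixProd, prefixProd, List.take_take, min_eq_left (by omega)]
  rw [this, List.getElem_take]
  exact hu.ht_pos (by omega)

theorem eq_one_of_ht_pos {w : V ≃ₗᵢ[ℝ] V} (hw : w ∈ D.W)
    (h : ∀ s, 0 < D.ht (w (D.root s))) : w = 1 := by
  obtain ⟨u, hu, rfl⟩ := D.exists_reduced hw
  rcases List.eq_nil_or_concat' u with rfl | ⟨v, s, rfl⟩
  · rfl
  · exfalso
    have h1 := hu.ht_pos (k := v.length) (by simp)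
    have h2 := h s
    rw [wordProd_append, wordProd_singleton, LinearIsometryEquiv.mul_app, simple_root, map_neg,
      ht_neg] at h2
    rw [prefixProd, List.take_left] at h1
    simp only [List.getElem_concat_length] at h1
    linarith

/-! ### The longest element -/

theorem IsLongest.ht_root_neg {w₀ : V ≃ₗᵢ[ℝ] V} (h : D.IsLongest w₀) (s : B) :
    D.ht (w₀ (D.root s)) < 0 := by
  by_contra hpos
  have h1 := ((D.isRoot_root s).map h.1).ht_ne_zero
  obtain ⟨u, hu, rfl⟩ := D.exists_reduced h.1
  have h2 := hu.append_singleton (lt_of_le_of_ne (not_lt.1 hpos) h1.symm)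
  have h3 := h.2 _ (D.wordProd_mem (u ++ [s]))
  rw [← h2, ← hu, List.length_append, List.length_singleton] at h3
  omega

theorem IsLongest.ht_neg {w₀ : V ≃ₗᵢ[ℝ] V} (h : D.IsLongest w₀) {v : V} (hv : D.IsRoot v)
    (hpos : 0 < D.ht v) : D.ht (w₀ v) < 0 := by
  refine lt_of_le_of_ne ?_ (hv.map h.1).ht_ne_zero
  rw [D.eq_sum_root v, map_sum, ht, sum_inner]
  refine Finset.sum_nonpos fun s _ => ?_
  rw [map_smul, real_inner_smul_left]
  have h1 := hv.inner_weight_nonneg hpos s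
  have h2 := D.inner_root_self_pos s
  exact mul_nonpos_of_nonneg_of_nonpos (by positivity) (h.ht_root_neg s).le

theorem IsLongest.ht_inv_neg {w₀ : V ≃ₗᵢ[ℝ] V} (h : D.IsLongest w₀) {v : V} (hv : D.IsRoot v)
    (hpos : 0 < D.ht v) : D.ht (w₀⁻¹ v) < 0 := by
  have hr := hv.map (inv_mem h.1)
  apply hr.ht_neg_of_not_pos
  intro h1
  have h2 := h.ht_neg hr h1
  rw [LinearIsometryEquiv.app_inv_self] at h2
  linarith

theorem IsLongest.eq {w₀ w : V ≃ₗᵢ[ℝ] V} (h : D.IsLongest w₀) (hw : w ∈ D.W)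
    (hneg : ∀ s, D.ht (w (D.root s)) < 0) : w = w₀ := by
  have : w₀⁻¹ * w = 1 := by
    apply eq_one_of_ht_pos (mul_mem (inv_mem h.1) hw)
    intro s
    have hr := (D.isRoot_root s).map hw
    have := h.ht_inv_neg hr.neg (by rw [D.ht_neg]; linarith [hneg s])
    rw [map_neg, D.ht_neg] at this
    rw [LinearIsometryEquiv.mul_app]
    linarith
  exact (inv_mul_eq_one.1 this).symm

/-- Ascents are appended as long as there are any. The length of `w₀` bounds the process, and an
element without ascents is `w₀`. -/
theorem IsReduced.exists_extension {w₀ : V ≃ₗᵢ[ℝ] V} (h : D.IsLongest w₀) {u : List B}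
    (hu : D.IsReduced u) : ∃ v, D.IsReduced (u ++ v) ∧ D.wordProd (u ++ v) = w₀ := by
  have hle : u.length ≤ D.length w₀ := hu ▸ h.2 _ (D.wordProd_mem u)
  obtain ⟨n, hn⟩ : ∃ n, D.length w₀ = u.length + n := ⟨_, (Nat.add_sub_cancel' hle).symm⟩
  induction n generalizing u with
  | zero =>
    refine ⟨[], by simpa using hu, ?_⟩
    rw [List.append_nil]
    apply h.eq (D.wordProd_mem u)
    intro s
    by_contra hpos
    have h1 := ((D.isRoot_root s).map (D.wordProd_mem u)).ht_ne_zero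
    have h2 := hu.append_singleton (lt_of_le_of_ne (not_lt.1 hpos) h1.symm)
    have h3 := h.2 _ (D.wordProd_mem (u ++ [s]))
    rw [← h2, List.length_append, List.length_singleton] at h3
    omega
  | succ n ih =>
    by_cases hneg : ∀ s, D.ht (D.wordProd u (D.root s)) < 0
    · exact ⟨[], by simpa using hu, by simpa using h.eq (D.wordProd_mem u) hneg⟩
    · push Not at hneg
      obtain ⟨s, hs⟩ := hneg
      have h1 := ((D.isRoot_root s).map (D.wordProd_mem u)).ht_ne_zero
      have h2 := hu.append_singleton (lt_of_le_of_ne hs h1.symm)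
      obtain ⟨v, hv⟩ := ih h2 (h2 ▸ h.2 _ (D.wordProd_mem _)) (by simp; omega)
      exact ⟨s :: v, by simpa using hv⟩

/-! ### Bruhat order -/

variable (D)

/-- The elementary steps of the Bruhat order. -/
def BruhatStep (x y : V ≃ₗᵢ[ℝ] V) : Prop :=
  x ∈ D.W ∧ ∃ v, D.IsRoot v ∧ 0 < D.ht v ∧ 0 < D.ht (x⁻¹ v) ∧ y = reflectionIn v * x

/-- The Bruhat order. -/
def BruhatLE : (V ≃ₗᵢ[ℝ] V) → (V ≃ₗᵢ[ℝ] V) → Prop := Relation.ReflTransGen D.BruhatStep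

variable {D}

/-- The root `x⁻¹ v` stays positive under `s` unless it is a multiple of `α_s`. In that case the
step was itself the right multiplication by `s`. -/
theorem BruhatStep.mul_simple {x y : V ≃ₗᵢ[ℝ] V} (h : D.BruhatStep x y) (s : B) :
    D.BruhatStep (x * D.simple s) (y * D.simple s) ∨ y = x * D.simple s := by
  obtain ⟨hx, v, hv, h1, h2, rfl⟩ := h
  have hr := hv.map (inv_mem hx)
  by_cases h3 : 0 < D.ht (D.simple s (x⁻¹ v))
  · left
    refine ⟨mul_mem hx (D.simple_mem s), v, hv, h1, ?_, mul_assoc _ _ _⟩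
    rwa [mul_inv_rev, simple_inv]
  · right
    obtain ⟨r, hr0, hr'⟩ := hr.eq_smul_root h2
      ((hr.map (D.simple_mem s)).ht_neg_of_not_pos h3)
    have : v = x (r • D.root s) := by rw [← hr', LinearIsometryEquiv.app_inv_self]
    rw [this, reflectionIn_map, reflectionIn_smul _ hr0.ne', simple]

theorem bruhatStep_mul_simple {x : V ≃ₗᵢ[ℝ] V} (hx : x ∈ D.W) {s : B}
    (h : 0 < D.ht (x (D.root s))) : D.BruhatStep x (x * D.simple s) := by
  refine ⟨hx, x (D.root s), (D.isRoot_root s).map hx, h, ?_, (reflectionIn_map _ _).symm⟩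
  rw [LinearIsometryEquiv.inv_app_self]
  exact D.ht_root_pos s

theorem bruhatStep_of_mul_simple {x : V ≃ₗᵢ[ℝ] V} (hx : x ∈ D.W) {s : B}
    (h : D.ht (x (D.root s)) < 0) : D.BruhatStep (x * D.simple s) x := by
  have := bruhatStep_mul_simple (mul_mem hx (D.simple_mem s)) (s := s) (by
    rw [LinearIsometryEquiv.mul_app, simple_root, map_neg, ht_neg]; linarith)
  rwa [mul_assoc, simple_mul_self, mul_one] at this

/-- The lifting property. -/
theorem BruhatLE.mul_simple {x y : V ≃ₗᵢ[ℝ] V} (h : D.BruhatLE x y) (s : B) :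
    D.BruhatLE (x * D.simple s) (y * D.simple s) ∨
      D.BruhatLE (x * D.simple s) y ∧ D.BruhatLE x (y * D.simple s) := by
  induction h with
  | refl => exact Or.inl .refl
  | tail hxy hyz ih =>
    rcases hyz.mul_simple s with h1 | rfl
    · rcases ih with h2 | ⟨h2, h3⟩
      · exact Or.inl (h2.tail h1)
      · exact Or.inr ⟨h2.tail hyz, h3.tail h1⟩
    · rcases ih with h2 | ⟨h2, h3⟩
      · refine Or.inr ⟨h2, ?_⟩
        rw [mul_assoc, simple_mul_self, mul_one]
        exact hxy
      · refine Or.inr ⟨h2.tail hyz, ?_⟩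
        rw [mul_assoc, simple_mul_self, mul_one]
        exact hxy

/-- This consequence of the lifting property and the next one drive the comparison of facets: here
the lower walk rests at an ascent while the upper one moves; below, the lower walk takes a descent
and the upper one rests or moves. -/
theorem BruhatLE.le_of_ascent {x y : V ≃ₗᵢ[ℝ] V} (h : D.BruhatLE x y) (hx : x ∈ D.W) {s : B}
    (hs : 0 < D.ht (x (D.root s))) : D.BruhatLE x (y * D.simple s) := by
  rcases h.mul_simple s with h1 | ⟨_, h1⟩
  · exact Relation.ReflTransGen.head (bruhatStep_mul_simple hx hs) h1
  · exact h1

theorem BruhatLE.mul_le_of_descent {x y : V ≃ₗᵢ[ℝ] V} (h : D.BruhatLE x y) (hx : x ∈ D.W) {s : B}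
    (hs : D.ht (x (D.root s)) < 0) :
    D.BruhatLE (x * D.simple s) y ∧ D.BruhatLE (x * D.simple s) (y * D.simple s) := by
  have h0 := bruhatStep_of_mul_simple hx hs
  refine ⟨Relation.ReflTransGen.head h0 h, ?_⟩
  rcases h.mul_simple s with h1 | ⟨_, h1⟩
  · exact h1
  · exact Relation.ReflTransGen.head h0 h1

/-- The difference is `2 ⟪v, x g⟫ ⟪v, f⟫ / ⟪v, v⟫`. Both factors pair a positive root with a
dominant vector: `x⁻¹ v` with `g`, and `v` with `f`. -/
theorem BruhatStep.inner_sub_nonneg {x y : V ≃ₗᵢ[ℝ] V} (h : D.BruhatStep x y) {f g : V}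
    (hf : ∀ s, 0 ≤ inner ℝ (D.root s) f) (hg : ∀ s, 0 ≤ inner ℝ (D.root s) g) :
    inner ℝ f (y g) ≤ inner ℝ f (x g) := by
  obtain ⟨hx, v, hv, h1, h2, rfl⟩ := h
  rw [LinearIsometryEquiv.mul_app, reflectionIn_apply, inner_sub_right, real_inner_smul_right,
    real_inner_comm v f]
  have h3 := hv.inner_dominant_nonneg h1 hf
  have h4 := (hv.map (inv_mem hx)).inner_dominant_nonneg h2 hg
  rw [LinearIsometryEquiv.inner_inv_left] at h4
  have : 0 ≤ 2 * inner ℝ v (x g) / inner ℝ v v * inner ℝ v f := by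
    have := real_inner_self_nonneg (x := v)
    positivity
  linarith

theorem BruhatLE.inner_le {x y : V ≃ₗᵢ[ℝ] V} (h : D.BruhatLE x y) {f g : V}
    (hf : ∀ s, 0 ≤ inner ℝ (D.root s) f) (hg : ∀ s, 0 ≤ inner ℝ (D.root s) g) :
    inner ℝ f (y g) ≤ inner ℝ f (x g) := by
  induction h with
  | refl => exact le_rfl
  | tail _ hyz ih => exact (hyz.inner_sub_nonneg hf hg).trans ih

theorem inner_root_basePoint_nonneg (s : B) : 0 ≤ inner ℝ (D.root s) D.basePoint :=
  (D.ht_root_pos s).le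

theorem BruhatLE.antisymm {x y : V ≃ₗᵢ[ℝ] V} (h : D.BruhatLE x y) (h' : D.BruhatLE y x) :
    x = y := by
  rcases Relation.ReflTransGen.cases_head h with h1 | ⟨z, hz, hzy⟩
  · exact h1
  · exfalso
    -- The base point is regular, so the first step strictly decreases `⟪q, x q⟫`, and the remaining
    -- steps cannot raise it again.
    have h2 := (BruhatLE.inner_le (hzy.trans h')) (inner_root_basePoint_nonneg (D := D))
      (inner_root_basePoint_nonneg (D := D))
    obtain ⟨hx, v, hv, h3, h4, rfl⟩ := hz
    rw [LinearIsometryEquiv.mul_app, reflectionIn_apply, inner_sub_right, real_inner_smul_right,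
      real_inner_comm v D.basePoint] at h2
    rw [ht, LinearIsometryEquiv.inner_inv_left] at h4
    have h5 : 0 < inner ℝ v v := real_inner_self_pos.2 hv.ne_zero
    have : 0 < 2 * inner ℝ v (x D.basePoint) / inner ℝ v v * inner ℝ v D.basePoint :=
      mul_pos (by positivity) h3
    linarith

theorem inner_root_weight_nonneg (s t : B) : 0 ≤ inner ℝ (D.root s) (D.weight t) :=
  (D.isRoot_root s).inner_weight_nonneg (D.ht_root_pos s) t

end CoxeterData

/-! ### Subword complexes: root and weight functions, flips, normal data at a position -/

namespace CoxeterData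

variable {B V : Type*} [NormedAddCommGroup V] [InnerProductSpace ℝ V]
variable (D : CoxeterData B V) [FiniteDimensional ℝ V] [Fintype B]

/-! ### Partial products along a subword -/

theorem subword_eq_of_sorted (Q : List B) (J : Finset (Fin Q.length)) (l : List (Fin Q.length))
    (hl : l.Pairwise (· < ·)) (hmem : ∀ z, z ∈ l ↔ z ∈ J) : subword Q J = l.map Q.get := by
  rw [subword]
  congr 1
  have h1 : ((List.finRange Q.length).filter (· ∈ J)).Pairwise (· < ·) :=
    (List.pairwise_lt_finRange _).filter _
  refine List.Perm.eq_of_pairwise (le := (· < ·)) (fun a b _ _ h1 h2 => absurd h1 h2.asymm) h1 hl ?_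
  rw [List.perm_ext_iff_of_nodup h1.nodup hl.nodup]
  intro z
  simp [hmem]

theorem length_subword (Q : List B) (J : Finset (Fin Q.length)) :
    (subword Q J).length = J.card := by
  have h : ((List.finRange Q.length).filter (· ∈ J)).toFinset = J := by
    ext z; simp
  rw [subword, List.length_map, ← List.toFinset_card_of_nodup, h]
  exact (List.nodup_finRange _).filter _

/-- The subword of the letters at positions before `k` that are not in `I`. -/
def subwordBefore (Q : List B) (I : Finset (Fin Q.length)) (k : ℕ) : List B :=
  subword Q {z | (z : ℕ) < k ∧ z ∉ I}

/-- The letters of `Q` at the positions not in `I`. -/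
def letterOutside (Q : List B) (I : Finset (Fin Q.length)) (k : ℕ) : Option B :=
  if h : k < Q.length then (if (⟨k, h⟩ : Fin Q.length) ∈ I then none else some Q[k]) else none

theorem letterOutside_of_mem {Q : List B} {I : Finset (Fin Q.length)} {k : Fin Q.length}
    (hk : k ∈ I) : letterOutside Q I k = none := by
  simp [letterOutside, hk]

theorem letterOutside_of_notMem {Q : List B} {I : Finset (Fin Q.length)} {k : Fin Q.length}
    (hk : k ∉ I) : letterOutside Q I k = some Q[k] := by
  simp [letterOutside, hk]

theorem letterOutside_of_le {Q : List B} {I : Finset (Fin Q.length)} {k : ℕ}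
    (hk : Q.length ≤ k) : letterOutside Q I k = none := by
  simp [letterOutside, not_lt.2 hk]

theorem letterOutside_eq_some {Q : List B} {I : Finset (Fin Q.length)} {k : ℕ} {t : B}
    (h : letterOutside Q I k = some t) :
    ∃ hk : k < Q.length, (⟨k, hk⟩ : Fin Q.length) ∉ I ∧ Q[k] = t := by
  unfold letterOutside at h
  split_ifs at h with h1 h2
  exact ⟨h1, h2, by simpa using h⟩

theorem subwordBefore_succ (Q : List B) (I : Finset (Fin Q.length)) (k : ℕ) :
    subwordBefore Q I (k + 1) = subwordBefore Q I k ++ (letterOutside Q I k).toList := by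
  by_cases hk : k < Q.length
  · by_cases hkI : (⟨k, hk⟩ : Fin Q.length) ∈ I
    · have h1 : letterOutside Q I k = none := letterOutside_of_mem (k := ⟨k, hk⟩) hkI
      rw [h1, Option.toList_none, List.append_nil, subwordBefore, subwordBefore]
      congr 1
      ext z
      simp only [Finset.mem_filter, Finset.mem_univ, true_and]
      constructor
      · rintro ⟨h2, h3⟩
        refine ⟨lt_of_le_of_ne (Nat.lt_succ_iff.1 h2) ?_, h3⟩
        rintro rfl
        exact h3 hkI
      · rintro ⟨h2, h3⟩
        exact ⟨by omega, h3⟩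
    · have h1 : letterOutside Q I k = some Q[k] := letterOutside_of_notMem (k := ⟨k, hk⟩) hkI
      rw [h1, subwordBefore, subword_eq_of_sorted Q _
        (((List.finRange Q.length).filter (· ∈ ({z | (z : ℕ) < k ∧ z ∉ I} : Finset (Fin Q.length)))) ++
          [⟨k, hk⟩])]
      · simp [subwordBefore, subword]
      · rw [List.pairwise_append]
        refine ⟨(List.pairwise_lt_finRange _).filter _, List.pairwise_singleton _ _, ?_⟩
        intro a ha b hb
        simp only [Finset.mem_filter, Finset.mem_univ, true_and, List.mem_filter,
          List.mem_finRange, decide_eq_true_eq, List.mem_singleton] at ha hb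
        subst hb
        exact ha.1
      · intro z
        simp only [Finset.mem_filter, Finset.mem_univ, true_and, List.mem_filter, List.mem_append,
          List.mem_finRange, decide_eq_true_eq, List.mem_singleton]
        constructor
        · rintro (⟨h2, h3⟩ | rfl)
          · exact ⟨by omega, h3⟩
          · exact ⟨Nat.lt_succ_self _, hkI⟩
        · rintro ⟨h2, h3⟩
          rcases Nat.lt_succ_iff_lt_or_eq.1 h2 with h4 | h4
          · exact Or.inl ⟨h4, h3⟩
          · exact Or.inr (Fin.ext h4)
  · rw [letterOutside_of_le (not_lt.1 hk), Option.toList_none, List.append_nil, subwordBefore,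
      subwordBefore]
    congr 1
    ext z
    have := z.2
    simp only [Finset.mem_filter, Finset.mem_univ, true_and]
    constructor
    · rintro ⟨h2, h3⟩
      exact ⟨by omega, h3⟩
    · rintro ⟨h2, h3⟩
      exact ⟨by omega, h3⟩

theorem subwordBefore_zero (Q : List B) (I : Finset (Fin Q.length)) : subwordBefore Q I 0 = [] := by
  rw [← List.length_eq_zero_iff, subwordBefore, length_subword]
  simp

theorem subwordBefore_prefix (Q : List B) (I : Finset (Fin Q.length)) {k l : ℕ} (hkl : k ≤ l) :
    subwordBefore Q I k <+: subwordBefore Q I l := by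
  induction l, hkl using Nat.le_induction with
  | base => exact List.prefix_rfl
  | succ l _ ih =>
    rw [subwordBefore_succ]
    exact ih.trans (List.prefix_append _ _)

theorem subwordBefore_length (Q : List B) (I : Finset (Fin Q.length)) :
    subwordBefore Q I Q.length = subword Q Iᶜ := by
  rw [subwordBefore]
  congr 1
  ext z
  simp

/-- The product of the letters of `Q` at positions before `k` that are not in `I`. -/
noncomputable def partialProd (Q : List B) (I : Finset (Fin Q.length)) (k : ℕ) : V ≃ₗᵢ[ℝ] V :=
  D.wordProd (subwordBefore Q I k)

/-- The root function of a set of positions. -/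
noncomputable def rootFunction (Q : List B) (I : Finset (Fin Q.length)) (k : Fin Q.length) : V :=
  D.partialProd Q I k (D.root Q[k])

theorem weightFunction_eq (Q : List B) (I : Finset (Fin Q.length)) (k : Fin Q.length) :
    D.weightFunction Q I k = D.partialProd Q I k (D.weight Q[k]) := by
  rw [weightFunction, partialProd, subwordBefore]
  rfl

theorem isWalk_partialProd (Q : List B) (I : Finset (Fin Q.length)) :
    D.IsWalk (letterOutside Q I) (D.partialProd Q I) := by
  constructor
  · rw [partialProd, subwordBefore_zero]; rfl
  · intro k
    rw [partialProd, partialProd, subwordBefore_succ, wordProd_append]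
    cases letterOutside Q I k with
    | none => rfl
    | some t => rw [Option.toList_some, wordProd_singleton]; rfl

theorem partialProd_mem (Q : List B) (I : Finset (Fin Q.length)) (k : ℕ) :
    D.partialProd Q I k ∈ D.W := D.wordProd_mem _

theorem isRoot_rootFunction (Q : List B) (I : Finset (Fin Q.length)) (k : Fin Q.length) :
    D.IsRoot (D.rootFunction Q I k) := (D.isRoot_root _).map (D.partialProd_mem Q I k)

theorem partialProd_succ_of_mem {Q : List B} {I : Finset (Fin Q.length)} {k : Fin Q.length}
    (hk : k ∈ I) : D.partialProd Q I (k + 1) = D.partialProd Q I k :=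
  (D.isWalk_partialProd Q I).succ_none (letterOutside_of_mem hk)

theorem partialProd_succ_of_notMem {Q : List B} {I : Finset (Fin Q.length)} {k : Fin Q.length}
    (hk : k ∉ I) : D.partialProd Q I (k + 1) = D.partialProd Q I k * D.simple Q[k] :=
  (D.isWalk_partialProd Q I).succ_some (letterOutside_of_notMem hk)

theorem inner_rootFunction_weightFunction_self (Q : List B) (I : Finset (Fin Q.length))
    (k : Fin Q.length) : 0 < inner ℝ (D.rootFunction Q I k) (D.weightFunction Q I k) := by
  rw [weightFunction_eq, rootFunction, LinearIsometryEquiv.inner_map_map, inner_root_weight_self]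
  exact half_pos (D.inner_root_self_pos _)

/-! ### Facets -/

/-- If the complement of a face contains a reduced expression at the positions `J`, then the face
lies in the face `Jᶜ`. So maximal faces are exactly the complements of reduced expressions. -/
theorem isFacet_iff {Q : List B} {w : V ≃ₗᵢ[ℝ] V} {I : Finset (Fin Q.length)} :
    D.IsFacet Q w I ↔ Iᶜ.card = D.length w ∧ D.partialProd Q I Q.length = w := by
  rw [partialProd, subwordBefore_length]
  constructor
  · intro h
    obtain ⟨J, hJ, hr, hw⟩ := h.prop
    have hJI : I ⊆ Jᶜ := by
      rw [← compl_compl I]; exact Finset.compl_subset_compl.2 hJ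
    have h1 : D.IsFace Q w Jᶜ := ⟨J, by rw [compl_compl], hr, hw⟩
    have h2 : I = Jᶜ := le_antisymm hJI (h.le_of_ge h1 hJI)
    rw [h2, compl_compl]
    refine ⟨?_, hw⟩
    rw [← length_subword, hr, hw]
  · rintro ⟨h1, h2⟩
    refine ⟨⟨Iᶜ, subset_rfl, ?_, h2⟩, ?_⟩
    · rw [IsReduced, length_subword, h1, h2]
    · rintro I' ⟨J, hJ, hr, hw⟩ hI'
      have h3 : J.card = D.length w := by rw [← length_subword, hr, hw]
      have h4 : J ⊆ Iᶜ := hJ.trans (Finset.compl_subset_compl.2 hI')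
      have h5 : J = Iᶜ := Finset.eq_of_subset_of_card_le h4 (by rw [h1, h3])
      rw [h5] at hJ
      exact Finset.compl_subset_compl.1 hJ

variable {D}

theorem IsFacet.partialProd_length {Q : List B} {w : V ≃ₗᵢ[ℝ] V} {I : Finset (Fin Q.length)}
    (h : D.IsFacet Q w I) : D.partialProd Q I Q.length = w := (D.isFacet_iff.1 h).2

theorem IsFacet.isAscending {Q : List B} {w : V ≃ₗᵢ[ℝ] V} {I : Finset (Fin Q.length)}
    (h : D.IsFacet Q w I) : D.IsAscending (letterOutside Q I) (D.partialProd Q I) := by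
  intro k t hk
  obtain ⟨hkl, hkI, rfl⟩ := letterOutside_eq_some hk
  have h1 := D.isFacet_iff.1 h
  rw [partialProd, subwordBefore_length] at h1
  have hr : D.IsReduced (subword Q Iᶜ) := by rw [IsReduced, length_subword, h1.1, h1.2]
  have hp : subwordBefore Q I k ++ [Q[k]] <+: subword Q Iᶜ := by
    have := subwordBefore_prefix Q I (Nat.succ_le_of_lt hkl)
    rwa [Nat.succ_eq_add_one, subwordBefore_succ, hk, subwordBefore_length] at this
  have hr' : D.IsReduced (subwordBefore Q I k ++ [Q[k]]) := by
    rw [List.prefix_iff_eq_take.1 hp]; exact hr.take _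
  have h2 := hr'.ht_pos (k := (subwordBefore Q I k).length) (by simp)
  rw [prefixProd, List.take_left] at h2
  simpa [partialProd] using h2

theorem IsFacet.ht_pos_of_le {Q : List B} {w : V ≃ₗᵢ[ℝ] V} {I : Finset (Fin Q.length)}
    (h : D.IsFacet Q w I) {k : Fin Q.length} (hk : k ∉ I) {l : ℕ} (hl : l ≤ k) :
    0 < D.ht ((D.partialProd Q I l)⁻¹ (D.rootFunction Q I k)) :=
  (D.isWalk_partialProd Q I).ht_pos_of_le h.isAscending (letterOutside_of_notMem hk) hl

theorem IsFacet.ht_neg_of_lt {Q : List B} {w : V ≃ₗᵢ[ℝ] V} {I : Finset (Fin Q.length)}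
    (h : D.IsFacet Q w I) {k : Fin Q.length} (hk : k ∉ I) {l : ℕ} (hl : k < l) :
    D.ht ((D.partialProd Q I l)⁻¹ (D.rootFunction Q I k)) < 0 :=
  (D.isWalk_partialProd Q I).ht_neg_of_lt h.isAscending (letterOutside_of_notMem hk) hl

/-! ### Comparison of facets -/

/-- If all the roots of the facet `I` at the positions outside `K` are positive with respect to the
`P`-th partial product of `I`, then the partial products of `I` are below those of any other facet
that contains `K`. -/
theorem IsFacet.bruhatLE {Q : List B} {w : V ≃ₗᵢ[ℝ] V} {I J K : Finset (Fin Q.length)}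
    (hI : D.IsFacet Q w I) (hJ : D.IsFacet Q w J) (hKJ : K ⊆ J) {P : ℕ}
    (hpos : ∀ k ∈ I, k ∉ K → 0 < D.ht ((D.partialProd Q I P)⁻¹ (D.rootFunction Q I k)))
    {k : ℕ} (hk : k ≤ Q.length) :
    D.BruhatLE ((D.partialProd Q I P)⁻¹ * D.partialProd Q I k)
      ((D.partialProd Q I P)⁻¹ * D.partialProd Q J k) := by
  set g := D.partialProd Q I P with hg
  have hmem : ∀ k, g⁻¹ * D.partialProd Q I k ∈ D.W := fun k =>
    mul_mem (inv_mem (D.partialProd_mem Q I P)) (D.partialProd_mem Q I k)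
  -- Up to position `P` the comparison is propagated from the common start of both walks.
  have hforward : ∀ k ≤ Q.length, k ≤ P →
      D.BruhatLE (g⁻¹ * D.partialProd Q I k) (g⁻¹ * D.partialProd Q J k) := by
    intro k
    induction k with
    | zero =>
      intro _ _
      rw [(D.isWalk_partialProd Q I).1, (D.isWalk_partialProd Q J).1]
      exact .refl
    | succ k ih =>
      intro h1 h2
      have ih := ih (by omega) (by omega)
      lift k to Fin Q.length using h1
      by_cases hkI : k ∈ I
      · rw [D.partialProd_succ_of_mem hkI]
        by_cases hkJ : k ∈ J
        · rwa [D.partialProd_succ_of_mem hkJ]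
        · rw [D.partialProd_succ_of_notMem hkJ, ← mul_assoc]
          exact ih.le_of_ascent (hmem k) (hpos k hkI fun h => hkJ (hKJ h))
      -- The walk of `I` crosses this root before `P`, so it is negative seen from `P`, and the step
      -- of `I` at `k` is a descent.
      · have h3 := hI.ht_neg_of_lt hkI h2
        have h4 := ih.mul_le_of_descent (hmem k) h3
        rw [D.partialProd_succ_of_notMem hkI, ← mul_assoc]
        by_cases hkJ : k ∈ J
        · rw [D.partialProd_succ_of_mem hkJ]
          exact h4.1
        · rw [D.partialProd_succ_of_notMem hkJ, ← mul_assoc]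
          exact h4.2
  -- Beyond `P` the comparison is propagated backwards from the common end `w`. Read backwards, the
  -- steps of `I` are again descents.
  have hbackward : ∀ n k, k + n = Q.length → P ≤ k →
      D.BruhatLE (g⁻¹ * D.partialProd Q I k) (g⁻¹ * D.partialProd Q J k) := by
    intro n
    induction n with
    | zero =>
      intro k h1 _
      rw [show k = Q.length by omega, hI.partialProd_length, hJ.partialProd_length]
      exact .refl
    | succ n ih =>
      intro k h1 h2
      have ih := ih (k + 1) (by omega) (by omega)
      have hkl : k < Q.length := by omega
      clear h1 hk
      lift k to Fin Q.length using hkl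
      have hJback : k ∉ J →
          D.partialProd Q J k = D.partialProd Q J (k + 1) * D.simple Q[k] := by
        intro hkJ
        rw [D.partialProd_succ_of_notMem hkJ, mul_assoc, simple_mul_self, mul_one]
      by_cases hkI : k ∈ I
      · rw [D.partialProd_succ_of_mem hkI] at ih
        by_cases hkJ : k ∈ J
        · rwa [D.partialProd_succ_of_mem hkJ] at ih
        · rw [hJback hkJ, ← mul_assoc]
          exact ih.le_of_ascent (hmem k) (hpos k hkI fun h => hkJ (hKJ h))
      · have h3 : D.ht ((g⁻¹ * D.partialProd Q I (k + 1)) (D.root Q[k])) < 0 := by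
          rw [D.partialProd_succ_of_notMem hkI, LinearIsometryEquiv.mul_app,
            LinearIsometryEquiv.mul_app, simple_root, map_neg, map_neg, ht_neg]
          have := hI.ht_pos_of_le hkI h2
          rw [rootFunction] at this
          linarith
        have h4 := ih.mul_le_of_descent (hmem _) h3
        have h5 : g⁻¹ * D.partialProd Q I k =
            g⁻¹ * D.partialProd Q I (k + 1) * D.simple Q[k] := by
          rw [D.partialProd_succ_of_notMem hkI, ← mul_assoc, mul_assoc, simple_mul_self, mul_one]
        rw [h5]
        by_cases hkJ : k ∈ J
        · rw [D.partialProd_succ_of_mem hkJ] at h4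
          exact h4.1
        · rw [hJback hkJ, ← mul_assoc]
          exact h4.2
  rcases le_total k P with h | h
  · exact hforward k hk h
  · exact hbackward (Q.length - k) k (by omega) h

/-- There is at most one facet containing `K` with positive roots outside `K`. -/
theorem IsFacet.eq_of_ht_pos {Q : List B} {w : V ≃ₗᵢ[ℝ] V} {I J K : Finset (Fin Q.length)}
    (hI : D.IsFacet Q w I) (hJ : D.IsFacet Q w J) (hKI : K ⊆ I) (hKJ : K ⊆ J)
    (hIpos : ∀ k ∈ I, k ∉ K → 0 < D.ht (D.rootFunction Q I k))
    (hJpos : ∀ k ∈ J, k ∉ K → 0 < D.ht (D.rootFunction Q J k)) : I = J := by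
  -- With `P = 0` the hypotheses put each walk below the other, and the Bruhat order is
  -- antisymmetric. Equal walks have equal sets of rests, since no simple reflection is trivial.
  have key : ∀ k ≤ Q.length, D.partialProd Q I k = D.partialProd Q J k := by
    intro k hk
    have h1 := hI.bruhatLE hJ hKJ (P := 0) (by
      rw [(D.isWalk_partialProd Q I).1, inv_one]; exact hIpos) hk
    have h2 := hJ.bruhatLE hI hKI (P := 0) (by
      rw [(D.isWalk_partialProd Q J).1, inv_one]; exact hJpos) hk
    rw [(D.isWalk_partialProd Q I).1, inv_one, one_mul, one_mul] at h1
    rw [(D.isWalk_partialProd Q J).1, inv_one, one_mul, one_mul] at h2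
    exact h1.antisymm h2
  have hne : ∀ s : B, D.simple s ≠ 1 := by
    intro s h
    have h1 := D.simple_root s
    have h2 := D.ht_neg (D.root s)
    rw [← h1, h, LinearIsometryEquiv.one_app] at h2
    linarith [D.ht_root_pos s]
  ext k
  have h1 := key k k.2.le
  have h2 := key (k + 1) k.2
  by_cases hkI : k ∈ I <;> by_cases hkJ : k ∈ J
  · simp [hkI, hkJ]
  · exfalso
    rw [D.partialProd_succ_of_mem hkI, D.partialProd_succ_of_notMem hkJ, h1] at h2
    exact hne _ (left_eq_mul.1 h2)
  · exfalso
    rw [D.partialProd_succ_of_mem hkJ, D.partialProd_succ_of_notMem hkI, h1] at h2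
    exact hne _ (mul_eq_left.1 h2)
  · simp [hkI, hkJ]

/-! ### Flips -/

section Flip

variable {Q : List B} {I : Finset (Fin Q.length)} {i j : Fin Q.length} {r : ℝ}

/-- Taking the letter at `i`, or the one at `j`, amounts to multiplying the walk on the left by the
same reflection. So the flip reflects the part of the walk between the two positions and leaves the
rest unchanged. -/
theorem partialProd_flip (hi : i ∈ I) (hj : j ∉ I) (hr : r ≠ 0)
    (hij : D.rootFunction Q I j = r • D.rootFunction Q I i) (k : ℕ) :
    D.partialProd Q (insert j (I.erase i)) k =
      if (i : ℕ) < k ∧ k ≤ j ∨ (j : ℕ) < k ∧ k ≤ i then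
        reflectionIn (D.rootFunction Q I i) * D.partialProd Q I k
      else D.partialProd Q I k := by
  have hne : i ≠ j := fun h => hj (h ▸ hi)
  have hne' : (i : ℕ) ≠ j := fun h => hne (Fin.ext h)
  have hi' : i ∉ insert j (I.erase i) := by simp [hne]
  have hj' : j ∈ insert j (I.erase i) := by simp
  have e1 : D.partialProd Q I i * D.simple Q[i] =
      reflectionIn (D.rootFunction Q I i) * D.partialProd Q I i := (reflectionIn_map _ _).symm
  have e2 : D.partialProd Q I j * D.simple Q[j] =
      reflectionIn (D.rootFunction Q I i) * D.partialProd Q I j := by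
    rw [← reflectionIn_smul _ hr, ← hij]; exact (reflectionIn_map _ _).symm
  induction k with
  | zero => simp [(D.isWalk_partialProd _ _).1]
  | succ k ih =>
    by_cases hki : k = i
    · subst hki
      rw [D.partialProd_succ_of_notMem hi', D.partialProd_succ_of_mem hi, ih]
      rcases lt_or_gt_of_ne hne' with h | h
      · rw [if_neg (by omega), if_pos (by omega), e1]
      · rw [if_pos (by omega), if_neg (by omega), mul_assoc, e1, ← mul_assoc,
          reflectionIn_mul_self, one_mul]
    by_cases hkj : k = j
    · subst hkj
      rw [D.partialProd_succ_of_mem hj', D.partialProd_succ_of_notMem hj, ih]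
      rcases lt_or_gt_of_ne hne' with h | h
      · rw [if_pos (by omega), if_neg (by omega), e2]
      · rw [if_neg (by omega), if_pos (by omega), e2, ← mul_assoc, reflectionIn_mul_self, one_mul]
    have hlet : letterOutside Q (insert j (I.erase i)) k = letterOutside Q I k := by
      unfold letterOutside
      by_cases hk : k < Q.length
      · simp only [hk, dif_pos, Finset.mem_insert, Finset.mem_erase, Fin.ext_iff]
        simp [show ¬(⟨k, hk⟩ : Fin Q.length) = i from fun h => hki (congrArg Fin.val h), hkj]
      · simp [hk]
    rw [(D.isWalk_partialProd _ _).2, (D.isWalk_partialProd _ _).2 k, hlet, ih]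
    by_cases hc : (i : ℕ) < k ∧ k ≤ j ∨ (j : ℕ) < k ∧ k ≤ i
    · rw [if_pos hc, if_pos (by omega), mul_assoc]
    · rw [if_neg hc, if_neg (by omega)]

theorem IsFacet.flip {w : V ≃ₗᵢ[ℝ] V} (hI : D.IsFacet Q w I) (hi : i ∈ I) (hj : j ∉ I)
    (hr : r ≠ 0) (hij : D.rootFunction Q I j = r • D.rootFunction Q I i) :
    D.IsFacet Q w (insert j (I.erase i)) := by
  rw [isFacet_iff] at hI ⊢
  constructor
  · rw [← hI.1, Finset.card_compl, Finset.card_compl, Finset.card_insert_of_notMem (by simp [hj]),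
      Finset.card_erase_of_mem hi]
    have := Finset.card_pos.2 ⟨i, hi⟩
    congr 1
    omega
  · have := i.2
    have := j.2
    rw [partialProd_flip hi hj hr hij, if_neg (by omega), hI.2]

theorem weightFunction_flip (hi : i ∈ I) (hj : j ∉ I) (hr : r ≠ 0)
    (hij : D.rootFunction Q I j = r • D.rootFunction Q I i) (k : Fin Q.length) :
    D.weightFunction Q (insert j (I.erase i)) k =
      if i < k ∧ k ≤ j ∨ j < k ∧ k ≤ i then
        reflectionIn (D.rootFunction Q I i) (D.weightFunction Q I k)
      else D.weightFunction Q I k := by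
  rw [weightFunction_eq, partialProd_flip hi hj hr hij, weightFunction_eq]
  simp only [Fin.lt_def, Fin.le_def]
  split_ifs <;> rfl

theorem rootFunction_flip (hi : i ∈ I) (hj : j ∉ I) (hr : r ≠ 0)
    (hij : D.rootFunction Q I j = r • D.rootFunction Q I i) (k : Fin Q.length) :
    D.rootFunction Q (insert j (I.erase i)) k =
      if i < k ∧ k ≤ j ∨ j < k ∧ k ≤ i then
        reflectionIn (D.rootFunction Q I i) (D.rootFunction Q I k)
      else D.rootFunction Q I k := by
  rw [rootFunction, partialProd_flip hi hj hr hij, rootFunction, rootFunction]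
  simp only [Fin.lt_def, Fin.le_def]
  split_ifs <;> rfl

theorem brickVector_flip (hi : i ∈ I) (hj : j ∉ I) (hr : r ≠ 0)
    (hij : D.rootFunction Q I j = r • D.rootFunction Q I i) :
    D.brickVector Q (insert j (I.erase i)) = D.brickVector Q I -
      (∑ k with i < k ∧ k ≤ j ∨ j < k ∧ k ≤ i,
        2 * inner ℝ (D.rootFunction Q I i) (D.weightFunction Q I k) /
          inner ℝ (D.rootFunction Q I i) (D.rootFunction Q I i)) • D.rootFunction Q I i := by
  rw [brickVector, brickVector, Finset.sum_smul, eq_sub_iff_add_eq, Finset.sum_filter,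
    ← Finset.sum_add_distrib]
  refine Finset.sum_congr rfl fun k _ => ?_
  rw [weightFunction_flip hi hj hr hij]
  split_ifs
  · rw [reflectionIn_apply, sub_add_cancel]
  · rw [add_zero]

end Flip

/-- Every position of a facet can be flipped; the brick vector moves in the direction opposite to
the root. -/
theorem IsFacet.exists_flip {Q : List B} {w₀ : V ≃ₗᵢ[ℝ] V} (hw₀ : D.IsLongest w₀)
    {I : Finset (Fin Q.length)} (hI : D.IsFacet Q w₀ I) {i : Fin Q.length} (hi : i ∈ I) :
    ∃ j, j ∉ I ∧ (∃ r : ℝ, r ≠ 0 ∧ D.rootFunction Q I j = r • D.rootFunction Q I i) ∧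
      (∃ μ : ℝ, 0 < μ ∧
        D.brickVector Q (insert j (I.erase i)) = D.brickVector Q I - μ • D.rootFunction Q I i) ∧
      (D.ht (D.rootFunction Q I i) < 0 → j < i) := by
  set v := D.rootFunction Q I i with hv
  have hroot : D.IsRoot v := D.isRoot_rootFunction Q I i
  have hw := D.isWalk_partialProd Q I
  have hvi : (D.partialProd Q I i)⁻¹ v = D.root Q[i] := LinearIsometryEquiv.inv_app_self _ _
  -- For a negative root, `j` is the last crossing of `-v` before `i`. For a positive root, `j` is
  -- the first crossing of `v` after `i`, which exists because `w₀` inverts every positive root.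
  -- Either choice keeps `v` positive as seen from all positions affected by the flip, so that their
  -- weights pair nonnegatively with `v`.
  have main : ∃ j, j ∉ I ∧ (∃ r : ℝ, r ≠ 0 ∧ D.rootFunction Q I j = r • v) ∧
      (D.ht v < 0 → j < i) ∧
      ∀ k : Fin Q.length, i < k ∧ k ≤ j ∨ j < k ∧ k ≤ i → 0 < D.ht ((D.partialProd Q I k)⁻¹ v) := by
    rcases lt_or_gt_of_ne hroot.ht_ne_zero with hneg | hpos
    · obtain ⟨j, -, hji, hl, t, ht, r, hr0, hr⟩ := hw.exists_change_last hroot.neg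
        (Nat.zero_le (i : ℕ))
        (by rw [hw.1, inv_one, LinearIsometryEquiv.one_app, ht_neg]; linarith)
        (by rw [map_neg, ht_neg, hvi]; linarith [D.ht_root_pos Q[i]])
      obtain ⟨hj, hjI, rfl⟩ := letterOutside_eq_some ht
      refine ⟨⟨j, hj⟩, hjI, ⟨-r⁻¹, neg_ne_zero.2 (inv_ne_zero hr0.ne'), ?_⟩, fun _ => hji, ?_⟩
      · rw [neg_smul, ← smul_neg, hr, smul_smul, inv_mul_cancel₀ hr0.ne', one_smul]; rfl
      · rintro k (⟨h1, h2⟩ | ⟨h1, h2⟩)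
        · exact absurd (lt_of_lt_of_le h1 h2) (not_lt.2 (le_of_lt hji))
        · have := hl k h1 h2
          rw [map_neg, ht_neg] at this
          linarith
    · obtain ⟨j, hij, -, hl, t, ht, r, hr0, hr⟩ := hw.exists_change_first hroot i.2.le
        (by rw [hvi]; exact D.ht_root_pos Q[i])
        (by rw [hI.partialProd_length]; exact hw₀.ht_inv_neg hroot hpos)
      obtain ⟨hj, hjI, rfl⟩ := letterOutside_eq_some ht
      refine ⟨⟨j, hj⟩, hjI, ⟨r⁻¹, inv_ne_zero hr0.ne', ?_⟩, fun h => absurd h hpos.not_gt, ?_⟩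
      · rw [hr, smul_smul, inv_mul_cancel₀ hr0.ne', one_smul]; rfl
      · rintro k (⟨h1, h2⟩ | ⟨h1, h2⟩)
        · exact hl k (le_of_lt h1) h2
        · have h3 : j < (k : ℕ) := h1
          have h4 : (k : ℕ) ≤ i := h2
          omega
  obtain ⟨j, hj, ⟨r, hr0, hr⟩, hlt, hk⟩ := main
  refine ⟨j, hj, ⟨r, hr0, hr⟩, ⟨_, ?_, brickVector_flip hi hj hr0 hr⟩, hlt⟩
  have hvv : 0 < inner ℝ v v := real_inner_self_pos.2 hroot.ne_zero
  have hnonneg : ∀ k : Fin Q.length, i < k ∧ k ≤ j ∨ j < k ∧ k ≤ i →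
      0 ≤ inner ℝ v (D.weightFunction Q I k) := by
    intro k hk'
    rw [weightFunction_eq, ← LinearIsometryEquiv.inner_inv_left]
    exact (hroot.map (inv_mem (D.partialProd_mem Q I k))).inner_weight_nonneg (hk k hk') _
  refine Finset.sum_pos' (fun k hk' => ?_) ?_
  · have := hnonneg k (by simpa using hk')
    positivity
  -- The later of the two positions is affected by the flip and contributes strictly: there a root
  -- proportional to `v` is paired with its own weight.
  · rcases lt_trichotomy i j with h | h | h
    · refine ⟨j, by simp [h], ?_⟩
      have h1 : 0 < inner ℝ v (D.weightFunction Q I j) := by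
        refine lt_of_le_of_ne (hnonneg j (Or.inl ⟨h, le_rfl⟩)) fun h0 => ?_
        have h2 := D.inner_rootFunction_weightFunction_self Q I j
        rw [hr, real_inner_smul_left, ← h0, mul_zero] at h2
        exact lt_irrefl _ h2
      positivity
    · exact absurd hi (h ▸ hj)
    · refine ⟨i, by simp [h], ?_⟩
      have h1 : 0 < inner ℝ v (D.weightFunction Q I i) :=
        D.inner_rootFunction_weightFunction_self Q I i
      positivity

/-! ### Facets containing a given position -/

variable (D) in
/-- The facet-defining data at the position `k`: the roots of `I` at other positions are orthogonal
to `ν`, which is the weight at `k`, and the linear form `ν` takes the value `h` at the brick vector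
of `I`. -/
def HasNormal (Q : List B) (k : Fin Q.length) (ν : V) (h : ℝ) (I : Finset (Fin Q.length)) : Prop :=
  (∀ i ∈ I, i ≠ k → inner ℝ (D.rootFunction Q I i) ν = 0) ∧ D.weightFunction Q I k = ν ∧
    inner ℝ ν (D.brickVector Q I) = h

theorem hasNormal_flip_iff {Q : List B} {I : Finset (Fin Q.length)} {i j k : Fin Q.length} {r : ℝ}
    (hi : i ∈ I) (hj : j ∉ I) (hr : r ≠ 0)
    (hij : D.rootFunction Q I j = r • D.rootFunction Q I i) (hk : k ∈ I) (hik : i ≠ k) (ν : V)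
    (h : ℝ) : D.HasNormal Q k ν h (insert j (I.erase i)) ↔ D.HasNormal Q k ν h I := by
  set v := D.rootFunction Q I i with hv
  have hjk : j ≠ k := fun h => hj (h ▸ hk)
  have hroot : ∀ l, inner ℝ v ν = 0 →
      inner ℝ (D.rootFunction Q (insert j (I.erase i)) l) ν = inner ℝ (D.rootFunction Q I l) ν := by
    intro l h0
    rw [rootFunction_flip hi hj hr hij]
    split_ifs
    · rw [inner_reflectionIn, reflectionIn_of_inner_eq_zero h0]
    · rfl
  have hbrick : inner ℝ v ν = 0 →
      inner ℝ ν (D.brickVector Q (insert j (I.erase i))) = inner ℝ ν (D.brickVector Q I) := by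
    intro h0
    rw [brickVector_flip hi hj hr hij, inner_sub_right, real_inner_smul_right,
      real_inner_comm v ν, h0, mul_zero, sub_zero]
  constructor
  · rintro ⟨h1, h2, h3⟩
    -- After the flip the root at `j` is `r • v` up to sign, so its orthogonality to `ν` passes to
    -- `v`.
    have h0 : inner ℝ v ν = 0 := by
      have h4 := h1 j (by simp) hjk
      rw [rootFunction_flip hi hj hr hij, hij, ← hv] at h4
      split_ifs at h4
      · rw [map_smul, reflectionIn_self, real_inner_smul_left, inner_neg_left] at h4
        simpa [hr] using h4
      · rw [real_inner_smul_left] at h4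
        simpa [hr] using h4
    refine ⟨fun l hl hlk => ?_, ?_, ?_⟩
    · by_cases hli : l = i
      · rw [hli]; exact h0
      · rw [← hroot l h0]
        exact h1 l (by simp [hli, hl]) hlk
    · rw [weightFunction_flip hi hj hr hij] at h2
      split_ifs at h2
      · have h5 : D.weightFunction Q I k = reflectionIn v ν := by
          rw [← h2, ← LinearIsometryEquiv.mul_app, reflectionIn_mul_self,
            LinearIsometryEquiv.one_app]
        rw [h5, reflectionIn_of_inner_eq_zero h0]
      · exact h2
    · rw [← h3, hbrick h0]
  · rintro ⟨h1, h2, h3⟩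
    have h0 : inner ℝ v ν = 0 := h1 i hi hik
    refine ⟨fun l hl hlk => ?_, ?_, ?_⟩
    · rw [hroot l h0]
      rcases Finset.mem_insert.1 hl with rfl | hl
      · rw [hij, real_inner_smul_left, h0, mul_zero]
      · exact h1 l (Finset.mem_of_mem_erase hl) hlk
    · rw [weightFunction_flip hi hj hr hij, h2, ← hv, reflectionIn_of_inner_eq_zero h0, ite_self]
    · rw [hbrick h0, h3]

/-- Flipping a position other than `k` with negative root moves it to the left. The sum of the
positions decreases, so the process ends, and every flip preserves the normal data at `k`. -/
theorem IsFacet.exists_sink {Q : List B} {w₀ : V ≃ₗᵢ[ℝ] V} (hw₀ : D.IsLongest w₀)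
    (k : Fin Q.length) (ν : V) (h : ℝ) (n : ℕ) : ∀ I : Finset (Fin Q.length),
    D.IsFacet Q w₀ I → k ∈ I → ∑ i ∈ I, (i : ℕ) = n →
    ∃ G, D.IsFacet Q w₀ G ∧ k ∈ G ∧ (∀ i ∈ G, i ≠ k → 0 < D.ht (D.rootFunction Q G i)) ∧
      (D.HasNormal Q k ν h G ↔ D.HasNormal Q k ν h I) := by
  induction n using Nat.strong_induction_on with
  | _ n ih =>
    intro I hI hk hn
    by_cases hpos : ∀ i ∈ I, i ≠ k → 0 < D.ht (D.rootFunction Q I i)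
    · exact ⟨I, hI, hk, hpos, Iff.rfl⟩
    · push Not at hpos
      obtain ⟨i, hi, hik, hle⟩ := hpos
      have hneg := (D.isRoot_rootFunction Q I i).ht_neg_of_not_pos (not_lt.2 hle)
      obtain ⟨j, hj, ⟨r, hr0, hr⟩, -, hlt⟩ := hI.exists_flip hw₀ hi
      have hlt' : (j : ℕ) < i := hlt hneg
      have hsum : ∑ l ∈ insert j (I.erase i), (l : ℕ) < n := by
        rw [Finset.sum_insert (by simp [hj]), ← hn, ← Finset.add_sum_erase I _ hi]
        omega
      obtain ⟨G, h1, h2, h3, h4⟩ := ih _ hsum _ (hI.flip hi hj hr0 hr)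
        (by simp [hk, hik.symm]) rfl
      exact ⟨G, h1, h2, h3, h4.trans (hasNormal_flip_iff hi hj hr0 hr hk hik ν h)⟩

/-- The normal data at a position are the same for all facets containing it. -/
theorem HasNormal.of_isFacet {Q : List B} {w₀ : V ≃ₗᵢ[ℝ] V} (hw₀ : D.IsLongest w₀)
    {k : Fin Q.length} {ν : V} {h : ℝ} {I J : Finset (Fin Q.length)} (hI : D.IsFacet Q w₀ I)
    (hJ : D.IsFacet Q w₀ J) (hkI : k ∈ I) (hkJ : k ∈ J) (hn : D.HasNormal Q k ν h I) :
    D.HasNormal Q k ν h J := by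
  obtain ⟨G, h1, h2, h3, h4⟩ := IsFacet.exists_sink hw₀ k ν h _ I hI hkI rfl
  obtain ⟨G', h1', h2', h3', h4'⟩ := IsFacet.exists_sink hw₀ k ν h _ J hJ hkJ rfl
  -- There is only one sink containing `k`, so both facets are linked to it by flips that keep `k`.
  have : G = G' := h1.eq_of_ht_pos h1' (K := {k}) (by simpa) (by simpa)
    (fun i hi hik => h3 i hi (by simpa using hik)) (fun i hi hik => h3' i hi (by simpa using hik))
  subst this
  exact h4'.1 (h4.2 hn)

end CoxeterData

/-! ### Orbits of roots and weights under a Coxeter element -/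

namespace CoxeterData

variable {B V : Type*} [NormedAddCommGroup V] [InnerProductSpace ℝ V]
variable (D : CoxeterData B V) [FiniteDimensional ℝ V] [Fintype B]

/-! ### Words avoiding a letter -/

theorem wordProd_weight_of_notMem {v : List B} {t : B} (ht : t ∉ v) :
    D.wordProd v (D.weight t) = D.weight t := by
  induction v with
  | nil => rfl
  | cons s v ih =>
    rw [List.mem_cons, not_or] at ht
    rw [wordProd_cons, LinearIsometryEquiv.mul_app, ih ht.2, simple_weight_of_ne _ (Ne.symm ht.1)]

theorem inner_wordProd_weight_of_notMem {v : List B} {t : B} (ht : t ∉ v) (x : V) :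
    inner ℝ (D.wordProd v x) (D.weight t) = inner ℝ x (D.weight t) := by
  conv_lhs => rw [← D.wordProd_weight_of_notMem ht]
  rw [LinearIsometryEquiv.inner_map_map]

theorem ht_wordProd_root_pos {v : List B} {t : B} (ht : t ∉ v) :
    0 < D.ht (D.wordProd v (D.root t)) := by
  apply ((D.isRoot_root t).map (D.wordProd_mem v)).ht_pos_of_inner_weight_pos (s := t)
  rw [inner_wordProd_weight_of_notMem _ ht, inner_root_weight_self]
  exact half_pos (D.inner_root_self_pos t)

/-- A word avoiding `s` and `t` adds to `α_t` a nonnegative combination of simple roots different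
from `α_s` and `α_t`, and these pair nonpositively with `α_s`. -/
theorem inner_wordProd_root_le {v : List B} {s t : B} (hs : s ∉ v) (ht : t ∉ v) (hst : s ≠ t) :
    inner ℝ (D.wordProd v (D.root t)) (D.root s) ≤ inner ℝ (D.root t) (D.root s) := by
  classical
  have hroot := (D.isRoot_root t).map (D.wordProd_mem v)
  have hpos := D.ht_wordProd_root_pos ht
  rw [D.eq_sum_root (D.wordProd v (D.root t)), sum_inner, ← Finset.add_sum_erase _ _
    (Finset.mem_univ t), inner_wordProd_weight_of_notMem _ ht, inner_root_weight_self,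
    real_inner_smul_left]
  have h0 := (D.inner_root_self_pos t).ne'
  rw [show 2 * (inner ℝ (D.root t) (D.root t) / 2) / inner ℝ (D.root t) (D.root t) = (1 : ℝ) by
    field_simp, one_mul, add_le_iff_nonpos_right]
  refine Finset.sum_nonpos fun r _ => ?_
  rw [real_inner_smul_left]
  by_cases hrs : r = s
  · subst hrs
    rw [inner_wordProd_weight_of_notMem _ hs, inner_root_weight_of_ne _ hst.symm]
    simp
  · have h1 := hroot.inner_weight_nonneg hpos r
    have h2 := D.inner_root_self_pos r
    exact mul_nonpos_of_nonneg_of_nonpos (by positivity) (D.inner_root_root_nonpos hrs)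

/-- If `s v` fixes `x`, then `v x = s x`. The word `v` preserves the pairing with `ω_s`, whereas `s`
changes it by `⟪α_s, x⟫`, which is therefore zero; then `v` fixes `x` as well. -/
theorem inner_root_eq_zero_of_wordProd_eq {v : List B} (hv : v.Nodup) {x : V}
    (hx : D.wordProd v x = x) : ∀ s ∈ v, inner ℝ (D.root s) x = 0 := by
  induction v with
  | nil => simp
  | cons s v ih =>
    rw [List.nodup_cons] at hv
    have h1 : D.wordProd v x = D.simple s x := by
      conv_rhs => rw [← hx, wordProd_cons, LinearIsometryEquiv.mul_app, simple_simple]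
    have h2 := D.inner_wordProd_weight_of_notMem hv.1 x
    rw [h1, inner_simple, simple_weight_self, inner_sub_right] at h2
    have h3 : inner ℝ (D.root s) x = 0 := by rw [real_inner_comm]; linarith
    have h4 : D.simple s x = x := reflectionIn_of_inner_eq_zero h3
    intro t ht
    rcases List.mem_cons.1 ht with rfl | ht
    · exact h3
    · exact ih hv.2 (h1.trans h4) t ht

/-! ### Coxeter elements -/

/-- The orbit of the fundamental weight `t` under the Coxeter element. -/
noncomputable def cWeight (c : List B) (t : B) (i : ℕ) : V := (D.wordProd c ^ i) (D.weight t)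

variable [DecidableEq B]

/-- The roots at the occurrences of the letter `t` in `c^∞`. -/
noncomputable def cRoot (c : List B) (t : B) (i : ℕ) : V :=
  (D.wordProd c ^ i) (D.prefixProd c (c.idxOf t) (D.root t))

theorem notMem_take_of_le_idxOf {c : List B} {t : B} {k : ℕ} (h : k ≤ c.idxOf t) :
    t ∉ c.take k := by
  rw [List.mem_iff_getElem]
  rintro ⟨i, hi, h1⟩
  rw [List.length_take] at hi
  rw [List.getElem_take] at h1
  have : c.idxOf t ≤ i := by
    by_contra h2
    have := List.not_of_lt_findIdx (p := (· == t)) (xs := c) (i := i) (by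
      rw [← List.idxOf]; omega)
    simp [h1] at this
  omega

theorem prefixProd_idxOf_weight {c : List B} (hc : c.Nodup) (t : B) (k : ℕ) :
    D.prefixProd c k (D.weight t) =
      D.cWeight c t (if c.idxOf t < k then 1 else 0) := by
  split_ifs with h
  · rw [cWeight, pow_one, D.wordProd_take_drop c k, LinearIsometryEquiv.mul_app]
    congr 1
    rw [wordProd_weight_of_notMem]
    intro ht
    have h0 : t ∈ c := List.mem_of_mem_drop ht
    have h1 := List.idxOf_lt_length_of_mem h0
    have h2 : t ∈ c.take k := by
      rw [List.mem_iff_getElem]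
      exact ⟨c.idxOf t, by rw [List.length_take]; omega, by rw [List.getElem_take]; simp⟩
    rw [← List.take_append_drop k c] at hc
    exact (List.nodup_append.1 hc).2.2 _ h2 _ ht rfl
  · rw [cWeight, pow_zero, LinearIsometryEquiv.one_app, prefixProd,
      wordProd_weight_of_notMem _ (notMem_take_of_le_idxOf (not_lt.1 h))]

/-- Reading one copy of `c`, only the letter `t` alters the image of `ω_t`, and it does so by
subtracting the current image of `α_t`. -/
theorem cRoot_eq_sub {c : List B} (hc : c.Nodup) {t : B} (ht : t ∈ c) (i : ℕ) :
    D.cRoot c t i = D.cWeight c t i - D.cWeight c t (i + 1) := by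
  have h1 := List.idxOf_lt_length_of_mem ht
  have h2 := D.prefixProd_idxOf_weight hc t (c.idxOf t + 1)
  rw [if_pos (Nat.lt_succ_self _), D.prefixProd_succ c h1, LinearIsometryEquiv.mul_app,
    List.getElem_idxOf, simple_weight_self, map_sub, D.prefixProd_idxOf_weight hc t,
    if_neg (lt_irrefl _)] at h2
  have h3 : D.prefixProd c (c.idxOf t) (D.root t) = D.cWeight c t 0 - D.cWeight c t 1 := by
    rw [← h2]; abel
  rw [cRoot, h3, map_sub, cWeight, cWeight, ← LinearIsometryEquiv.mul_app,
    ← LinearIsometryEquiv.mul_app, ← pow_add, ← pow_add]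
  rfl

theorem isRoot_cRoot (c : List B) (t : B) (i : ℕ) : D.IsRoot (D.cRoot c t i) :=
  ((D.isRoot_root t).map (D.prefixProd_mem _ _)).map (pow_mem (D.wordProd_mem c) i)

theorem ht_cRoot_zero_pos (c : List B) (t : B) : 0 < D.ht (D.cRoot c t 0) :=
  D.ht_wordProd_root_pos (notMem_take_of_le_idxOf le_rfl)

theorem eq_zero_of_coxeter_fixed {c : List B} (hc : c.Nodup) (hall : ∀ s, s ∈ c) {x : V}
    (hx : D.wordProd c x = x) : x = 0 := by
  apply D.ext_inner_root
  intro s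
  rw [D.inner_root_eq_zero_of_wordProd_eq hc hx s (hall s), inner_zero_right]

/-- Over a full period of the Coxeter element the roots telescope to zero. Their heights sum to zero
while the first one is positive. -/
theorem exists_cRoot_neg {c : List B} (hc : c.Nodup) (hall : ∀ s, s ∈ c) (t : B) :
    ∃ i, D.ht (D.cRoot c t i) < 0 := by
  by_contra! h
  have := D.finite_W
  obtain ⟨n, hn, hn1⟩ := (isOfFinOrder_of_finite
    (⟨D.wordProd c, D.wordProd_mem c⟩ : D.W)).exists_pow_eq_one
  have hn1 : D.wordProd c ^ n = 1 := by simpa [Subtype.ext_iff] using hn1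
  have h1 : ∑ i ∈ Finset.range n, D.cRoot c t i = 0 := by
    simp only [D.cRoot_eq_sub hc (hall t)]
    rw [Finset.sum_range_sub', cWeight, cWeight, hn1, pow_zero, sub_self]
  have h2 : ∑ i ∈ Finset.range n, D.ht (D.cRoot c t i) = 0 := by
    simp only [ht, ← sum_inner]
    rw [h1, inner_zero_left]
  have h3 := (Finset.sum_eq_zero_iff_of_nonneg fun i _ => h i).1 h2 0 (Finset.mem_range.2 hn)
  exact (D.ht_cRoot_zero_pos c t).ne' h3

/-- The number of occurrences of the letter `t` in the `c`-sorting word of the longest element. -/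
noncomputable def mult (c : List B) (t : B) : ℕ := sInf {i | D.ht (D.cRoot c t i) < 0}

theorem ht_cRoot_mult_neg {c : List B} (hc : c.Nodup) (hall : ∀ s, s ∈ c) (t : B) :
    D.ht (D.cRoot c t (D.mult c t)) < 0 := Nat.sInf_mem (D.exists_cRoot_neg hc hall t)

theorem ht_cRoot_pos {c : List B} {t : B} {i : ℕ} (h : i < D.mult c t) :
    0 < D.ht (D.cRoot c t i) := by
  by_contra h1
  exact Nat.notMem_of_lt_sInf h ((D.isRoot_cRoot c t i).ht_neg_of_not_pos h1)

theorem mult_le {c : List B} {t : B} {i : ℕ} (h : D.ht (D.cRoot c t i) < 0) : D.mult c t ≤ i :=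
  Nat.sInf_le h

theorem mult_pos {c : List B} (hc : c.Nodup) (hall : ∀ s, s ∈ c) (t : B) : 0 < D.mult c t := by
  rw [Nat.pos_iff_ne_zero]
  intro h
  have := D.ht_cRoot_mult_neg hc hall t
  rw [h] at this
  linarith [D.ht_cRoot_zero_pos c t]

theorem wordProd_cRoot (c : List B) (t : B) (i : ℕ) :
    D.wordProd c (D.cRoot c t i) = D.cRoot c t (i + 1) := by
  rw [cRoot, cRoot, pow_succ', LinearIsometryEquiv.mul_app]

theorem wordProd_cWeight (c : List B) (t : B) (i : ℕ) :
    D.wordProd c (D.cWeight c t i) = D.cWeight c t (i + 1) := by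
  rw [cWeight, cWeight, pow_succ', LinearIsometryEquiv.mul_app]

/-- When `c` makes a positive root negative, the opposite of the image is crossed while reading `c`
once, so it is proportional to the root at one of its letters. -/
theorem exists_eq_neg_smul_cRoot {c : List B} (hc : c.Nodup) {v : V}
    (hv : D.IsRoot v) (h1 : 0 < D.ht v) (h2 : D.ht (D.wordProd c v) < 0) :
    ∃ t, ∃ r : ℝ, 0 < r ∧ D.wordProd c v = -(r • D.cRoot c t 0) := by
  obtain ⟨k, -, hk, -, t, ht, r, hr0, hr⟩ := (D.isWalk_prefixProd c).exists_change_first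
    (hv.map (D.wordProd_mem c)).neg (Nat.zero_le c.length)
    (by rw [prefixProd_zero, inv_one, LinearIsometryEquiv.one_app, ht_neg]; linarith)
    (by
      rw [prefixProd_of_length_le _ _ le_rfl, map_neg, LinearIsometryEquiv.inv_app_self, ht_neg]
      linarith)
  obtain ⟨hk', rfl⟩ := List.getElem?_eq_some_iff.1 ht
  refine ⟨(c)[k], r, hr0, ?_⟩
  rw [cRoot, pow_zero, LinearIsometryEquiv.one_app, hc.idxOf_getElem, ← hr, neg_neg]

/-- The last weight in the orbit before the root becomes negative is antidominant. -/
theorem exists_cWeight_mult {c : List B} (hc : c.Nodup) (hall : ∀ s, s ∈ c) (t : B) :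
    ∃ s, ∃ r : ℝ, 0 < r ∧ D.cWeight c t (D.mult c t) = -(r • D.weight s) := by
  have h0 := D.mult_pos hc hall t
  obtain ⟨i, hi⟩ : ∃ i, D.mult c t = i + 1 := ⟨D.mult c t - 1, by omega⟩
  obtain ⟨s, r, hr0, hr⟩ := D.exists_eq_neg_smul_cRoot hc (D.isRoot_cRoot c t i)
    (D.ht_cRoot_pos (by omega)) (by
      rw [wordProd_cRoot, ← hi]; exact D.ht_cRoot_mult_neg hc hall t)
  refine ⟨s, r, hr0, ?_⟩
  -- Both roots in `hr` have the form `(1 - c)` applied to a weight. The relation says that `c^m ω_t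
  -- + r ω_s`, with `m = mult c t`, is fixed by `c`, and the Coxeter element fixes only zero.
  rw [eq_neg_iff_add_eq_zero]
  apply D.eq_zero_of_coxeter_fixed hc hall
  rw [wordProd_cRoot, ← hi, cRoot_eq_sub _ hc (hall _), cRoot_eq_sub _ hc (hall _)] at hr
  have h1 : D.wordProd c (D.weight s) = D.cWeight c s (0 + 1) := by
    rw [cWeight, zero_add, pow_one]
  have h2 : D.cWeight c s 0 = D.weight s := rfl
  rw [map_add, map_smul, wordProd_cWeight, h1]
  rw [h2, smul_sub] at hr
  have h3 : D.cWeight c t (D.mult c t) = D.cWeight c t (D.mult c t + 1) -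
    (r • D.weight s - r • D.cWeight c s (0 + 1)) := by
    rw [sub_eq_add_neg, ← hr]; abel
  rw [h3]
  abel

theorem ht_neg_of_inner_cWeight_mult_pos {c : List B} (hc : c.Nodup) (hall : ∀ s, s ∈ c) (t : B)
    {v : V} (hv : D.IsRoot v) (h : 0 < inner ℝ v (D.cWeight c t (D.mult c t))) : D.ht v < 0 := by
  obtain ⟨s, r, hr0, hr⟩ := D.exists_cWeight_mult hc hall t
  rw [hr, inner_neg_right, real_inner_smul_right] at h
  refine hv.ht_neg_of_inner_weight_neg (s := s) ?_
  by_contra h1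
  have := mul_nonneg hr0.le (not_lt.1 h1)
  linarith

theorem take_drop_split {c : List B} (hc : c.Nodup) {s t : B} (ht : t ∈ c)
    (hst : c.idxOf s < c.idxOf t) :
    ∃ a b d : List B, c = a ++ s :: b ++ t :: d ∧ c.take (c.idxOf s) = a ∧
      c.take (c.idxOf t) = a ++ s :: b ∧ s ∉ a ∧ s ∉ b ∧ s ∉ d ∧ t ∉ a ∧ t ∉ b ∧ t ∉ d := by
  have h1 := List.idxOf_lt_length_of_mem ht
  have h2 : c.idxOf s < c.length := hst.trans h1
  have h3 : c.take (c.idxOf t) = c.take (c.idxOf s) ++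
      s :: (c.take (c.idxOf t)).drop (c.idxOf s + 1) := by
    conv_lhs => rw [← List.take_append_drop (c.idxOf s) (c.take (c.idxOf t))]
    rw [List.take_take, min_eq_left hst.le, List.drop_eq_getElem_cons (by
      rw [List.length_take]; omega), List.getElem_take, List.getElem_idxOf]
  have h4 : c = c.take (c.idxOf t) ++ t :: c.drop (c.idxOf t + 1) := by
    conv_lhs => rw [← List.take_append_drop (c.idxOf t) c, List.drop_eq_getElem_cons h1,
      List.getElem_idxOf]
  have h5 : c = c.take (c.idxOf s) ++ s :: (c.take (c.idxOf t)).drop (c.idxOf s + 1) ++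
      t :: c.drop (c.idxOf t + 1) := by rw [← h3]; exact h4
  refine ⟨_, _, _, h5, rfl, h3, ?_⟩
  rw [h5] at hc
  simp only [List.nodup_append, List.nodup_cons, List.mem_append, List.mem_cons] at hc
  grind

/-- Adjacent letters alternate: `t` does not occur more often than an adjacent letter `s` that comes
before it in `c`, and at most once less often. -/
theorem mult_le_mult {c : List B} (hc : c.Nodup) (hall : ∀ s, s ∈ c) {s t : B}
    (hst : c.idxOf s < c.idxOf t) (hadj : inner ℝ (D.root s) (D.root t) ≠ 0) :
    D.mult c t ≤ D.mult c s ∧ D.mult c s ≤ D.mult c t + 1 := by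
  have hne : s ≠ t := by rintro rfl; exact lt_irrefl _ hst
  have hneg : inner ℝ (D.root s) (D.root t) < 0 :=
    lt_of_le_of_ne (D.inner_root_root_nonpos hne) hadj
  obtain ⟨a, b, d, hcab, hs, ht, sa, sb, sd, ta, tb, td⟩ := take_drop_split hc (hall t) hst
  have hps : D.prefixProd c (c.idxOf s) = D.wordProd a := by rw [prefixProd, hs]
  have hpt : D.prefixProd c (c.idxOf t) = D.wordProd a * D.simple s * D.wordProd b := by
    rw [prefixProd, ht, wordProd_append, wordProd_cons, mul_assoc]
  have hcp : D.wordProd c = D.wordProd a * D.simple s * D.wordProd b * D.simple t *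
      D.wordProd d := by
    conv_lhs => rw [hcab]
    simp only [wordProd_append, wordProd_cons, mul_assoc]
  constructor
  · apply D.mult_le
    apply D.ht_neg_of_inner_cWeight_mult_pos hc hall s (D.isRoot_cRoot c t _)
    -- At the occurrence of `t` in this copy of `c` the letter `s` has already been read, so the
    -- current weight of `s` is the next one of its orbit and is orthogonal to the root of `t`. The
    -- pairing with the antidominant weight before it thus reduces to one with the root of `s`, and
    -- is positive because the letters `b` in between avoid both `s` and `t`.
    have h1 : inner ℝ (D.cRoot c t (D.mult c s)) (D.cWeight c s (D.mult c s + 1)) = 0 := by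
      have : D.cWeight c s (D.mult c s + 1) = (D.wordProd c ^ (D.mult c s))
          (D.prefixProd c (c.idxOf t) (D.weight s)) := by
        rw [D.prefixProd_idxOf_weight hc, if_pos hst, cWeight, cWeight, pow_succ, pow_one]
        rfl
      rw [this, cRoot, LinearIsometryEquiv.inner_map_map, LinearIsometryEquiv.inner_map_map,
        inner_root_weight_of_ne _ hne.symm]
    have h2 : D.cWeight c s (D.mult c s) =
        D.cWeight c s (D.mult c s + 1) + D.cRoot c s (D.mult c s) := by
      rw [D.cRoot_eq_sub hc (hall s)]; abel
    rw [h2, inner_add_right, h1, zero_add, cRoot, cRoot, LinearIsometryEquiv.inner_map_map, hps,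
      hpt, mul_assoc, LinearIsometryEquiv.mul_app, LinearIsometryEquiv.inner_map_map,
      LinearIsometryEquiv.mul_app, inner_simple, simple_root, inner_neg_right]
    have := D.inner_wordProd_root_le sb tb hne
    rw [real_inner_comm (D.root s) (D.root t)] at this
    linarith
  · apply D.mult_le
    apply D.ht_neg_of_inner_cWeight_mult_pos hc hall t (D.isRoot_cRoot c s _)
    -- The same argument applies between an occurrence of `t` and the next occurrence of `s`. The
    -- letters in between are now `d ++ a`, running over the end of one copy of `c` into the next.
    have h1 : inner ℝ (D.cRoot c s (D.mult c t + 1)) (D.cWeight c t (D.mult c t + 1)) = 0 := by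
      have : D.cWeight c t (D.mult c t + 1) = (D.wordProd c ^ (D.mult c t + 1))
          (D.prefixProd c (c.idxOf s) (D.weight t)) := by
        rw [D.prefixProd_idxOf_weight hc, if_neg hst.not_gt, cWeight, cWeight, pow_zero]
        rfl
      rw [this, cRoot, LinearIsometryEquiv.inner_map_map, LinearIsometryEquiv.inner_map_map,
        inner_root_weight_of_ne _ hne]
    have h2 : D.cWeight c t (D.mult c t) =
        D.cWeight c t (D.mult c t + 1) + D.cRoot c t (D.mult c t) := by
      rw [D.cRoot_eq_sub hc (hall t)]; abel
    rw [h2, inner_add_right, h1, zero_add, cRoot, cRoot, pow_succ, LinearIsometryEquiv.mul_app,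
      LinearIsometryEquiv.inner_map_map, hps, hpt, hcp]
    simp only [LinearIsometryEquiv.mul_app, LinearIsometryEquiv.inner_map_map]
    rw [inner_simple, simple_root, inner_neg_right, ← LinearIsometryEquiv.mul_app,
      ← wordProd_append]
    have := D.inner_wordProd_root_le (v := d ++ a) (s := t) (t := s) (by simp [td, ta])
      (by simp [sd, sa]) hne.symm
    linarith

end CoxeterData

namespace CoxeterData

variable {B V : Type*} [NormedAddCommGroup V] [InnerProductSpace ℝ V]
variable (D : CoxeterData B V) [FiniteDimensional ℝ V] [Fintype B] [DecidableEq B]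

variable {D}

/-! ### Sorting words -/

/-- A letter missing from `c` would yield a nonzero weight fixed by a Coxeter element. Containing
all letters and being no longer than `e`, the reduced word `c` cannot repeat one. -/
theorem IsCoxeterElement.nodup_and_mem {c : List B} (hc : D.IsReduced c)
    (hcox : D.IsCoxeterElement (D.wordProd c)) : c.Nodup ∧ ∀ s, s ∈ c := by
  obtain ⟨e, he, hall, hprod⟩ := hcox
  have hmem : ∀ s, s ∈ c := by
    intro s
    by_contra hs
    have h1 := D.wordProd_weight_of_notMem hs
    rw [← hprod] at h1
    have h2 := D.eq_zero_of_coxeter_fixed he hall h1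
    have h3 := D.inner_root_weight_self s
    rw [h2, inner_zero_right] at h3
    linarith [D.inner_root_self_pos s]
  refine ⟨?_, hmem⟩
  have h1 : c.toFinset = Finset.univ := by ext s; simp [hmem]
  have h2 : e.toFinset = Finset.univ := by ext s; simp [hall]
  have h3 : c.length ≤ e.length := by rw [hc, ← hprod]; exact D.length_le e
  rw [← List.toFinset_card_of_nodup he, h2, ← h1, List.card_toFinset] at h3
  rw [← (List.dedup_sublist c).eq_of_length_le h3]
  exact List.nodup_dedup c

/-- Every word is a subword of `c^∞` beyond any given position. -/
theorem exists_positions {c : List B} (hall : ∀ s, s ∈ c) (v : List B) (k : ℕ) :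
    ∃ p : List ℕ, p.Pairwise (· < ·) ∧ (∀ x ∈ p, k < x) ∧
      p.map (fun k => getElem? c (k % c.length)) = v.map some := by
  induction v generalizing k with
  | nil => exact ⟨[], List.Pairwise.nil, by simp, rfl⟩
  | cons s v ih =>
    have hs := List.idxOf_lt_length_of_mem (hall s)
    have hk : k < c.length * (k + 1) + c.idxOf s := by nlinarith
    obtain ⟨p, h1, h2, h3⟩ := ih (c.length * (k + 1) + c.idxOf s)
    refine ⟨(c.length * (k + 1) + c.idxOf s) :: p, List.pairwise_cons.2 ⟨h2, h1⟩, ?_, ?_⟩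
    · intro x hx
      rcases List.mem_cons.1 hx with rfl | hx
      · exact hk
      · exact hk.trans (h2 x hx)
    · rw [List.map_cons, List.map_cons, h3, Nat.mul_add_mod, Nat.mod_eq_of_lt hs,
        List.getElem?_eq_getElem hs, List.getElem_idxOf]

section Sorting

variable {c : List B} {w₀ : V ≃ₗᵢ[ℝ] V} {u : List B} {p : List ℕ}

theorem IsReducedSubwordAt.length_eq (h : D.IsReducedSubwordAt c w₀ p u) :
    p.length = u.length := by
  simpa using congrArg List.length h.2.1

theorem IsReducedSubwordAt.getElem_eq (h : D.IsReducedSubwordAt c w₀ p u) {i : ℕ}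
    (hi : i < p.length) (hi' : i < u.length) : (c)[p[i] % c.length]? = some u[i] := by
  have h1 : (p.map (fun k => getElem? c (k % c.length)))[i]'(by simpa using hi) =
      (u.map some)[i]'(by simpa using hi') := by
    simp only [h.2.1]
  simpa using h1

theorem take_append_cons_lt {p l : List ℕ} {j k : ℕ} (hj : j < p.length) (hk : k < p[j]) :
    p.take j ++ k :: l < p := by
  conv_rhs => rw [← List.take_append_drop j p, List.drop_eq_getElem_cons hj]
  exact List.Lex.append_left _ (List.Lex.rel hk) _

/-- The sorting word is greedy: a letter is skipped only if it does not increase the length. -/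
theorem IsReducedSubwordAt.not_ht_pos (h : D.IsReducedSubwordAt c w₀ p u) (hall : ∀ s, s ∈ c)
    (hw₀ : D.IsLongest w₀) (hmin : ∀ p' u', D.IsReducedSubwordAt c w₀ p' u' → p ≤ p') {j k : ℕ}
    (hj : j ≤ u.length) (h1 : ∀ i (hi : i < p.length), i < j → p[i] < k)
    (h2 : ∀ hj : j < p.length, k < p[j]) {s : B} (hs : getElem? c (k % c.length) = some s) :
    ¬0 < D.ht (D.prefixProd u j (D.root s)) := by
  intro hpos
  have hlen := h.length_eq
  by_cases hjl : j < p.length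
  -- If the skipped letter were an ascent, the prefix followed by it would extend to a reduced word
  -- of `w₀`, whose remaining letters can be placed after `k`. This gives a lexicographically
  -- smaller sequence of positions.
  · have hr : D.IsReduced (u.take j ++ [s]) := (h.2.2.1.take j).append_singleton hpos
    obtain ⟨v, hv, hvw⟩ := hr.exists_extension hw₀
    obtain ⟨q, hq1, hq2, hq3⟩ := exists_positions hall v k
    have h3 : D.IsReducedSubwordAt c w₀ (p.take j ++ k :: q) (u.take j ++ [s] ++ v) := by
      refine ⟨?_, ?_, hv, hvw⟩
      · rw [List.pairwise_append, List.pairwise_cons]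
        have h4 : ∀ a ∈ p.take j, a < k := by
          intro a ha
          obtain ⟨i, hi, rfl⟩ := List.mem_iff_getElem.1 ha
          rw [List.length_take] at hi
          rw [List.getElem_take]
          exact h1 i (by omega) (by omega)
        refine ⟨h.1.sublist (List.take_sublist _ _), ⟨hq2, hq1⟩, ?_⟩
        intro a ha b hb
        rcases List.mem_cons.1 hb with rfl | hb
        · exact h4 a ha
        · exact (h4 a ha).trans (hq2 b hb)
      · rw [List.map_append, List.map_cons, hq3, hs, List.map_take, h.2.1]
        simp [List.map_take]
    exact absurd (hmin _ _ h3) (not_le.2 (take_append_cons_lt hjl (h2 hjl)))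
  · rw [D.prefixProd_of_length_le _ (by omega), h.2.2.2] at hpos
    linarith [hw₀.ht_root_neg s]

variable (D) in
theorem map_root_eq (x : V ≃ₗᵢ[ℝ] V) (s : B) :
    x (D.root s) = ∑ t, (2 * inner ℝ (D.root t) (D.root s) / inner ℝ (D.root t) (D.root t)) •
      x (D.weight t) := by
  conv_lhs => rw [D.eq_sum_weight (D.root s), map_sum]
  simp only [map_smul]

variable (D) in
/-- The root of the letter `s` is determined by the weights of the adjacent letters. -/
theorem map_root_eq_cRoot (hc : c.Nodup) {x : V ≃ₗᵢ[ℝ] V} {s : B} {i : ℕ}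
    (h : ∀ t, inner ℝ (D.root t) (D.root s) ≠ 0 →
      x (D.weight t) = D.cWeight c t (i + if c.idxOf t < c.idxOf s then 1 else 0)) :
    x (D.root s) = D.cRoot c s i := by
  rw [cRoot, ← LinearIsometryEquiv.mul_app, map_root_eq, map_root_eq]
  refine Finset.sum_congr rfl fun t _ => ?_
  by_cases h0 : inner ℝ (D.root t) (D.root s) = 0
  · simp [h0]
  · rw [h t h0, LinearIsometryEquiv.mul_app, D.prefixProd_idxOf_weight hc, cWeight, cWeight,
      ← LinearIsometryEquiv.mul_app, ← pow_add]

/-- The number of occurrences of the letter `t` in `c^∞` before the position `k`. -/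
def occurrences (c : List B) (k : ℕ) (t : B) : ℕ :=
  k / c.length + if c.idxOf t < k % c.length then 1 else 0

theorem occurrences_zero (c : List B) (t : B) : occurrences c 0 t = 0 := by
  simp [occurrences]

theorem occurrences_succ (hc : c.Nodup) (hall : ∀ s, s ∈ c) {k : ℕ} {s : B}
    (hs : getElem? c (k % c.length) = some s) (t : B) :
    occurrences c (k + 1) t = occurrences c k t + if t = s then 1 else 0 := by
  obtain ⟨hlt, rfl⟩ := List.getElem?_eq_some_iff.1 hs
  have ht := List.idxOf_lt_length_of_mem (hall t)
  have heq : t = (c)[k % c.length] ↔ c.idxOf t = k % c.length := by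
    constructor
    · intro h
      rw [h, hc.idxOf_getElem]
    · intro h
      simp [← h]
  simp only [occurrences, heq]
  have hn : 0 < c.length := by omega
  have e0 := Nat.div_add_mod k c.length
  by_cases h : k % c.length + 1 = c.length
  · have h1 : k + 1 = c.length * (k / c.length + 1) := by rw [mul_add, mul_one]; omega
    rw [h1, Nat.mul_div_cancel_left _ hn, Nat.mul_mod_right]
    split_ifs <;> omega
  · have h1 : k + 1 = c.length * (k / c.length) + (k % c.length + 1) := by omega
    have h2 : (k + 1) / c.length = k / c.length := by
      have h4 : k % c.length + 1 < c.length := by omega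
      rw [h1, Nat.mul_add_div hn, Nat.div_eq_of_lt h4, add_zero]
    have h3 : (k + 1) % c.length = k % c.length + 1 := by
      conv_lhs => rw [h1]
      rw [Nat.mul_add_mod, Nat.mod_eq_of_lt (by omega)]
    rw [h2, h3]
    split_ifs <;> omega

theorem occurrences_self (hc : c.Nodup) {k : ℕ} {s : B} (hs : getElem? c (k % c.length) = some s) :
    occurrences c k s = k / c.length := by
  obtain ⟨hlt, rfl⟩ := List.getElem?_eq_some_iff.1 hs
  rw [occurrences, hc.idxOf_getElem]
  simp

theorem occurrences_eq (hc : c.Nodup) {k : ℕ} {s : B} (hs : getElem? c (k % c.length) = some s) (t : B) :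
    occurrences c k t = occurrences c k s + if c.idxOf t < c.idxOf s then 1 else 0 := by
  rw [occurrences_self hc hs, occurrences]
  obtain ⟨hlt, rfl⟩ := List.getElem?_eq_some_iff.1 hs
  rw [hc.idxOf_getElem]

/-- As long as `s` is not exhausted, the inequalities between the multiplicities of adjacent letters
ensure that its neighbours have also been taken at all their occurrences so far. The case `t = s` is
included, since `α_s` itself involves `ω_s`. -/
theorem min_mult_occurrences (hc : c.Nodup) (hall : ∀ s, s ∈ c) {k : ℕ} {s t : B}
    (hs : getElem? c (k % c.length) = some s) (hlt : occurrences c k s < D.mult c s)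
    (hadj : inner ℝ (D.root t) (D.root s) ≠ 0) :
    min (D.mult c t) (occurrences c k t) =
      occurrences c k s + if c.idxOf t < c.idxOf s then 1 else 0 := by
  rw [← occurrences_eq hc hs, min_eq_right]
  rw [occurrences_eq hc hs]
  rcases lt_trichotomy (c.idxOf t) (c.idxOf s) with h | h | h
  · have := D.mult_le_mult hc hall h hadj
    rw [if_pos h]; omega
  · obtain rfl := (List.idxOf_inj (hall t)).1 h
    rw [if_neg (lt_irrefl _)]; omega
  · rw [real_inner_comm] at hadj
    have := D.mult_le_mult hc hall h hadj
    rw [if_neg h.not_gt]; omega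

/-- Once `s` is exhausted, `x(α_s)` pairs positively with the antidominant weight `x(ω_s)` and is
negative. Before that, `x(α_s)` is the root at the current occurrence of `s` in `c^∞`, positive by
the definition of `mult`. -/
theorem ht_pos_iff_occurrences_lt (hc : c.Nodup) (hall : ∀ s, s ∈ c) {k : ℕ} {s : B}
    (hs : getElem? c (k % c.length) = some s) {x : V ≃ₗᵢ[ℝ] V} (hx : x ∈ D.W)
    (h : ∀ t, x (D.weight t) = D.cWeight c t (min (D.mult c t) (occurrences c k t))) :
    0 < D.ht (x (D.root s)) ↔ occurrences c k s < D.mult c s := by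
  constructor
  · intro hpos
    by_contra hle
    have h1 := h s
    rw [min_eq_left (not_lt.1 hle)] at h1
    have h2 : 0 < inner ℝ (x (D.root s)) (D.cWeight c s (D.mult c s)) := by
      rw [← h1, LinearIsometryEquiv.inner_map_map, inner_root_weight_self]
      exact half_pos (D.inner_root_self_pos s)
    have h3 := D.ht_neg_of_inner_cWeight_mult_pos hc hall s ((D.isRoot_root s).map hx) h2
    linarith
  · intro hlt
    rw [D.map_root_eq_cRoot hc (i := occurrences c k s) (fun t hadj => by
      rw [h t, min_mult_occurrences hc hall hs hlt hadj])]
    exact D.ht_cRoot_pos hlt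

/-- The invariant of the greedy reading: of each letter `t`, exactly the first `mult c t`
occurrences are taken. Here `j` counts the letters taken before position `k`; tracking the images of
the weights determines whether the next letter is an ascent. -/
theorem IsReducedSubwordAt.exists_state (h : D.IsReducedSubwordAt c w₀ p u) (hc : c.Nodup)
    (hall : ∀ s, s ∈ c) (hne : c ≠ [])
    (hw₀ : D.IsLongest w₀) (hmin : ∀ p' u', D.IsReducedSubwordAt c w₀ p' u' → p ≤ p') (k : ℕ) :
    ∃ j ≤ u.length, (∀ i (hi : i < p.length), i < j → p[i] < k) ∧
      (∀ i (hi : i < p.length), j ≤ i → k ≤ p[i]) ∧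
      ∀ t, D.prefixProd u j (D.weight t) =
          D.cWeight c t (min (D.mult c t) (occurrences c k t)) ∧
        (u.take j).count t = min (D.mult c t) (occurrences c k t) := by
  have hlen := h.length_eq
  induction k with
  | zero =>
    refine ⟨0, Nat.zero_le _, by simp, by simp, fun t => ?_⟩
    rw [occurrences_zero, Nat.min_zero]
    exact ⟨rfl, by simp⟩
  | succ k ih =>
    obtain ⟨j, hj, h1, h2, h3⟩ := ih
    have hk : k % c.length < c.length := Nat.mod_lt _ (List.length_pos_iff.2 hne)
    obtain ⟨s, hs⟩ : ∃ s, (c)[k % c.length]? = some s := ⟨_, List.getElem?_eq_getElem hk⟩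
    have hiff := ht_pos_iff_occurrences_lt hc hall hs (D.prefixProd_mem u j) fun t => (h3 t).1
    by_cases hjk : ∃ hjl : j < p.length, p[j] = k
    · obtain ⟨hjl, hpj⟩ := hjk
      have hju : j < u.length := by omega
      have hus : u[j] = s := by
        have := h.getElem_eq hjl hju
        rw [hpj, hs, Option.some_inj] at this
        exact this.symm
      have hpos : 0 < D.ht (D.prefixProd u j (D.root s)) := by
        rw [← hus]; exact h.2.2.1.ht_pos hju
      have hlt := hiff.1 hpos
      refine ⟨j + 1, hju, ?_, ?_, ?_⟩
      · intro i hi hij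
        rcases Nat.lt_succ_iff_lt_or_eq.1 hij with h4 | rfl
        · exact (h1 i hi h4).trans (Nat.lt_succ_self k)
        · rw [hpj]; exact Nat.lt_succ_self k
      · intro i hi hij
        have := List.pairwise_iff_getElem.1 h.1 j i hjl hi (by omega)
        omega
      · intro t
        rw [occurrences_succ hc hall hs, D.prefixProd_succ u hju, hus,
          List.take_succ_eq_append_getElem hju, hus, List.count_append, (h3 t).2,
          LinearIsometryEquiv.mul_app]
        by_cases hts : t = s
        · subst hts
          rw [if_pos rfl, min_eq_right hlt.le, min_eq_right (Nat.succ_le_of_lt hlt)]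
          refine ⟨?_, by simp⟩
          rw [simple_weight_self, map_sub, (h3 t).1, min_eq_right hlt.le,
            D.map_root_eq_cRoot hc (i := occurrences c k t) (fun r hadj => by
              rw [(h3 r).1, min_mult_occurrences hc hall hs hlt hadj]),
            D.cRoot_eq_sub hc (hall t)]
          abel
        · rw [if_neg hts, add_zero, simple_weight_of_ne _ (Ne.symm hts)]
          exact ⟨(h3 t).1, by simp [Ne.symm hts]⟩
    · have h4 : ∀ i (hi : i < p.length), j ≤ i → k + 1 ≤ p[i] := by
        intro i hi hij
        have hkj : k < p[j] := lt_of_le_of_ne (h2 j (by omega) le_rfl) fun h =>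
          hjk ⟨by omega, h.symm⟩
        rcases hij.eq_or_lt with rfl | hij
        · exact hkj
        · have := List.pairwise_iff_getElem.1 h.1 j i (by omega) hi hij
          omega
      have hnot := h.not_ht_pos hall hw₀ hmin hj h1 (fun hjl => h4 j hjl le_rfl) hs
      rw [hiff, not_lt] at hnot
      refine ⟨j, hj, fun i hi hij => (h1 i hi hij).trans (Nat.lt_succ_self k), h4, fun t => ?_⟩
      have : min (D.mult c t) (occurrences c (k + 1) t) =
          min (D.mult c t) (occurrences c k t) := by
        rw [occurrences_succ hc hall hs]
        by_cases hts : t = s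
        · subst hts
          rw [if_pos rfl, min_eq_left hnot, min_eq_left (by omega)]
        · rw [if_neg hts, add_zero]
      rw [this]
      exact h3 t

/-- Between two consecutive occurrences of a letter in the sorting word, each adjacent letter
occurs exactly once. -/
theorem IsSortingWord.count_eq (hu : D.IsSortingWord c w₀ u) (hc : c.Nodup)
    (hall : ∀ s, s ∈ c) (hw₀ : D.IsLongest w₀) {j : ℕ} (hj : j < u.length) {t : B}
    (hadj : inner ℝ (D.root t) (D.root u[j]) ≠ 0) :
    (u.take j).count t =
      (u.take j).count u[j] + if c.idxOf t < c.idxOf u[j] then 1 else 0 := by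
  obtain ⟨p, h, hmin⟩ := hu
  have hlen := h.length_eq
  have hjp : j < p.length := by omega
  have hne : c ≠ [] := List.ne_nil_of_mem (hall t)
  have hs := h.getElem_eq hjp hj
  obtain ⟨j', hj', h1, h2, h3⟩ := h.exists_state hc hall hne hw₀ hmin p[j]
  obtain rfl : j' = j := by
    rcases lt_trichotomy j' j with hlt | heq | hlt
    · have h4 := List.pairwise_iff_getElem.1 h.1 j' j (by omega) hjp hlt
      have h5 := h2 j' (by omega) le_rfl
      omega
    · exact heq
    · exact absurd (h1 j hjp hlt) (lt_irrefl _)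
  have hiff := ht_pos_iff_occurrences_lt hc hall hs (D.prefixProd_mem u j') fun t => (h3 t).1
  have hlt := hiff.1 (h.2.2.1.ht_pos hj)
  rw [(h3 t).2, (h3 u[j']).2, min_mult_occurrences hc hall hs hlt hadj, min_eq_right hlt.le]

end Sorting

end CoxeterData

namespace CoxeterData

variable {B V : Type*} [NormedAddCommGroup V] [InnerProductSpace ℝ V]
variable (D : CoxeterData B V) [FiniteDimensional ℝ V] [Fintype B] [DecidableEq B]

/-! ### Alternating words -/

/-- Adjacent letters alternate in `Q`, in the order given by `c`. -/
def IsAlternating (c Q : List B) : Prop :=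
  ∀ (k : ℕ) (hk : k < Q.length) (t : B), inner ℝ (D.root t) (D.root Q[k]) ≠ 0 →
    (Q.take k).count t = (Q.take k).count Q[k] + if c.idxOf t < c.idxOf Q[k] then 1 else 0

theorem count_take_succ {Q : List B} {k : ℕ} (hk : k < Q.length) (t : B) :
    (Q.take (k + 1)).count t = (Q.take k).count t + if Q[k] = t then 1 else 0 := by
  rw [List.take_succ_eq_append_getElem hk, List.count_append, List.count_singleton]
  simp

theorem count_take_mono (Q : List B) {k l : ℕ} (h : k ≤ l) (t : B) :
    (Q.take k).count t ≤ (Q.take l).count t :=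
  (List.take_sublist_take_left h).count_le t

theorem count_take_eq {Q : List B} {i j : ℕ} (hij : i ≤ j) (hj : j ≤ Q.length) {t : B}
    (h : ∀ l (hl : l < Q.length), i ≤ l → l < j → Q[l] ≠ t) :
    (Q.take j).count t = (Q.take i).count t := by
  induction j, hij using Nat.le_induction with
  | base => rfl
  | succ j hij ih =>
    rw [count_take_succ hj, if_neg (h j hj hij (Nat.lt_succ_self j)), add_zero]
    exact ih (by omega) fun l hl h1 h2 => h l hl h1 (by omega)

theorem count_take_of_nodup {c : List B} (hc : c.Nodup) (t : B) {k : ℕ} (hk : k ≤ c.length) :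
    (c.take k).count t = if c.idxOf t < k then 1 else 0 := by
  split_ifs with h
  · apply List.count_eq_one_of_mem (hc.sublist (List.take_sublist _ _))
    rw [List.mem_iff_getElem]
    exact ⟨c.idxOf t, by rw [List.length_take]; omega, by rw [List.getElem_take]; simp⟩
  · exact List.count_eq_zero_of_not_mem (notMem_take_of_le_idxOf (not_lt.1 h))

variable {D}

/-- Inside `c` the counts are 0 or 1 according to the order in `c`. Beyond it, the prefix `c` adds
one to every count of `u`, so the differences are unchanged. -/
theorem isAlternating_append {c u : List B} (hc : c.Nodup) (hall : ∀ s, s ∈ c)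
    (hu : ∀ (j : ℕ) (hj : j < u.length) (t : B), inner ℝ (D.root t) (D.root u[j]) ≠ 0 →
      (u.take j).count t = (u.take j).count u[j] + if c.idxOf t < c.idxOf u[j] then 1 else 0) :
    D.IsAlternating c (c ++ u) := by
  intro k hk t hadj
  by_cases hkc : k < c.length
  · rw [List.getElem_append_left hkc, List.take_append_of_le_length hkc.le,
      count_take_of_nodup hc _ hkc.le, count_take_of_nodup hc _ hkc.le, hc.idxOf_getElem]
    simp
  · obtain ⟨j, rfl⟩ := Nat.exists_eq_add_of_le (not_lt.1 hkc)
    rw [List.length_append] at hk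
    have hj : j < u.length := by omega
    have e : (c ++ u)[c.length + j] = u[j] := by simp
    rw [e] at hadj ⊢
    rw [List.take_length_add_append, List.count_append, List.count_append, hu j hj t hadj,
      List.count_eq_one_of_mem hc (hall _), List.count_eq_one_of_mem hc (hall _)]
    omega

section Between

variable {c Q : List B} (h : D.IsAlternating c Q) {i j : ℕ} (hij : i < j) (hj : j < Q.length)
  (hs : Q[i] = Q[j]) (hbetween : ∀ l (hl : l < Q.length), i < l → l < j → Q[l] ≠ Q[j]) {t : B}
  (hadj : inner ℝ (D.root t) (D.root Q[j]) ≠ 0) (ht : t ≠ Q[j])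
include h hij hs hbetween hadj

theorem IsAlternating.count_eq : (Q.take j).count t = (Q.take i).count t + 1 := by
  have h1 := h j hj t hadj
  have h2 := h i (hij.trans hj) t (by rwa [hs])
  have h3 := count_take_eq (Q := Q) (t := Q[j]) (Nat.succ_le_of_lt hij) hj.le
    fun l hl h1 h2 => hbetween l hl h1 h2
  rw [Nat.succ_eq_add_one, count_take_succ (hij.trans hj), if_pos hs] at h3
  rw [h1, h2, hs, h3]
  omega

include ht

theorem IsAlternating.exists_between :
    ∃ l, ∃ hl : l < Q.length, i < l ∧ l < j ∧ Q[l] = t := by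
  by_contra! hcon
  have h1 := h.count_eq hij hj hs hbetween hadj
  rw [count_take_eq hij.le hj.le (t := t)] at h1
  · omega
  · intro l hl h2 h3
    rcases h2.eq_or_lt with rfl | h2
    · rw [hs]; exact ht.symm
    · exact hcon l hl h2 h3

omit ht in
theorem IsAlternating.between_unique {l l' : ℕ} (hl : i < l) (hll' : l < l') (hl' : l' < j)
    (h1 : Q[l] = t) (h2 : Q[l'] = t) : False := by
  have h3 := h.count_eq hij hj hs hbetween hadj
  have h4 := count_take_mono Q (Nat.succ_le_of_lt hl') t
  have h5 := count_take_mono Q (Nat.succ_le_of_lt hll') t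
  have h6 := count_take_mono Q hl.le t
  rw [Nat.succ_eq_add_one, count_take_succ (hl'.trans hj), if_pos h2] at h4
  rw [Nat.succ_eq_add_one, count_take_succ (by omega), if_pos h1] at h5
  omega

end Between

end CoxeterData

namespace CoxeterData

variable {B V : Type*} [NormedAddCommGroup V] [InnerProductSpace ℝ V]
variable (D : CoxeterData B V) [FiniteDimensional ℝ V] [Fintype B]

/-! ### The facets at the points `ρ_p q` -/

/-- The vector `Ω`. -/
noncomputable def sortingShift (u : List B) : V :=
  ∑ p : Fin u.length, D.prefixProd u p (D.weight (u.get p))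

/-- `I` is the facet of the last occurrences of the letters in the first `c.length + p` positions
of `c ++ u`. -/
structure IsPrefixFacet (c u : List B) (w₀ : V ≃ₗᵢ[ℝ] V) (p : ℕ)
    (I : Finset (Fin (c ++ u).length)) : Prop where
  isFacet : D.IsFacet (c ++ u) w₀ I
  lt : ∀ k ∈ I, (k : ℕ) < c.length + p
  exists_gt : ∀ k : Fin (c ++ u).length, (k : ℕ) < c.length + p → k ∉ I →
    ∃ l ∈ I, k < l ∧ (c ++ u)[l] = (c ++ u)[k]
  ne : ∀ k ∈ I, ∀ l : Fin (c ++ u).length, k < l → (l : ℕ) < c.length + p →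
    (c ++ u)[l] ≠ (c ++ u)[k]
  partialProd_eq : D.partialProd (c ++ u) I (c.length + p) = D.prefixProd u p
  rootFunction_eq : ∀ k ∈ I, D.rootFunction (c ++ u) I k = D.prefixProd u p (D.root (c ++ u)[k])
  weightFunction_eq : ∀ k ∈ I,
    D.weightFunction (c ++ u) I k = D.prefixProd u p (D.weight (c ++ u)[k])
  brickVector_eq : D.brickVector (c ++ u) I = D.sortingShift u + D.prefixProd u p D.basePoint

variable {D}

section Prefix

variable {c u : List B} {w₀ : V ≃ₗᵢ[ℝ] V}

theorem partialProd_initial (c u : List B) (k : ℕ) :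
    D.partialProd (c ++ u) {z | (z : ℕ) < c.length} k = D.prefixProd u (k - c.length) := by
  induction k with
  | zero => rw [Nat.zero_sub]; exact (D.isWalk_partialProd _ _).1
  | succ k ih =>
    by_cases hk : k < (c ++ u).length
    · lift k to Fin (c ++ u).length using hk
      by_cases hkc : (k : ℕ) < c.length
      · rw [D.partialProd_succ_of_mem (by simpa using hkc), ih]
        congr 1
        omega
      · rw [D.partialProd_succ_of_notMem (by simpa using hkc), ih, Nat.succ_sub (not_lt.1 hkc)]
        have h1 : (k : ℕ) - c.length < u.length := by
          have := k.2
          have e : (c ++ u).length = c.length + u.length := List.length_append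
          omega
        rw [Nat.succ_eq_add_one, D.prefixProd_succ u h1]
        congr 2
        rw [Fin.getElem_fin, List.getElem_append_right (not_lt.1 hkc)]
    · rw [(D.isWalk_partialProd _ _).succ_none (letterOutside_of_le (not_lt.1 hk)), ih]
      rw [List.length_append] at hk
      rw [prefixProd_of_length_le _ _ (by omega), prefixProd_of_length_le _ _ (by omega)]

theorem sum_weight_getElem (hc : c.Nodup) (hall : ∀ s, s ∈ c) :
    ∑ i : Fin c.length, D.weight (c)[i] = D.basePoint := by
  classical
  rw [basePoint]
  exact Fintype.sum_equiv (hc.getEquivOfForallMemList c hall) _ _ fun i => rfl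

theorem isPrefixFacet_initial (hc : c.Nodup) (hall : ∀ s, s ∈ c)
    (hu : D.IsReduced u) (huw : D.wordProd u = w₀) :
    D.IsPrefixFacet c u w₀ 0 {z | (z : ℕ) < c.length} := by
  have h1 : ∀ k : ℕ, k < c.length →
      D.partialProd (c ++ u) {z | (z : ℕ) < c.length} k = 1 := by
    intro k hk
    rw [partialProd_initial, Nat.sub_eq_zero_of_le hk.le, prefixProd_zero]
  refine ⟨?_, by simp, ?_, ?_, ?_, ?_, ?_, ?_⟩
  · have e : (c ++ u).length = c.length + u.length := List.length_append
    rw [isFacet_iff, partialProd_initial, prefixProd_of_length_le _ _ (by omega)]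
    refine ⟨?_, huw⟩
    have h2 : ({z | (z : ℕ) < c.length} : Finset (Fin (c ++ u).length)).card = c.length := by
      rw [Fin.card_filter_val_lt, min_eq_right (by simp)]
    rw [Finset.card_compl, Fintype.card_fin, h2, e, Nat.add_sub_cancel_left, ← huw, hu]
  · intro k hk hkI
    simp at hk hkI
    omega
  · intro k hk l hkl hl heq
    have hl' : (l : ℕ) < c.length := by simpa using hl
    have hk' : (k : ℕ) < c.length := by simpa using hk
    rw [Fin.getElem_fin, Fin.getElem_fin, List.getElem_append_left hl',
      List.getElem_append_left hk', hc.getElem_inj_iff] at heq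
    exact hkl.ne (Fin.ext heq.symm)
  · rw [partialProd_initial, Nat.add_sub_cancel_left]
  · intro k hk
    rw [rootFunction, h1 k (by simpa using hk), prefixProd_zero]
  · intro k hk
    rw [CoxeterData.weightFunction_eq, h1 k (by simpa using hk), prefixProd_zero]
  -- The walk rests on the positions of `c`, which contribute the base point, and then follows `u`,
  -- which contributes `Ω`.
  · have e : (c ++ u).length = c.length + u.length := List.length_append
    rw [brickVector, ← Equiv.sum_comp (finCongr e.symm), Fin.sum_univ_add, prefixProd_zero,
      LinearIsometryEquiv.one_app, ← sum_weight_getElem hc hall, sortingShift, add_comm]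
    congr 1
    · refine Finset.sum_congr rfl fun i _ => ?_
      rw [CoxeterData.weightFunction_eq, partialProd_initial]
      simp
    · refine Finset.sum_congr rfl fun i _ => ?_
      rw [CoxeterData.weightFunction_eq, partialProd_initial]
      simp [prefixProd_zero, LinearIsometryEquiv.one_app]

theorem IsPrefixFacet.exists_mem {p : ℕ} {I : Finset (Fin (c ++ u).length)}
    (h : D.IsPrefixFacet c u w₀ p I) (hall : ∀ s, s ∈ c) (s : B) :
    ∃ k ∈ I, (c ++ u)[k] = s := by
  obtain ⟨i, hi, rfl⟩ := List.mem_iff_getElem.1 (hall s)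
  have hi' : i < (c ++ u).length := by rw [List.length_append]; omega
  by_cases hk : (⟨i, hi'⟩ : Fin (c ++ u).length) ∈ I
  · exact ⟨_, hk, List.getElem_append_left hi⟩
  · obtain ⟨l, hl, _, hl'⟩ := h.exists_gt ⟨i, hi'⟩ (by simp; omega) hk
    exact ⟨l, hl, hl'.trans (List.getElem_append_left hi)⟩

theorem IsPrefixFacet.eq_of_getElem_eq {p : ℕ} {I : Finset (Fin (c ++ u).length)}
    (h : D.IsPrefixFacet c u w₀ p I) {k l : Fin (c ++ u).length} (hk : k ∈ I) (hl : l ∈ I)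
    (hkl : (c ++ u)[k] = (c ++ u)[l]) : k = l := by
  rcases lt_trichotomy k l with h1 | h1 | h1
  · exact absurd hkl.symm (h.ne k hk l h1 (h.lt l hl))
  · exact h1
  · exact absurd hkl (h.ne l hl k h1 (h.lt k hk))

variable [DecidableEq B]

/-- The letter `u[p]` at the new position `j` has the same root as its last occurrence `i` in the
facet, so the two are exchanged by a flip. -/
theorem IsPrefixFacet.succ (hall : ∀ s, s ∈ c) (halt : D.IsAlternating c (c ++ u)) {p : ℕ}
    (hp : p < u.length) {I : Finset (Fin (c ++ u).length)} (h : D.IsPrefixFacet c u w₀ p I) :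
    ∃ J, D.IsPrefixFacet c u w₀ (p + 1) J := by
  obtain ⟨j, hjp⟩ : ∃ j : Fin (c ++ u).length, (j : ℕ) = c.length + p :=
    ⟨⟨c.length + p, by rw [List.length_append]; omega⟩, rfl⟩
  have hjs : (c ++ u)[j] = u[p] := by
    simp [hjp]
  obtain ⟨i, hi, his⟩ := h.exists_mem hall u[p]
  have hij : i < j := by rw [Fin.lt_def, hjp]; exact h.lt i hi
  have hij' : (i : ℕ) < j := hij
  have hj : j ∉ I := fun hj => absurd (h.lt j hj) (by omega)
  have hPj : D.partialProd (c ++ u) I j = D.prefixProd u p := by rw [hjp, h.partialProd_eq]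
  have hri : D.rootFunction (c ++ u) I i = D.prefixProd u p (D.root u[p]) := by
    rw [h.rootFunction_eq i hi, his]
  have hrj : D.rootFunction (c ++ u) I j = D.prefixProd u p (D.root u[p]) := by
    rw [rootFunction, hPj, hjs]
  have hrel : D.rootFunction (c ++ u) I j = (1 : ℝ) • D.rootFunction (c ++ u) I i := by
    rw [one_smul, hri, hrj]
  have hne : ∀ k ∈ I, k ≠ i → (c ++ u)[k] ≠ u[p] := fun k hk hki heq =>
    hki (h.eq_of_getElem_eq hk hi (heq.trans his.symm))
  have hbetween : ∀ l (hl : l < (c ++ u).length), (i : ℕ) < l → l < j →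
      (c ++ u)[l] ≠ (c ++ u)[(j : ℕ)] := by
    intro l hl h1 h2
    have := h.ne i hi ⟨l, hl⟩ h1 (by simp only; omega)
    rw [his, ← hjs] at this
    exact this
  have hs' : (c ++ u)[(i : ℕ)] = (c ++ u)[(j : ℕ)] := his.trans hjs.symm
  have hpre : D.prefixProd u (p + 1) = D.prefixProd u p * D.simple u[p] := D.prefixProd_succ u hp
  have hrefl : ∀ x, reflectionIn (D.rootFunction (c ++ u) I i) (D.prefixProd u p x) =
      D.prefixProd u (p + 1) x := by
    intro x
    rw [hri, ← LinearIsometryEquiv.mul_app, reflectionIn_map, hpre, simple]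
  -- By alternation a letter adjacent to `u[p]` occurs between `i` and `j`, so its last occurrence
  -- cannot come before `i`. Hence the data at positions of `I` before `i`, which the flip does not
  -- reflect, are fixed by the new simple reflection anyway.
  have hadj0 : ∀ k ∈ I, k < i → inner ℝ (D.root (c ++ u)[k]) (D.root u[p]) = 0 := by
    intro k hk hki
    by_contra hadj
    have hadj' : inner ℝ (D.root (c ++ u)[k]) (D.root (c ++ u)[(j : ℕ)]) ≠ 0 := by
      rw [← hjs] at hadj; exact hadj
    obtain ⟨l, hl, h1, h2, h3⟩ := halt.exists_between hij' j.2 hs' hbetween hadj' (by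
      have := hne k hk hki.ne
      rw [← hjs] at this
      exact this)
    exact h.ne k hk ⟨l, hl⟩ (hki.trans h1) (by simp only; omega) h3
  have hsimple : ∀ t, inner ℝ (D.root t) (D.root u[p]) = 0 →
      D.simple u[p] (D.root t) = D.root t := by
    intro t ht
    rw [real_inner_comm] at ht
    exact reflectionIn_of_inner_eq_zero ht
  -- Seen from any position between `i` and `j`, the flipped root is the simple root of `u[p]`. A
  -- step of the walk with an adjacent letter would alter it, but then that letter would have a
  -- later occurrence in `I`, making two between `i` and `j`, against alternation.
  have hinv : ∀ k : ℕ, (i : ℕ) ≤ k → k ≤ j →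
      (D.partialProd (c ++ u) I k)⁻¹ (D.rootFunction (c ++ u) I i) = D.root u[p] := by
    intro k hik
    induction k, hik using Nat.le_induction with
    | base =>
      intro _
      rw [rootFunction, LinearIsometryEquiv.inv_app_self, his]
    | succ k hik ih =>
      intro hkj
      have ih := ih (by omega)
      lift k to Fin (c ++ u).length using (by have := j.2; omega)
      by_cases hkI : k ∈ I
      · rw [D.partialProd_succ_of_mem hkI, ih]
      · rw [D.partialProd_succ_of_notMem hkI, mul_inv_rev, simple_inv,
          LinearIsometryEquiv.mul_app, ih]
        have hik' : i < k := lt_of_le_of_ne hik fun h => hkI (h ▸ hi)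
        apply reflectionIn_of_inner_eq_zero
        by_contra hadj
        obtain ⟨l, hl, h1, h2⟩ := h.exists_gt k (by omega) hkI
        have hadj' : inner ℝ (D.root (c ++ u)[k]) (D.root (c ++ u)[(j : ℕ)]) ≠ 0 := by
          rw [← hjs] at hadj; exact hadj
        exact halt.between_unique hij' j.2 hs' hbetween hadj' hik' h1
          (by have := h.lt l hl; omega) rfl h2
  refine ⟨insert j (I.erase i), h.isFacet.flip hi hj one_ne_zero hrel, ?_, ?_, ?_, ?_, ?_, ?_, ?_⟩
  · intro k hk
    rcases Finset.mem_insert.1 hk with rfl | hk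
    · omega
    · have := h.lt k (Finset.mem_of_mem_erase hk)
      omega
  · intro k hk hkJ
    rw [Finset.mem_insert, Finset.mem_erase, not_or, not_and] at hkJ
    have hkj : (k : ℕ) ≠ j := fun h => hkJ.1 (Fin.ext h)
    by_cases hki : k = i
    · exact ⟨j, by simp, hki ▸ hij, by rw [hki, hjs, his]⟩
    · obtain ⟨l, hl, h1, h2⟩ := h.exists_gt k (by omega) (hkJ.2 hki)
      by_cases hli : l = i
      · exact ⟨j, by simp, h1.trans (hli ▸ hij), by rw [← h2, hli, hjs, his]⟩
      · exact ⟨l, by simp [hl, hli], h1, h2⟩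
  · intro k hk l hkl hl
    have hkl' : (k : ℕ) < l := hkl
    rcases Finset.mem_insert.1 hk with rfl | hk
    · omega
    · obtain ⟨hki, hk⟩ := Finset.mem_erase.1 hk
      by_cases hlj : l = j
      · rw [hlj, hjs]; exact (hne k hk hki).symm
      · have : (l : ℕ) ≠ j := fun h => hlj (Fin.ext h)
        exact h.ne k hk l hkl (by omega)
  · rw [partialProd_flip hi hj one_ne_zero hrel, if_neg (by omega), ← add_assoc, ← hjp,
      D.partialProd_succ_of_notMem hj, hPj, hjs, hpre]
  · intro k hk
    rw [rootFunction_flip hi hj one_ne_zero hrel]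
    rcases Finset.mem_insert.1 hk with rfl | hk
    · rw [if_pos (Or.inl ⟨hij, le_rfl⟩), hrj, hrefl, hjs]
    · obtain ⟨hki, hk⟩ := Finset.mem_erase.1 hk
      rw [h.rootFunction_eq k hk]
      have hkj : k < j := by rw [Fin.lt_def, hjp]; exact h.lt k hk
      rcases lt_or_gt_of_ne hki with h1 | h1
      · rw [if_neg (by rintro (⟨h2, _⟩ | ⟨h2, _⟩) <;> order), hpre, LinearIsometryEquiv.mul_app,
          hsimple _ (hadj0 k hk h1)]
      · rw [if_pos (Or.inl ⟨h1, hkj.le⟩), hrefl]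
  · intro k hk
    rw [weightFunction_flip hi hj one_ne_zero hrel]
    rcases Finset.mem_insert.1 hk with rfl | hk
    · rw [if_pos (Or.inl ⟨hij, le_rfl⟩), CoxeterData.weightFunction_eq, hPj, hrefl]
    · obtain ⟨hki, hk⟩ := Finset.mem_erase.1 hk
      rw [h.weightFunction_eq k hk]
      have hkj : k < j := by rw [Fin.lt_def, hjp]; exact h.lt k hk
      rcases lt_or_gt_of_ne hki with h1 | h1
      · rw [if_neg (by rintro (⟨h2, _⟩ | ⟨h2, _⟩) <;> order), hpre, LinearIsometryEquiv.mul_app,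
          D.simple_weight_of_ne (hne k hk hki).symm]
      · rw [if_pos (Or.inl ⟨h1, hkj.le⟩), hrefl]
  -- Only `j` carries the letter `u[p]` among the affected positions, so it alone contributes. The
  -- coefficient is 1, and the brick vector moves from `Ω + ρ_p(q)` to `Ω + ρ_{p+1}(q)`.
  · rw [brickVector_flip hi hj one_ne_zero hrel, h.brickVector_eq, Finset.sum_eq_single j]
    · have h1 : inner ℝ (D.rootFunction (c ++ u) I i) (D.weightFunction (c ++ u) I j) =
          inner ℝ (D.root u[p]) (D.root u[p]) / 2 := by
        rw [CoxeterData.weightFunction_eq, ← LinearIsometryEquiv.inner_inv_left,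
          hinv j hij'.le le_rfl, hjs, inner_root_weight_self]
      have h2 := (D.inner_root_self_pos u[p]).ne'
      rw [h1, hri, LinearIsometryEquiv.inner_map_map, hpre, LinearIsometryEquiv.mul_app,
        simple_basePoint, map_sub, mul_div_cancel₀ _ two_ne_zero, div_self h2, one_smul, add_sub]
    · intro k hk hkj
      have hk' : i < k ∧ k ≤ j := by
        rcases (Finset.mem_filter.1 hk).2 with h1 | h1
        · exact h1
        · exact absurd (h1.1.trans_le h1.2) hij.not_gt
      have hkj' : k < j := lt_of_le_of_ne hk'.2 hkj
      have h1 : inner ℝ (D.rootFunction (c ++ u) I i) (D.weightFunction (c ++ u) I k) = 0 := by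
        rw [CoxeterData.weightFunction_eq, ← LinearIsometryEquiv.inner_inv_left,
          hinv k (le_of_lt hk'.1) hk'.2]
        apply D.inner_root_weight_of_ne
        have := hbetween k k.2 hk'.1 hkj'
        rw [← hjs]
        exact this.symm
      rw [h1, mul_zero, zero_div]
    · intro hj'
      exact absurd (Finset.mem_filter.2 ⟨Finset.mem_univ j, Or.inl ⟨hij, le_rfl⟩⟩) hj'

theorem exists_isPrefixFacet (hc : c.Nodup) (hall : ∀ s, s ∈ c)
    (halt : D.IsAlternating c (c ++ u)) (hu : D.IsReduced u) (huw : D.wordProd u = w₀) (p : ℕ)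
    (hp : p ≤ u.length) : ∃ I, D.IsPrefixFacet c u w₀ p I := by
  induction p with
  | zero => exact ⟨_, isPrefixFacet_initial hc hall hu huw⟩
  | succ p ih =>
    obtain ⟨I, hI⟩ := ih (by omega)
    exact hI.succ hall halt (by omega)

/-- The subtraction is truncated. For `k` in `c` it gives the initial range, where no letter
repeats; otherwise the range ends exactly at `k`, which is then a last occurrence. -/
theorem IsPrefixFacet.mem_of_eq (hc : c.Nodup) {k : Fin (c ++ u).length}
    {I : Finset (Fin (c ++ u).length)} (h : D.IsPrefixFacet c u w₀ (k + 1 - c.length) I) :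
    k ∈ I := by
  by_contra hk
  obtain ⟨l, hl, h1, h2⟩ := h.exists_gt k (by omega) hk
  have h3 := h.lt l hl
  have h4 : (k : ℕ) < l := h1
  have hl' : (l : ℕ) < c.length := by omega
  have hk' : (k : ℕ) < c.length := by omega
  rw [Fin.getElem_fin, Fin.getElem_fin, List.getElem_append_left hl',
    List.getElem_append_left hk', hc.getElem_inj_iff] at h2
  omega

theorem IsPrefixFacet.hasNormal {p : ℕ} {I : Finset (Fin (c ++ u).length)}
    (h : D.IsPrefixFacet c u w₀ p I) {k : Fin (c ++ u).length} (hk : k ∈ I) :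
    D.HasNormal (c ++ u) k (D.prefixProd u p (D.weight (c ++ u)[k]))
      (inner ℝ (D.prefixProd u p (D.weight (c ++ u)[k])) (D.sortingShift u) +
        inner ℝ (D.weight (c ++ u)[k]) D.basePoint) I := by
  refine ⟨fun i hi hik => ?_, h.weightFunction_eq k hk, ?_⟩
  · rw [h.rootFunction_eq i hi, LinearIsometryEquiv.inner_map_map]
    exact D.inner_root_weight_of_ne fun heq => hik (h.eq_of_getElem_eq hi hk heq)
  · rw [h.brickVector_eq, inner_add_right, LinearIsometryEquiv.inner_map_map]

/-- Based at the position `c.length + p`, all roots of the prefix facet become simple roots. The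
Bruhat comparison with `K = ∅` therefore applies to every facet `J` and bounds each summand of the
brick vector separately. -/
theorem IsPrefixFacet.inner_brickVector_le {p : ℕ} {I J : Finset (Fin (c ++ u).length)}
    (h : D.IsPrefixFacet c u w₀ p I) (hJ : D.IsFacet (c ++ u) w₀ J) (s : B) :
    inner ℝ (D.prefixProd u p (D.weight s)) (D.brickVector (c ++ u) J) ≤
      inner ℝ (D.prefixProd u p (D.weight s)) (D.sortingShift u) +
        inner ℝ (D.weight s) D.basePoint := by
  have h1 : inner ℝ (D.prefixProd u p (D.weight s)) (D.sortingShift u) +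
      inner ℝ (D.weight s) D.basePoint =
      inner ℝ (D.prefixProd u p (D.weight s)) (D.brickVector (c ++ u) I) := by
    rw [h.brickVector_eq, inner_add_right, LinearIsometryEquiv.inner_map_map]
  rw [h1, brickVector, brickVector, inner_sum, inner_sum]
  refine Finset.sum_le_sum fun k _ => ?_
  have h2 := h.isFacet.bruhatLE hJ (K := ∅) (by simp) (P := c.length + p) (by
    intro k hk _
    rw [h.partialProd_eq, h.rootFunction_eq k hk, LinearIsometryEquiv.inv_app_self]
    exact D.ht_root_pos _) (k := k) k.2.le
  rw [h.partialProd_eq] at h2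
  have h3 := h2.inner_le (f := D.weight s) (g := D.weight (c ++ u)[k])
    (fun t => inner_root_weight_nonneg t s) (fun t => inner_root_weight_nonneg t _)
  rw [LinearIsometryEquiv.mul_app, LinearIsometryEquiv.mul_app,
    LinearIsometryEquiv.inner_inv_right, LinearIsometryEquiv.inner_inv_right] at h3
  rw [CoxeterData.weightFunction_eq, CoxeterData.weightFunction_eq]
  exact h3

end Prefix

end CoxeterData

/-! ### Simple polytopes described by their vertices, edges and facet normals -/

/-- Points `b a`, together with, at each of them, a system of `finrank ℝ V` vectors `r a i` pointing
away from neighbouring points, and the dual system of vectors `ν a i`, whose linear forms are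
maximal at `b a`. -/
structure VertexSystem (V : Type*) [NormedAddCommGroup V] [InnerProductSpace ℝ V] (A : Type*)
    (ι : A → Type*) [∀ a, Fintype (ι a)] where
  b : A → V
  ν : ∀ a, ι a → V
  r : ∀ a, ι a → V
  card : ∀ a, Fintype.card (ι a) = finrank ℝ V
  orth : ∀ a i j, i ≠ j → inner ℝ (r a i) (ν a j) = 0
  pos : ∀ a i, 0 < inner ℝ (r a i) (ν a i)
  nbr : ∀ a i, ∃ a', ∃ μ : ℝ, 0 < μ ∧ b a' = b a - μ • r a i
  valid : ∀ a i a', inner ℝ (ν a i) (b a') ≤ inner ℝ (ν a i) (b a)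

namespace VertexSystem

variable {V : Type*} [NormedAddCommGroup V] [InnerProductSpace ℝ V] [FiniteDimensional ℝ V]
  {A : Type*} {ι : A → Type*} [∀ a, Fintype (ι a)] (S : VertexSystem V A ι)

/-- The convex hull of the points of a vertex system. -/
def polytope : Set V := convexHull ℝ (Set.range S.b)

theorem b_mem (a : A) : S.b a ∈ S.polytope := subset_convexHull ℝ _ ⟨a, rfl⟩

theorem inner_le_of_mem {f x : V} {M : ℝ} (h : ∀ a, inner ℝ f (S.b a) ≤ M)
    (hx : x ∈ S.polytope) : inner ℝ f x ≤ M := by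
  have h1 : Convex ℝ {x : V | inner ℝ f x ≤ M} :=
    convex_halfSpace_le ⟨fun x y => inner_add_right _ _ _, fun t x => real_inner_smul_right _ _ _⟩ M
  refine convexHull_min ?_ h1 hx
  rintro _ ⟨a, rfl⟩
  exact h a

/-- The systems `r a` and `ν a` are biorthogonal up to scaling, and their number is the dimension,
so `ν a` is a basis with coordinates read off by `r a`. -/
theorem eq_sum (a : A) (f : V) :
    f = ∑ i, (inner ℝ (S.r a i) f / inner ℝ (S.r a i) (S.ν a i)) • S.ν a i := by
  classical
  have hpair : ∀ (g : ι a → ℝ) j,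
      inner ℝ (S.r a j) (∑ i, g i • S.ν a i) = g j * inner ℝ (S.r a j) (S.ν a j) := by
    intro g j
    rw [inner_sum, Finset.sum_eq_single j]
    · rw [real_inner_smul_right]
    · intro i _ hij
      rw [real_inner_smul_right, S.orth a j i hij.symm, mul_zero]
    · simp
  have hli : LinearIndependent ℝ (S.ν a) := by
    rw [Fintype.linearIndependent_iff]
    intro g hg j
    have := hpair g j
    rw [hg, inner_zero_right] at this
    exact (mul_eq_zero.1 this.symm).resolve_right (S.pos a j).ne'
  have hspan := hli.span_eq_top_of_card_eq_finrank' (S.card a)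
  obtain ⟨g, rfl⟩ := (Submodule.mem_span_range_iff_exists_fun ℝ).1
    (hspan ▸ Submodule.mem_top : f ∈ Submodule.span ℝ (Set.range (S.ν a)))
  refine Finset.sum_congr rfl fun i _ => ?_
  rw [hpair, mul_div_cancel_right₀ _ (S.pos a i).ne']

theorem inner_r_nonneg {a : A} {f : V} (h : ∀ a', inner ℝ f (S.b a') ≤ inner ℝ f (S.b a))
    (i : ι a) : 0 ≤ inner ℝ (S.r a i) f := by
  obtain ⟨a', μ, hμ, ha'⟩ := S.nbr a i
  have h1 := h a'
  rw [ha', inner_sub_right, real_inner_smul_right] at h1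
  rw [real_inner_comm]
  by_contra h2
  have := mul_neg_of_pos_of_neg hμ (not_le.1 h2)
  linarith

theorem coeff_nonneg {a : A} {f : V} (h : ∀ a', inner ℝ f (S.b a') ≤ inner ℝ f (S.b a))
    (i : ι a) : 0 ≤ inner ℝ (S.r a i) f / inner ℝ (S.r a i) (S.ν a i) :=
  div_nonneg (S.inner_r_nonneg h i) (S.pos a i).le

theorem inner_eq_sum (a : A) (f x : V) :
    inner ℝ f x =
      ∑ i, (inner ℝ (S.r a i) f / inner ℝ (S.r a i) (S.ν a i)) * inner ℝ (S.ν a i) x := by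
  conv_lhs => rw [S.eq_sum a f, sum_inner]
  simp only [real_inner_smul_left]

variable [Finite A] [Nonempty A]

theorem exists_max (f : V) : ∃ a, ∀ a', inner ℝ f (S.b a') ≤ inner ℝ f (S.b a) :=
  Finite.exists_max fun a => inner ℝ f (S.b a)

/-- A linear form separating a point from the polytope is maximal at some `b a`. The neighbours of
`b a` make its coordinates in `ν a` nonnegative, so it is bounded by the inequalities at `a`. -/
theorem polytope_eq :
    S.polytope = {x | ∀ a i, inner ℝ (S.ν a i) x ≤ inner ℝ (S.ν a i) (S.b a)} := by
  apply Set.Subset.antisymm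
  · intro x hx a i
    exact S.inner_le_of_mem (S.valid a i) hx
  · intro x hx
    by_contra hxP
    obtain ⟨l, M, h1, h2⟩ := geometric_hahn_banach_closed_point (convex_convexHull ℝ _)
      ((Set.finite_range S.b).isClosed_convexHull ℝ) hxP
    set f := (InnerProductSpace.toDual ℝ V).symm l with hf
    have hl : ∀ y, l y = inner ℝ f y := fun y => by
      rw [hf, InnerProductSpace.toDual_symm_apply]
    obtain ⟨a, ha⟩ := S.exists_max f
    have h3 := h1 _ (S.b_mem a)
    rw [hl] at h2 h3
    have h4 : inner ℝ f x ≤ inner ℝ f (S.b a) := by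
      rw [S.inner_eq_sum a f, S.inner_eq_sum a f]
      exact Finset.sum_le_sum fun i _ =>
        mul_le_mul_of_nonneg_left (hx a i) (S.coeff_nonneg ha i)
    linarith

theorem mem_orthogonal_vectorSpan {F : Set V} {w : V} :
    w ∈ (vectorSpan ℝ F)ᗮ ↔ ∀ x ∈ F, ∀ z ∈ F, inner ℝ w x = inner ℝ w z := by
  rw [Submodule.mem_orthogonal']
  constructor
  · intro h x hx z hz
    have := h _ (vsub_mem_vectorSpan ℝ hx hz)
    rw [vsub_eq_sub, inner_sub_right] at this
    linarith
  · intro h v hv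
    rw [vectorSpan] at hv
    induction hv using Submodule.span_induction with
    | mem v hv =>
      obtain ⟨x, hx, z, hz, rfl⟩ := Set.mem_vsub.1 hv
      rw [vsub_eq_sub, inner_sub_right, h x hx z hz, sub_self]
    | zero => exact inner_zero_right _
    | add v w _ _ h1 h2 => rw [inner_add_right, h1, h2, add_zero]
    | smul t v _ h1 => rw [real_inner_smul_right, h1, mul_zero]

theorem vectorSpan_polytope : vectorSpan ℝ S.polytope = ⊤ := by
  rw [← Submodule.orthogonal_eq_bot_iff, Submodule.eq_bot_iff]
  intro w hw
  rw [mem_orthogonal_vectorSpan] at hw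
  obtain ⟨a⟩ := ‹Nonempty A›
  rw [S.eq_sum a w]
  refine Finset.sum_eq_zero fun i _ => ?_
  obtain ⟨a', μ, hμ, ha'⟩ := S.nbr a i
  have := hw _ (S.b_mem a) _ (S.b_mem a')
  rw [ha', inner_sub_right, real_inner_smul_right] at this
  have h0 : μ * inner ℝ w (S.r a i) = 0 := by linarith
  rw [real_inner_comm, (mul_eq_zero.1 h0).resolve_left hμ.ne']
  simp

theorem finrank_orthogonal_of_facet {F : Set V} (hF : IsPolytopeFacet S.polytope F) :
    finrank ℝ (vectorSpan ℝ F)ᗮ = 1 := by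
  have h1 := hF.2.2
  rw [S.vectorSpan_polytope, finrank_top] at h1
  have h2 := (vectorSpan ℝ F).finrank_add_finrank_orthogonal
  omega

theorem exists_eq_smul_of_facet {F : Set V} (hF : IsPolytopeFacet S.polytope F) {v w : V}
    (hv : v ∈ (vectorSpan ℝ F)ᗮ) (hv0 : v ≠ 0) (hw : w ∈ (vectorSpan ℝ F)ᗮ) :
    ∃ t : ℝ, w = t • v := by
  have h1 := (finrank_eq_one_iff_of_nonzero' (⟨v, hv⟩ : (vectorSpan ℝ F)ᗮ)
    (by simpa [Subtype.ext_iff] using hv0)).1 (S.finrank_orthogonal_of_facet hF) ⟨w, hw⟩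
  obtain ⟨t, ht⟩ := h1
  exact ⟨t, (congrArg Subtype.val ht).symm⟩

theorem ν_ne_zero (a : A) (i : ι a) : S.ν a i ≠ 0 := fun h => by
  have := S.pos a i
  rw [h, inner_zero_right] at this
  exact lt_irrefl _ this

theorem mem_orthogonal_of_isOuterNormal {F : Set V} {y : V}
    (hy : IsOuterNormal S.polytope F y) : y ∈ (vectorSpan ℝ F)ᗮ := by
  rw [mem_orthogonal_vectorSpan]
  intro x hx z hz
  rw [hy] at hx hz
  exact le_antisymm (hz.2 x hx.1) (hx.2 z hz.1)

/-- At a vertex where `y` is maximal, `y` is a nonnegative combination of the `ν a i`. Any of these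
with positive coefficient is constant on `F`, and the orthogonal complement of the direction of a
facet is a line. -/
theorem exists_ν_of_facet {F : Set V} (hF : IsPolytopeFacet S.polytope F) {y : V}
    (hy : IsOuterNormal S.polytope F y) :
    ∃ a i, S.ν a i ∈ (vectorSpan ℝ F)ᗮ ∧ ∃ t : ℝ, 0 < t ∧ y = t • S.ν a i := by
  have hyF := S.mem_orthogonal_of_isOuterNormal hy
  have hy0 : y ≠ 0 := by
    rintro rfl
    have h1 : F = S.polytope := by rw [hy]; simp
    have h2 := hF.2.2
    rw [h1] at h2
    omega
  obtain ⟨a, ha⟩ := S.exists_max y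
  obtain ⟨i, hi⟩ : ∃ i, inner ℝ (S.r a i) y ≠ 0 := by
    by_contra! h
    apply hy0
    rw [S.eq_sum a y]
    exact Finset.sum_eq_zero fun i _ => by rw [h i, zero_div, zero_smul]
  have hipos : 0 < inner ℝ (S.r a i) y := lt_of_le_of_ne (S.inner_r_nonneg ha i) hi.symm
  have htight : ∀ x ∈ F, inner ℝ (S.ν a i) x = inner ℝ (S.ν a i) (S.b a) := by
    intro x hx
    rw [hy] at hx
    have h1 : inner ℝ y x = inner ℝ y (S.b a) :=
      le_antisymm (S.inner_le_of_mem ha hx.1) (hx.2 _ (S.b_mem a))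
    rw [S.inner_eq_sum a y, S.inner_eq_sum a y] at h1
    have h2 := (Finset.sum_eq_sum_iff_of_le fun j _ => mul_le_mul_of_nonneg_left
      (S.inner_le_of_mem (S.valid a j) hx.1) (S.coeff_nonneg ha j)).1 h1 i (Finset.mem_univ i)
    exact mul_left_cancel₀ (div_pos hipos (S.pos a i)).ne' h2
  have hνF : S.ν a i ∈ (vectorSpan ℝ F)ᗮ := by
    rw [mem_orthogonal_vectorSpan]
    intro x hx z hz
    rw [htight x hx, htight z hz]
  obtain ⟨t, rfl⟩ := S.exists_eq_smul_of_facet hF hνF (S.ν_ne_zero a i) hyF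
  refine ⟨a, i, hνF, t, ?_, rfl⟩
  rw [real_inner_smul_right] at hipos
  exact (pos_iff_pos_of_mul_pos hipos).2 (S.pos a i)

theorem exists_facet_of_ν (a : A) (i : ι a) {t : ℝ} (ht : 0 < t) :
    ∃ F, IsPolytopeFacet S.polytope F ∧ IsOuterNormal S.polytope F (t • S.ν a i) ∧
      S.b a ∈ F := by
  set F := {x | x ∈ S.polytope ∧ ∀ z ∈ S.polytope,
    inner ℝ (t • S.ν a i) z ≤ inner ℝ (t • S.ν a i) x} with hF
  have hy : IsOuterNormal S.polytope F (t • S.ν a i) := rfl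
  have hmax : ∀ z ∈ S.polytope, inner ℝ (S.ν a i) z ≤ inner ℝ (S.ν a i) (S.b a) := fun z hz =>
    S.inner_le_of_mem (S.valid a i) hz
  have hmem : ∀ x ∈ S.polytope, inner ℝ (S.ν a i) x = inner ℝ (S.ν a i) (S.b a) → x ∈ F := by
    intro x hx hx'
    refine ⟨hx, fun z hz => ?_⟩
    rw [real_inner_smul_left, real_inner_smul_left, hx']
    exact mul_le_mul_of_nonneg_left (hmax z hz) ht.le
  have hb := hmem _ (S.b_mem a) rfl
  refine ⟨F, ⟨fun _ => ⟨InnerProductSpace.toDual ℝ V (t • S.ν a i), rfl⟩, ⟨_, hb⟩, ?_⟩, hy, hb⟩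
  -- The neighbours of `b a` in the directions `r a j` with `j ≠ i` lie in `F`, so a vector
  -- orthogonal to `F` has no coordinates other than the one along `ν a i`.
  have horth : (vectorSpan ℝ F)ᗮ = Submodule.span ℝ {S.ν a i} := by
    apply le_antisymm
    · intro w hw
      rw [mem_orthogonal_vectorSpan] at hw
      rw [Submodule.mem_span_singleton]
      refine ⟨inner ℝ (S.r a i) w / inner ℝ (S.r a i) (S.ν a i), ?_⟩
      conv_rhs => rw [S.eq_sum a w]
      rw [Finset.sum_eq_single i]
      · intro j _ hji
        obtain ⟨a', μ, hμ, ha'⟩ := S.nbr a j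
        have h1 : S.b a' ∈ F := by
          apply hmem _ (S.b_mem a')
          rw [ha', inner_sub_right, real_inner_smul_right, real_inner_comm (S.r a j),
            S.orth a j i hji, mul_zero, sub_zero]
        have h2 := hw _ hb _ h1
        rw [ha', inner_sub_right, real_inner_smul_right] at h2
        have h3 : μ * inner ℝ w (S.r a j) = 0 := by linarith
        rw [real_inner_comm, (mul_eq_zero.1 h3).resolve_left hμ.ne']
        simp
      · simp
    · rw [Submodule.span_singleton_le_iff_mem]
      have := S.mem_orthogonal_of_isOuterNormal hy
      rwa [Submodule.smul_mem_iff _ ht.ne'] at this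
  have h1 := (vectorSpan ℝ F).finrank_add_finrank_orthogonal
  rw [horth, finrank_span_singleton (S.ν_ne_zero a i)] at h1
  rw [S.vectorSpan_polytope, finrank_top, h1]

theorem exists_facet_iff (y : V) :
    (∃ F, IsPolytopeFacet S.polytope F ∧ IsOuterNormal S.polytope F y) ↔
      ∃ a i, ∃ t : ℝ, 0 < t ∧ y = t • S.ν a i := by
  constructor
  · rintro ⟨F, hF, hy⟩
    obtain ⟨a, i, -, h⟩ := S.exists_ν_of_facet hF hy
    exact ⟨a, i, h⟩
  · rintro ⟨a, i, t, ht, rfl⟩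
    obtain ⟨F, h1, h2, -⟩ := S.exists_facet_of_ν a i ht
    exact ⟨F, h1, h2⟩

theorem exists_facet_orthogonal_iff (y : V) :
    (y ≠ 0 ∧ ∃ F, IsPolytopeFacet S.polytope F ∧ ∀ x ∈ F, ∀ z ∈ F, inner ℝ y x = inner ℝ y z) ↔
      ∃ a i, ∃ t : ℝ, t ≠ 0 ∧ y = t • S.ν a i := by
  constructor
  · rintro ⟨hy0, F, hF, hy⟩
    obtain ⟨l, hl⟩ := hF.1 hF.2.1
    have h0 : IsOuterNormal S.polytope F ((InnerProductSpace.toDual ℝ V).symm l) := by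
      rw [IsOuterNormal]
      simp only [InnerProductSpace.toDual_symm_apply]
      exact hl
    obtain ⟨a, i, hν, -⟩ := S.exists_ν_of_facet hF h0
    obtain ⟨t, rfl⟩ := S.exists_eq_smul_of_facet hF hν (S.ν_ne_zero a i)
      (mem_orthogonal_vectorSpan.2 hy)
    exact ⟨a, i, t, fun h => hy0 (by rw [h, zero_smul]), rfl⟩
  · rintro ⟨a, i, t, ht, rfl⟩
    obtain ⟨F, h1, h2, -⟩ := S.exists_facet_of_ν a i one_pos
    rw [one_smul] at h2
    refine ⟨smul_ne_zero ht (S.ν_ne_zero a i), F, h1, fun x hx z hz => ?_⟩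
    rw [real_inner_smul_left, real_inner_smul_left,
      mem_orthogonal_vectorSpan.1 (S.mem_orthogonal_of_isOuterNormal h2) x hx z hz]

end VertexSystem

namespace CoxeterData

variable {B V : Type*} [NormedAddCommGroup V] [InnerProductSpace ℝ V]
variable (D : CoxeterData B V) [FiniteDimensional ℝ V] [Fintype B]

/-! ### The permutahedron -/

variable {D} in
theorem one_bruhatLE {w : V ≃ₗᵢ[ℝ] V} (hw : w ∈ D.W) : D.BruhatLE 1 w := by
  obtain ⟨u, hu, rfl⟩ := D.exists_reduced hw
  have h : ∀ k ≤ u.length, D.BruhatLE 1 (D.prefixProd u k) := by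
    intro k
    induction k with
    | zero => intro _; exact .refl
    | succ k ih =>
      intro hk
      rw [D.prefixProd_succ u hk]
      exact (ih (by omega)).tail (bruhatStep_mul_simple (D.prefixProd_mem u k) (hu.ht_pos hk))
  have := h _ le_rfl
  rwa [prefixProd_of_length_le _ _ le_rfl] at this

variable {D} in
theorem inner_weight_map_basePoint_le {w : V ≃ₗᵢ[ℝ] V} (hw : w ∈ D.W) (s : B) :
    inner ℝ (D.weight s) (w D.basePoint) ≤ inner ℝ (D.weight s) D.basePoint :=
  (one_bruhatLE hw).inner_le (fun t => inner_root_weight_nonneg t s) inner_root_basePoint_nonneg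

/-- The vertices and facet normals of the permutahedron. -/
noncomputable def permutahedronSystem : VertexSystem V D.W (fun _ => B) where
  b w := (w : V ≃ₗᵢ[ℝ] V) D.basePoint
  ν w s := (w : V ≃ₗᵢ[ℝ] V) (D.weight s)
  r w s := (w : V ≃ₗᵢ[ℝ] V) (D.root s)
  card _ := (finrank_eq_card_basis D.root).symm
  orth w s t hst := by
    rw [LinearIsometryEquiv.inner_map_map, D.inner_root_weight_of_ne hst]
  pos w s := by
    rw [LinearIsometryEquiv.inner_map_map, inner_root_weight_self]
    exact half_pos (D.inner_root_self_pos s)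
  nbr w s := by
    refine ⟨⟨w * D.simple s, mul_mem w.2 (D.simple_mem s)⟩, 1, one_pos, ?_⟩
    rw [one_smul, LinearIsometryEquiv.mul_app, simple_basePoint, map_sub]
  valid w s w' := by
    rw [LinearIsometryEquiv.inner_map_map, ← LinearIsometryEquiv.inner_inv_right,
      ← LinearIsometryEquiv.mul_app]
    exact inner_weight_map_basePoint_le (mul_mem (inv_mem w.2) w'.2) s

theorem polytope_permutahedronSystem :
    D.permutahedronSystem.polytope = D.balancedPermutahedron := by
  rw [VertexSystem.polytope, balancedPermutahedron]
  congr 1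
  ext x
  constructor
  · rintro ⟨w, rfl⟩
    exact ⟨w, w.2, rfl⟩
  · rintro ⟨w, hw, rfl⟩
    exact ⟨⟨w, hw⟩, rfl⟩

theorem removeFacetsNotMeeting_permutahedron {X : Set V} {G : Set (V ≃ₗᵢ[ℝ] V)}
    (hG : ∀ g ∈ G, g ∈ D.W) (hX : X = {x | ∃ g ∈ G, x = g D.basePoint}) :
    removeFacetsNotMeeting D.balancedPermutahedron X =
      {x | ∀ g ∈ G, ∀ s, inner ℝ (g (D.weight s)) x ≤ inner ℝ (D.weight s) D.basePoint} := by
  have := D.finite_W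
  subst hX
  rw [← polytope_permutahedronSystem]
  ext x
  constructor
  · intro hx g hg s
    obtain ⟨F, hF, hy, hb⟩ := D.permutahedronSystem.exists_facet_of_ν ⟨g, hG g hg⟩ s one_pos
    have h1 := hx F hF ⟨_, hb, g, hg, rfl⟩ _ hy _ hb
    rw [one_smul] at h1
    have h2 : inner ℝ (D.permutahedronSystem.ν ⟨g, hG g hg⟩ s)
        (D.permutahedronSystem.b ⟨g, hG g hg⟩) = inner ℝ (D.weight s) D.basePoint :=
      g.inner_map_map _ _
    rw [h2] at h1
    exact h1
  -- A facet meeting `X` contains some vertex `g(q)`, so its normal is a nonnegative combination of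
  -- the vectors `g(ω_s)` and its inequality follows from theirs.
  · rintro hx F hF ⟨z', hz', g, hg, rfl⟩ y hy z hz
    have hgz := VertexSystem.mem_orthogonal_vectorSpan.1
      (D.permutahedronSystem.mem_orthogonal_of_isOuterNormal hy) _ hz _ hz'
    rw [hgz]
    rw [hy] at hz'
    have hmax : ∀ a, inner ℝ y (D.permutahedronSystem.b a) ≤
        inner ℝ y (D.permutahedronSystem.b ⟨g, hG g hg⟩) := fun a =>
      hz'.2 _ (D.permutahedronSystem.b_mem a)
    rw [D.permutahedronSystem.inner_eq_sum ⟨g, hG g hg⟩ y,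
      D.permutahedronSystem.inner_eq_sum ⟨g, hG g hg⟩ y]
    refine Finset.sum_le_sum fun s _ => mul_le_mul_of_nonneg_left ?_
      (D.permutahedronSystem.coeff_nonneg hmax s)
    exact (hx g hg s).trans_eq (g.inner_map_map _ _).symm

/-! ### The brick polytope -/

section Brick

variable {D} {c u : List B} {w₀ : V ≃ₗᵢ[ℝ] V}

variable (D) in
/-- The normal vector at a position of `c ++ u`. -/
noncomputable def positionNormal (c u : List B) (k : Fin (c ++ u).length) : V :=
  D.prefixProd u (k + 1 - c.length) (D.weight (c ++ u)[k])

theorem length_eq_card (hc : c.Nodup) (hall : ∀ s, s ∈ c) : c.length = Fintype.card B := by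
  classical
  simpa using Fintype.card_congr (hc.getEquivOfForallMemList c hall)

variable [DecidableEq B]

theorem exists_prefixFacet_at (hc : c.Nodup) (hall : ∀ s, s ∈ c)
    (halt : D.IsAlternating c (c ++ u)) (hu : D.IsReduced u) (huw : D.wordProd u = w₀)
    (k : Fin (c ++ u).length) : ∃ I, D.IsPrefixFacet c u w₀ (k + 1 - c.length) I ∧ k ∈ I := by
  have h1 := k.2
  have e : (c ++ u).length = c.length + u.length := List.length_append
  obtain ⟨I, hI⟩ := exists_isPrefixFacet hc hall halt hu huw (k + 1 - c.length) (by omega)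
  exact ⟨I, hI, hI.mem_of_eq hc⟩

theorem IsFacet.hasNormal (hw₀ : D.IsLongest w₀) (hc : c.Nodup) (hall : ∀ s, s ∈ c)
    (halt : D.IsAlternating c (c ++ u)) (hu : D.IsReduced u) (huw : D.wordProd u = w₀)
    {J : Finset (Fin (c ++ u).length)} (hJ : D.IsFacet (c ++ u) w₀ J) {k : Fin (c ++ u).length}
    (hk : k ∈ J) :
    D.HasNormal (c ++ u) k (D.positionNormal c u k)
      (inner ℝ (D.positionNormal c u k) (D.sortingShift u) +
        inner ℝ (D.weight (c ++ u)[k]) D.basePoint) J := by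
  obtain ⟨I, hI, hkI⟩ := exists_prefixFacet_at hc hall halt hu huw k
  exact (hI.hasNormal hkI).of_isFacet hw₀ hI.isFacet hJ hkI hk

/-- The vertices and facet normals of the brick polytope. -/
noncomputable def brickSystem (hw₀ : D.IsLongest w₀) (hc : c.Nodup) (hall : ∀ s, s ∈ c)
    (halt : D.IsAlternating c (c ++ u)) (hu : D.IsReduced u) (huw : D.wordProd u = w₀) :
    VertexSystem V {I // D.IsFacet (c ++ u) w₀ I} (fun I => I.1) where
  b I := D.brickVector (c ++ u) I
  ν _ k := D.positionNormal c u k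
  r I k := D.rootFunction (c ++ u) I k
  card I := by
    have h1 := (D.isFacet_iff.1 I.2).1
    have e : (c ++ u).length = c.length + u.length := List.length_append
    have h3 : D.length w₀ = u.length := by rw [← huw, hu]
    rw [Finset.card_compl, Fintype.card_fin] at h1
    have h2 := Finset.card_le_univ I.1
    rw [Fintype.card_fin] at h2
    rw [Fintype.card_coe, finrank_eq_card_basis D.root, ← length_eq_card hc hall]
    omega
  orth I i j hij := (I.2.hasNormal hw₀ hc hall halt hu huw j.2).1 i i.2 fun h => hij (Subtype.ext h)
  pos I i := by
    rw [← (I.2.hasNormal hw₀ hc hall halt hu huw i.2).2.1]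
    exact D.inner_rootFunction_weightFunction_self _ _ _
  nbr I i := by
    obtain ⟨j, hj, ⟨r, hr0, hr⟩, ⟨μ, hμ, h⟩, -⟩ := I.2.exists_flip hw₀ i.2
    exact ⟨⟨_, I.2.flip i.2 hj hr0 hr⟩, μ, hμ, h⟩
  valid I i J := by
    rw [(I.2.hasNormal hw₀ hc hall halt hu huw i.2).2.2]
    obtain ⟨K, hK, -⟩ := exists_prefixFacet_at hc hall halt hu huw i
    exact hK.inner_brickVector_le J.2 _

theorem polytope_brickSystem (hw₀ : D.IsLongest w₀) (hc : c.Nodup) (hall : ∀ s, s ∈ c)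
    (halt : D.IsAlternating c (c ++ u)) (hu : D.IsReduced u) (huw : D.wordProd u = w₀) :
    (brickSystem hw₀ hc hall halt hu huw).polytope = D.brickPolytope (c ++ u) w₀ := by
  rw [VertexSystem.polytope, brickPolytope]
  congr 1
  ext x
  constructor
  · rintro ⟨I, rfl⟩
    exact ⟨I.1, I.2, rfl⟩
  · rintro ⟨I, hI, rfl⟩
    exact ⟨⟨I, hI⟩, rfl⟩

theorem nonempty_facet (hc : c.Nodup) (hall : ∀ s, s ∈ c) (hu : D.IsReduced u)
    (huw : D.wordProd u = w₀) : Nonempty {I // D.IsFacet (c ++ u) w₀ I} :=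
  ⟨⟨_, (isPrefixFacet_initial hc hall hu huw).isFacet⟩⟩

/-- All the inequalities at the points `ρ_p(q)` hold because prefix facets maximize `ρ_p(ω_s)` for
every `s`. Conversely, each facet normal of the brick system is one of these vectors, with the same
bound after translation by `Ω`. -/
theorem mem_brickPolytope_iff (hw₀ : D.IsLongest w₀) (hc : c.Nodup) (hall : ∀ s, s ∈ c)
    (halt : D.IsAlternating c (c ++ u)) (hu : D.IsReduced u) (huw : D.wordProd u = w₀) (x : V) :
    x + D.sortingShift u ∈ D.brickPolytope (c ++ u) w₀ ↔
      ∀ p ≤ u.length, ∀ s,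
        inner ℝ (D.prefixProd u p (D.weight s)) x ≤ inner ℝ (D.weight s) D.basePoint := by
  have := nonempty_facet hc hall hu huw
  rw [← polytope_brickSystem hw₀ hc hall halt hu huw]
  constructor
  · intro hx p hp s
    obtain ⟨I, hI⟩ := exists_isPrefixFacet hc hall halt hu huw p hp
    have h1 := (brickSystem hw₀ hc hall halt hu huw).inner_le_of_mem
      (fun J => hI.inner_brickVector_le J.2 s) hx
    rw [inner_add_right] at h1
    linarith
  · intro hx
    rw [VertexSystem.polytope_eq]
    intro I k
    have e : (c ++ u).length = c.length + u.length := List.length_append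
    have h1 := hx (k + 1 - c.length) (by have := k.1.2; omega) (c ++ u)[k.1]
    have h2 : inner ℝ (D.positionNormal c u k) (D.brickVector (c ++ u) I) = _ :=
      (I.2.hasNormal hw₀ hc hall halt hu huw k.2).2.2
    change inner ℝ (D.positionNormal c u k) (x + D.sortingShift u) ≤
      inner ℝ (D.positionNormal c u k) (D.brickVector (c ++ u) I)
    rw [h2, inner_add_right, positionNormal]
    linarith

theorem exists_ν_brickSystem_iff (hw₀ : D.IsLongest w₀) (hc : c.Nodup) (hall : ∀ s, s ∈ c)
    (halt : D.IsAlternating c (c ++ u)) (hu : D.IsReduced u) (huw : D.wordProd u = w₀)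
    (P : V → Prop) :
    (∃ I i, P ((brickSystem hw₀ hc hall halt hu huw).ν I i)) ↔
      ∃ v ∈ Set.range D.weight ∪
        Set.range (fun p : Fin u.length => D.prefixProd u (p + 1) (D.weight (u.get p))), P v := by
  have e : (c ++ u).length = c.length + u.length := List.length_append
  have hex : ∀ k, P (D.positionNormal c u k) →
      ∃ I i, P ((brickSystem hw₀ hc hall halt hu huw).ν I i) := by
    intro k hk
    obtain ⟨I, hI, hkI⟩ := exists_prefixFacet_at hc hall halt hu huw k
    exact ⟨⟨I, hI.isFacet⟩, ⟨k, hkI⟩, hk⟩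
  constructor
  · rintro ⟨I, ⟨k, hk⟩, hP⟩
    refine ⟨_, ?_, hP⟩
    change D.positionNormal c u k ∈ _
    have hkl := k.2
    by_cases hkc : (k : ℕ) < c.length
    · left
      refine ⟨(c ++ u)[k], ?_⟩
      rw [positionNormal, Nat.sub_eq_zero_of_le hkc, prefixProd_zero, LinearIsometryEquiv.one_app]
    · right
      refine ⟨⟨k - c.length, by omega⟩, ?_⟩
      have h1 : (k : ℕ) + 1 - c.length = k - c.length + 1 := by omega
      rw [positionNormal, Fin.getElem_fin, List.getElem_append_right (not_lt.1 hkc), h1]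
      rfl
  · rintro ⟨v, ⟨s, rfl⟩ | ⟨p, rfl⟩, hP⟩
    · obtain ⟨i, hi, rfl⟩ := List.mem_iff_getElem.1 (hall s)
      apply hex ⟨i, by omega⟩
      rw [positionNormal, Nat.sub_eq_zero_of_le hi, prefixProd_zero, LinearIsometryEquiv.one_app,
        Fin.getElem_fin, List.getElem_append_left hi]
      exact hP
    · apply hex ⟨c.length + p, by omega⟩
      have h1 : c.length + (p : ℕ) + 1 - c.length = p + 1 := by omega
      have h2 : (c ++ u)[(⟨c.length + p, by omega⟩ : Fin (c ++ u).length)] = u.get p := by simp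
      rw [positionNormal, h1, h2]
      exact hP

/-! ### Comparison of the two descriptions of the normals -/

theorem IsSortingWord.exists_weight_eq_neg (hu : D.IsSortingWord c w₀ u) (hc : c.Nodup)
    (hall : ∀ s, s ∈ c) (hw₀ : D.IsLongest w₀) (t : B) :
    ∃ s, ∃ r : ℝ, 0 < r ∧ w₀ (D.weight t) = -(r • D.weight s) := by
  obtain ⟨p, h, hmin⟩ := hu
  have hlen := h.length_eq
  have hne : c ≠ [] := List.ne_nil_of_mem (hall t)
  have hpos : 0 < c.length := List.length_pos_iff.2 hne
  -- This position lies beyond every entry of `p`, each being at most `p.sum`, and beyond `mult c t`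
  -- copies of `c`. So the whole word has been read and `t` is exhausted.
  obtain ⟨j, hj, h1, h2, h3⟩ := h.exists_state hc hall hne hw₀ hmin
    (c.length * (D.mult c t + p.sum + 1))
  have hjl : j = u.length := by
    by_contra hjne
    have hjp : j < p.length := by omega
    have h4 := h2 j hjp le_rfl
    have h5 : p[j] ≤ p.sum := List.le_sum_of_mem (List.getElem_mem hjp)
    nlinarith
  have h4 := (h3 t).1
  have h5 : D.mult c t ≤ occurrences c (c.length * (D.mult c t + p.sum + 1)) t := by
    rw [occurrences, Nat.mul_div_cancel_left _ hpos]
    omega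
  rw [min_eq_left h5, hjl, prefixProd_of_length_le _ _ le_rfl, h.2.2.2] at h4
  rw [h4]
  exact D.exists_cWeight_mult hc hall t

theorem prefixProd_weight_next (u : List B) (t : B) (n k : ℕ) (hk : k + n = u.length) :
    (∃ p : Fin u.length, u.get p = t ∧
        D.prefixProd u p (D.weight (u.get p)) = D.prefixProd u k (D.weight t)) ∨
      D.wordProd u (D.weight t) = D.prefixProd u k (D.weight t) := by
  induction n generalizing k with
  | zero => right; rw [prefixProd_of_length_le _ _ (by omega)]
  | succ n ih =>
    have hk' : k < u.length := by omega
    by_cases h : u[k] = t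
    · left
      exact ⟨⟨k, hk'⟩, h, by rw [List.get_eq_getElem, h]⟩
    · have h1 : D.prefixProd u (k + 1) (D.weight t) = D.prefixProd u k (D.weight t) := by
        rw [D.prefixProd_succ u hk', LinearIsometryEquiv.mul_app, D.simple_weight_of_ne h]
      rw [← h1]
      exact ih (k + 1) (by omega)

theorem prefixProd_weight_previous (u : List B) (t : B) (k : ℕ) (hk : k ≤ u.length) :
    D.prefixProd u k (D.weight t) = D.weight t ∨ ∃ p : Fin u.length, u.get p = t ∧
      D.prefixProd u (p + 1) (D.weight (u.get p)) = D.prefixProd u k (D.weight t) := by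
  induction k with
  | zero => left; rfl
  | succ k ih =>
    by_cases h : u[k] = t
    · right
      exact ⟨⟨k, hk⟩, h, by rw [List.get_eq_getElem, h]⟩
    · have h1 : D.prefixProd u (k + 1) (D.weight t) = D.prefixProd u k (D.weight t) := by
        rw [D.prefixProd_succ u hk, LinearIsometryEquiv.mul_app, D.simple_weight_of_ne h]
      rw [h1]
      exact ih (by omega)

/-- Along the prefixes of `u` the image of `ω_t` changes only at the letter `t`. Taking the values
after these letters omits the initial value `ω_t`, and taking those before them omits the final
value `w₀ ω_t`. Both are nonzero multiples of fundamental weights, which belong to either list. -/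
theorem IsSortingWord.exists_smul_normal_iff (hu : D.IsSortingWord c w₀ u) (hc : c.Nodup)
    (hall : ∀ s, s ∈ c) (hw₀ : D.IsLongest w₀) (huw : D.wordProd u = w₀) (y : V) :
    (∃ v ∈ Set.range D.weight ∪
        Set.range (fun p : Fin u.length => D.prefixProd u (p + 1) (D.weight (u.get p))),
          ∃ t : ℝ, t ≠ 0 ∧ y = t • v) ↔
      ∃ v ∈ Set.range D.weight ∪
        Set.range (fun p : Fin u.length => D.prefixProd u p (D.weight (u.get p))),
          ∃ t : ℝ, t ≠ 0 ∧ y = t • v := by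
  constructor
  · rintro ⟨v, ⟨s, rfl⟩ | ⟨p, rfl⟩, t, ht, rfl⟩
    · exact ⟨_, Or.inl ⟨s, rfl⟩, t, ht, rfl⟩
    · rcases prefixProd_weight_next (D := D) u (u.get p) (u.length - (p + 1)) (p + 1)
        (by omega) with ⟨p', -, h⟩ | h
      · exact ⟨_, Or.inr ⟨p', rfl⟩, t, ht, by simp only [h]⟩
      · obtain ⟨s, r, hr0, hr⟩ := hu.exists_weight_eq_neg hc hall hw₀ (u.get p)
        refine ⟨_, Or.inl ⟨s, rfl⟩, -(t * r), neg_ne_zero.2 (mul_ne_zero ht hr0.ne'), ?_⟩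
        simp only
        rw [← h, huw, hr, smul_neg, smul_smul, neg_smul]
  · rintro ⟨v, ⟨s, rfl⟩ | ⟨p, rfl⟩, t, ht, rfl⟩
    · exact ⟨_, Or.inl ⟨s, rfl⟩, t, ht, rfl⟩
    · rcases prefixProd_weight_previous (D := D) u (u.get p) p p.2.le with h | ⟨p', -, h⟩
      · exact ⟨_, Or.inl ⟨u.get p, rfl⟩, t, ht, by simp only [h]⟩
      · exact ⟨_, Or.inr ⟨p', rfl⟩, t, ht, by simp only [h]⟩

end Brick

end CoxeterData

/-! ### The main theorem, assembled from the two vertex systems -/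

theorem mainTheorem7 {V : Type*} [NormedAddCommGroup V] [InnerProductSpace ℝ V]
    [FiniteDimensional ℝ V] {B : Type*} [Fintype B] (D : CoxeterData B V)
    (c : List B) (hc : D.IsReduced c) (hcox : D.IsCoxeterElement (D.wordProd c))
    (w₀ : V ≃ₗᵢ[ℝ] V) (hw₀ : D.IsLongest w₀)
    (u : List B) (hu : D.IsSortingWord c w₀ u) :
    -- the brick polytope is the translate by `Ω` of the permutahedron with facets removed
    D.brickPolytope (c ++ u) w₀ =
        (fun x => x + ∑ p : Fin u.length, D.prefixProd u p (D.weight (u.get p))) ''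
          removeFacetsNotMeeting D.balancedPermutahedron
            {x | ∃ p ≤ u.length, x = D.prefixProd u p D.basePoint} ∧
    -- its outer facet normals
    (∀ y : V,
      (∃ F, IsPolytopeFacet (D.brickPolytope (c ++ u) w₀) F ∧
          IsOuterNormal (D.brickPolytope (c ++ u) w₀) F y) ↔
        ∃ v ∈ Set.range D.weight ∪
            Set.range (fun p : Fin u.length => D.prefixProd u (p + 1) (D.weight (u.get p))),
          ∃ t : ℝ, 0 < t ∧ y = t • v) ∧
    -- its facet normals, up to sign
    (∀ y : V,
      (y ≠ 0 ∧ ∃ F, IsPolytopeFacet (D.brickPolytope (c ++ u) w₀) F ∧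
          ∀ x ∈ F, ∀ z ∈ F, inner ℝ y x = inner ℝ y z) ↔
        ∃ v ∈ Set.range D.weight ∪
            Set.range (fun p : Fin u.length => D.prefixProd u p (D.weight (u.get p))),
          ∃ t : ℝ, t ≠ 0 ∧ y = t • v) := by
  classical
  obtain ⟨hnd, hall⟩ := CoxeterData.IsCoxeterElement.nodup_and_mem hc hcox
  have hred : D.IsReduced u := by
    obtain ⟨p, h, -⟩ := hu
    exact h.2.2.1
  have huw : D.wordProd u = w₀ := by
    obtain ⟨p, h, -⟩ := hu
    exact h.2.2.2
  have halt : D.IsAlternating c (c ++ u) := CoxeterData.isAlternating_append hnd hall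
    fun j hj t hadj => hu.count_eq hnd hall hw₀ hj hadj
  have := CoxeterData.nonempty_facet hnd hall hred huw
  have hpoly := CoxeterData.polytope_brickSystem hw₀ hnd hall halt hred huw
  refine ⟨?_, fun y => ?_, fun y => ?_⟩
  · rw [D.removeFacetsNotMeeting_permutahedron (G := {g | ∃ p ≤ u.length, g = D.prefixProd u p})
      (by rintro _ ⟨p, -, rfl⟩; exact D.prefixProd_mem u p) (by
        ext x
        constructor
        · rintro ⟨p, hp, rfl⟩
          exact ⟨_, ⟨p, hp, rfl⟩, rfl⟩
        · rintro ⟨_, ⟨p, hp, rfl⟩, rfl⟩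
          exact ⟨p, hp, rfl⟩)]
    ext x
    obtain ⟨x, rfl⟩ : ∃ z, x = z + D.sortingShift u := ⟨x - D.sortingShift u, by abel⟩
    rw [CoxeterData.mem_brickPolytope_iff hw₀ hnd hall halt hred huw]
    constructor
    · intro hx
      refine ⟨x, ?_, rfl⟩
      rintro _ ⟨p, hp, rfl⟩ s
      exact hx p hp s
    · rintro ⟨z, hz, hzx⟩ p hp s
      obtain rfl : z = x := add_right_cancel hzx
      exact hz _ ⟨p, hp, rfl⟩ s
  · rw [← hpoly, VertexSystem.exists_facet_iff]
    exact CoxeterData.exists_ν_brickSystem_iff hw₀ hnd hall halt hred huw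
      fun v => ∃ t : ℝ, 0 < t ∧ y = t • v
  · rw [← hpoly, VertexSystem.exists_facet_orthogonal_iff,
      ← hu.exists_smul_normal_iff hnd hall hw₀ huw]
    exact CoxeterData.exists_ν_brickSystem_iff hw₀ hnd hall halt hred huw
      fun v => ∃ t : ℝ, t ≠ 0 ∧ y = t • v
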